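/- \textbf{Theorem (Squared Function Theorem).} Let $K\subseteq\mathbb{C}$ be an admissible amplitude set, i.e. $\{0,\pm1\}\subseteq K$ and $K$ is closed under addition, subtraction, multiplication, division, complex conjugation and square root. If $f\in\mathrm{GapQP}_K$, then $f^2\in\#\mathrm{QP}_K$, where $f^2(x)=(f(x))^2$. Here a quantum Turing machine (QTM) $M$ has finitely many two-way infinite tapes, with cells indexed by $\mathbb{Z}$ (among them a designated input tape and a designated output tape), a finite alphabet with a blank for each tape, a finite state set $Q$ with an initial state $q_0$ and a nonempty set $Q_f\subseteq Q\setminus\{q_0\}$ of final states, and a total transition function $\delta$ that assigns a complex amplitude to each combination of current state, scanned symbols, new state, written symbols and head moves in $\{\mathrm{left},\mathrm{none},\mathrm{right}\}$. It induces a linear time-evolution operator $U_M$ on the superpositions of configurations. $M$ is well-formed if $U_M$ preserves the $L_2$-norm, and it has $K$-amplitudes if all values of $\delta$ lie in $K$. On input $x\in\{0,1\}^*$ it starts in state $q_0$ with $x$ on the input tape (leftmost symbol in cell $0$), all other cells blank and all heads on cell $0$; on a qustring of size $n$ (a unit vector in the span of $\{0,1\}^n$) it starts in the corresponding superposition. The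 running time of $M$ on an input is the least $t$ such that all computation paths are simultaneously in final configurations (configurations with a state in $Q_f$) at time $t$; a computation path is a sequence of configurations, beginning with an initial configuration present in the input, in which each is obtained from its predecessor by one application of $\delta$ with nonzero amplitude. $M$ is polynomial-time if there is a polynomial $p\in\mathbb{N}[X]$ such that, for every $n$, $M$ has running time exactly $p(n)$ on every qustring of size $n$. The acceptance probability $\rho_M(x)$ is the sum of the squared magnitudes, in the superposition reached at the running time on $x$, of the final configurations with the symbol $1$ in cell $0$ of the output tape; the rejection probability $\overline{\rho}_M(x)$ is the same sum over all other final configurations. The class $\#\mathrm{QP}_K$ consists of the functions $x\mapsto\rho_M(x)$ on $\{0,1\}^*$, and $\mathrm{GapQP}_K$ of the functions $x\mapsto\rho_M(x)-\overline{\rho}_M(x)=2\rho_M(x)-1$, where $M$ ranges over all polynomial-time well-formed QTMs with $K$-amplitudes. -/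

import Mathlib

/-- Head moves: left, no move, right. -/
inductive HeadMove : Type
  | L | N | R
  deriving DecidableEq

instance : Fintype HeadMove where
  elems := {HeadMove.L, HeadMove.N, HeadMove.R}
  complete := by intro d; cases d <;> decide

/-- The displacement of a head move on the tape, whose cells are indexed by the integers. -/
def HeadMove.toInt : HeadMove → ℤ
  | L => -1
  | N => 0
  | R => 1

/-- A multi-tape quantum Turing machine with two-way infinite tapes and flexible head moves.
All alphabets are finite sets of symbols taken from one type `Symb` of symbols, which contains the
blank and the two bits; one tape is designated as the input tape and one as the output tape
(they may be the same tape, as they have to be for a one-tape machine). -/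
structure QTM : Type 1 where
  /-- number of tapes -/
  k : ℕ
  /-- internal states -/
  Q : Type
  [fintypeQ : Fintype Q]
  /-- initial state -/
  q₀ : Q
  /-- final states -/
  Qf : Set Q
  Qf_nonempty : Qf.Nonempty
  q₀_notMem : q₀ ∉ Qf
  /-- symbols -/
  Symb : Type
  blank : Symb
  bit : Bool → Symb
  bit_injective : Function.Injective bit
  bit_ne_blank : ∀ b, bit b ≠ blank
  /-- input/output alphabet of each tape (possibly empty) -/
  ioAlph : Fin k → Finset Symb
  /-- tape alphabet of each tape -/
  tapeAlph : Fin k → Finset Symb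
  ioAlph_subset : ∀ i, ioAlph i ⊆ tapeAlph i
  blank_mem : ∀ i, blank ∈ tapeAlph i
  blank_notMem : ∀ i, blank ∉ ioAlph i
  inputTape : Fin k
  outputTape : Fin k
  bit_mem : ∀ b, bit b ∈ ioAlph inputTape
  /-- `δ p σ q τ d` is the amplitude of entering state `q`, writing `τ` and moving the heads
  by `d` when in state `p` and reading `σ` -/
  δ : Q → (∀ i, tapeAlph i) → Q → (∀ i, tapeAlph i) → (Fin k → HeadMove) → ℂ

attribute [instance] QTM.fintypeQ

namespace QTM

/-- The type of `k`-tuples of tape symbols. -/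
abbrev Symbols (M : QTM) : Type := ∀ i, M.tapeAlph i

/-- The blank as a symbol of tape `i`. -/
def blankAt (M : QTM) (i : Fin M.k) : M.tapeAlph i := ⟨M.blank, M.blank_mem i⟩

/-- Configurations: an internal state, the head positions and the tape contents (all but finitely
many cells are blank). -/
@[ext]
structure Conf (M : QTM) : Type where
  state : M.Q
  head : Fin M.k → ℤ
  tape : ∀ i, ℤ → M.tapeAlph i
  finite_nonblank : ∀ i, {z | tape i z ≠ M.blankAt i}.Finite

/-- The symbols scanned by the heads. -/
def Conf.scanned {M : QTM} (c : M.Conf) : M.Symbols := fun i => c.tape i (c.head i)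

/-- The configuration obtained from `c` by entering state `q`, writing `τ` in the scanned cells and
then moving the heads by `d`. -/
def Conf.next {M : QTM} (c : M.Conf) (q : M.Q) (τ : M.Symbols) (d : Fin M.k → HeadMove) :
    M.Conf where
  state := q
  head i := c.head i + (d i).toInt
  tape i := Function.update (c.tape i) (c.head i) (τ i)
  finite_nonblank i := by
    refine ((c.finite_nonblank i).insert (c.head i)).subset fun z hz => ?_
    by_cases h : z = c.head i
    · exact Or.inl h
    · right
      simpa [Function.update_of_ne h] using hz

/-- Superpositions: finite complex linear combinations of configurations. -/
abbrev Superposition (M : QTM) : Type := M.Conf →₀ ℂ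

/-- The image of a configuration under one application of the transition function. -/
noncomputable def stepVec (M : QTM) (c : M.Conf) : M.Superposition :=
  ∑ q : M.Q, ∑ τ : M.Symbols, ∑ d : Fin M.k → HeadMove,
    Finsupp.single (c.next q τ d) (M.δ c.state c.scanned q τ d)

/-- The time-evolution operator. -/
noncomputable def U (M : QTM) : M.Superposition →ₗ[ℂ] M.Superposition :=
  Finsupp.linearCombination ℂ M.stepVec

/-- The `L₂`-norm of a superposition. -/
noncomputable def l2norm {M : QTM} (Φ : M.Superposition) : ℝ :=
  Real.sqrt (Φ.sum fun _ a => ‖a‖ ^ 2)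

/-- A machine is well-formed if its time-evolution operator preserves the `L₂`-norm. -/
def WellFormed (M : QTM) : Prop := ∀ Φ : M.Superposition, l2norm (M.U Φ) = l2norm Φ

/-- All amplitudes of the machine are in `K`. -/
def HasAmplitudes (M : QTM) (K : Set ℂ) : Prop := ∀ p σ q τ d, M.δ p σ q τ d ∈ K

/-- The content of cell `z` of a tape that holds the binary string `x`, with its leftmost symbol in
the start cell `0`. -/
def stringCell (M : QTM) (x : List Bool) (z : ℤ) : M.Symb :=
  if 0 ≤ z then (x[z.toNat]?).elim M.blank M.bit else M.blank

/-- The initial configuration on a classical binary input `x`. -/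
def init (M : QTM) (x : List Bool) : M.Conf where
  state := M.q₀
  head _ := 0
  tape i z := ⟨if i = M.inputTape then M.stringCell x z else M.blank, by
    split_ifs with h
    · subst h
      unfold stringCell
      split_ifs with hz
      · cases x[z.toNat]? with
        | none => exact M.blank_mem _
        | some b => exact M.ioAlph_subset _ (M.bit_mem b)
      · exact M.blank_mem _
    · exact M.blank_mem _⟩
  finite_nonblank i := by
    refine (Set.finite_Ico (0 : ℤ) x.length).subset fun z hz => ?_
    by_contra hcon
    apply hz
    apply Subtype.ext
    change (if i = M.inputTape then M.stringCell x z else M.blank) = M.blank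
    split_ifs with h
    · unfold stringCell
      split_ifs with h0
      · have hlen : x.length ≤ z.toNat := by
          simp only [Set.mem_Ico, not_and, not_lt] at hcon
          have := hcon h0
          omega
        simp [List.getElem?_eq_none hlen]
      · rfl
    · rfl

/-- `c'` is obtained from `c` by a single application of the transition function. -/
def Step (M : QTM) (c c' : M.Conf) : Prop := M.U (Finsupp.single c 1) c' ≠ 0

/-- `γ 0, …, γ t` is a computation path of `M` that starts with a configuration present in `Φ`. -/
def IsPath (M : QTM) (Φ : M.Superposition) (t : ℕ) (γ : ℕ → M.Conf) : Prop :=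
  γ 0 ∈ Φ.support ∧ ∀ s < t, M.Step (γ s) (γ (s + 1))

/-- Final configurations. -/
def Final (M : QTM) (c : M.Conf) : Prop := c.state ∈ M.Qf

/-- At time `t` all computation paths that start in `Φ` are in final configurations. -/
def AllFinalAt (M : QTM) (Φ : M.Superposition) (t : ℕ) : Prop :=
  ∀ γ : ℕ → M.Conf, M.IsPath Φ t γ → M.Final (γ t)

/-- The running time on `Φ` is defined and equals `t`. -/
def HaltsAt (M : QTM) (Φ : M.Superposition) (t : ℕ) : Prop :=
  IsLeast {s | M.AllFinalAt Φ s} t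

/-- The running time on `Φ` (meaningful if `M` halts on `Φ`). -/
noncomputable def runningTime (M : QTM) (Φ : M.Superposition) : ℕ :=
  sInf {s | M.AllFinalAt Φ s}

/-- The final superposition of `M` on `Φ` (meaningful if `M` halts on `Φ`). -/
noncomputable def finalSuperposition (M : QTM) (Φ : M.Superposition) : M.Superposition :=
  (M.U ^ M.runningTime Φ) Φ

end QTM

/-- Qustrings of size `n`: unit vectors over the binary strings of length `n`. -/
def Qustring (n : ℕ) : Type :=
  {φ : List.Vector Bool n → ℂ // Real.sqrt (∑ x, ‖φ x‖ ^ 2) = 1}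

namespace QTM

/-- The initial superposition on a qustring input. -/
noncomputable def initQ (M : QTM) {n : ℕ} (φ : Qustring n) : M.Superposition :=
  ∑ x : List.Vector Bool n, Finsupp.single (M.init x.toList) (φ.1 x)

/-- There is a polynomial `p` such that `M` halts exactly at time `p n` on every qustring of
size `n`. -/
def PolyTime (M : QTM) : Prop :=
  ∃ p : Polynomial ℕ, ∀ (n : ℕ) (φ : Qustring n), M.HaltsAt (M.initQ φ) (p.eval n)

/-- Accepting configurations: final, with the symbol `1` in the start cell of the output tape. -/
def Accepting (M : QTM) (c : M.Conf) : Prop :=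
  M.Final c ∧ (c.tape M.outputTape 0 : M.Symb) = M.bit true

/-- Rejecting configurations: the other final configurations. -/
def Rejecting (M : QTM) (c : M.Conf) : Prop := M.Final c ∧ ¬ M.Accepting c

open Classical in
/-- The acceptance probability `ρ_M(x)` on a classical input `x`. -/
noncomputable def acceptProb (M : QTM) (x : List Bool) : ℝ :=
  (M.finalSuperposition (Finsupp.single (M.init x) 1)).sum fun c a =>
    if M.Accepting c then ‖a‖ ^ 2 else 0

open Classical in
/-- The rejection probability on a classical input `x`. -/
noncomputable def rejectProb (M : QTM) (x : List Bool) : ℝ :=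
  (M.finalSuperposition (Finsupp.single (M.init x) 1)).sum fun c a =>
    if M.Rejecting c then ‖a‖ ^ 2 else 0

end QTM

/-- The class `#QP_K` of polynomial-time quantum probability functions with `K`-amplitudes. -/
def SharpQP (K : Set ℂ) : Set (List Bool → ℝ) :=
  {f | ∃ M : QTM, M.WellFormed ∧ M.PolyTime ∧ M.HasAmplitudes K ∧ ∀ x, f x = M.acceptProb x}

/-- The class `GapQP_K` of polynomial-time quantum probability gap functions with
`K`-amplitudes. -/
def GapQP (K : Set ℂ) : Set (List Bool → ℝ) :=
  {f | ∃ M : QTM, M.WellFormed ∧ M.PolyTime ∧ M.HasAmplitudes K ∧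
    ∀ x, f x = M.acceptProb x - M.rejectProb x}

/-- A set of complex numbers is admissible if it is closed under addition, subtraction,
multiplication, division, complex conjugation and square roots. -/
structure Admissible (K : Set ℂ) : Prop where
  add : ∀ a ∈ K, ∀ b ∈ K, a + b ∈ K
  sub : ∀ a ∈ K, ∀ b ∈ K, a - b ∈ K
  mul : ∀ a ∈ K, ∀ b ∈ K, a * b ∈ K
  div : ∀ a ∈ K, ∀ b ∈ K, b ≠ 0 → a / b ∈ K
  conj : ∀ a ∈ K, (starRingEnd ℂ) a ∈ K
  sqrt : ∀ a : ℂ, a ^ 2 ∈ K → a ∈ K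

/-!
# Squares of gap functions are acceptance probabilities

Let `M` be a well-formed machine with `f x = ρ - ρ'`, where `ρ` and `ρ'` are its probabilities of
acceptance and rejection on `x`, and let `p` be the polynomial of its running time. With `ψ = U ^
p(n) |init x⟩` and with the diagonal operator `Z` that gives the sign `1` to the configurations
with symbol `1` in the start cell of the output tape and the sign `-1` to the others, `f x = ⟨ψ, Z
ψ⟩` (`ip_outSign`). If `U` were invertible, a machine could run `M`, apply `Z`, run `M` backwards,
and accept in the initial configuration only; the amplitude of that configuration being `⟨ψ, Z ψ⟩`,
the acceptance probability would be the square of `f x`.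

A well-formed machine need not be invertible: `U` preserves the norm, but on the infinite tape it
may fail to be surjective. Running backwards is therefore replaced by a unitary dilation on two
copies `Bool × M.Conf` of the configuration space. For a tuple `r` of residues modulo 3, `J r` is
the reflection about the vectors `|0, c⟩ - |1, U c⟩`, where `c` ranges over the configurations with
heads in positions congruent to `r`. These vectors are pairwise orthogonal as `M` is well-formed;
the residues make the reflection local, since a machine that knows them and the present head
positions modulo 3 can find the cells in which the heads of `c` were. The product of all `J r`,
followed by the exchange of the copies, is an operator `G` with `G |0, Φ⟩ = |0, U Φ⟩`
(`G_pow_copy_false`), whose adjoint acts on copy `1` as `U` (`ip_copy_true_G_pow`). Hence `G ^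
p(n)`, then `Z` and the exchange of the copies, then `G ^ p(n)` once more, take `|0, init x⟩` to a
superposition in which `|1, init x⟩` has the amplitude `⟨ψ, Z ψ⟩` (`finalData_apply`).

The machine that does this is given as a cyclic program of gates (`Program`, `Gate`), each of them
an isometry. Its running time has to be the same on all computation paths, and a polynomial in the
length `n` of the input. All control is therefore left to a clock, an odometer of `D` heads which
travel over copies of the input and pass through `(2 * n + 2) ^ D` states in a cycle (`odo_cycle`).
The polynomial `p` is a sum of powers `n ^ j` (`exists_degs`), and a power `n ^ j` is the number of
clock states in which the first `j` heads scan the input on their way to the right and the others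
rest (`card_clkAct`); one step `G` is applied for each power in each of these states. The clock
also measures the sweeps of the simulated heads over the tapes, in which `Z` is applied and the
final configuration is compared with `init x`. By locality (`G_pow_near`) the sweeps reach all
cells concerned when `D` is large (`exists_period_gt`). Deviations from `|1, init x⟩` are counted
by the position of the output head, and the symbol `1` is written where this head stands in the
end, so that it is in cell `0` exactly if there is no deviation (`cnt_eq_zero_iff`). Phase and
clock evolve independently of the simulated data (`prog_ctl`), which gives the running time
(`Program.haltsAt`); `runs_prog` describes the superposition reached then, and
`sum_mapDomain_finalCfg` its acceptance probability.

The entries of the reflections are obtained from the amplitudes of `M` by addition, subtraction,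
multiplication and conjugation, so that the amplitudes stay in `K` (`prog_amp_mem`).
-/

/-! ### Inner product and isometries on finitely supported superpositions -/

namespace SquaredFunction

open ComplexConjugate

/-- The standard Hermitian inner product on `X →₀ ℂ`, conjugate-linear in the first argument and
bundled as a linear form in the second. -/
noncomputable def ip {X : Type*} (Φ : X →₀ ℂ) : (X →₀ ℂ) →ₗ[ℂ] ℂ :=
  Finsupp.linearCombination ℂ fun x => conj (Φ x)

section ip
variable {X Y Z : Type*}

lemma ip_single_right (Φ : X →₀ ℂ) (x : X) (a : ℂ) :
    ip Φ (Finsupp.single x a) = a * conj (Φ x) := by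
  simp [ip]

lemma ip_def (Φ Ψ : X →₀ ℂ) : ip Φ Ψ = Ψ.sum fun x b => b * conj (Φ x) := by
  simp [ip, Finsupp.linearCombination_apply]

lemma ip_conj (Φ Ψ : X →₀ ℂ) : conj (ip Φ Ψ) = ip Ψ Φ := by
  classical
  rw [ip_def, ip_def, Finsupp.sum_of_support_subset _ (Finset.subset_union_left (s₂ := Φ.support)) _
    (by simp), Finsupp.sum_of_support_subset _ (Finset.subset_union_right (s₁ := Ψ.support)) _
    (by simp), map_sum]
  refine Finset.sum_congr rfl fun x _ => ?_
  simp [mul_comm]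

lemma ip_zero_left (Ψ : X →₀ ℂ) : ip 0 Ψ = 0 := by
  rw [← ip_conj, map_zero, map_zero]

lemma ip_add_left (Φ Φ' Ψ : X →₀ ℂ) : ip (Φ + Φ') Ψ = ip Φ Ψ + ip Φ' Ψ := by
  rw [← ip_conj, map_add, map_add, ip_conj, ip_conj]

lemma ip_sub_left (Φ Φ' Ψ : X →₀ ℂ) : ip (Φ - Φ') Ψ = ip Φ Ψ - ip Φ' Ψ := by
  rw [← ip_conj, map_sub, map_sub, ip_conj, ip_conj]

lemma ip_smul_left (a : ℂ) (Φ Ψ : X →₀ ℂ) : ip (a • Φ) Ψ = conj a * ip Φ Ψ := by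
  rw [← ip_conj, map_smul, smul_eq_mul, map_mul, ip_conj]

lemma ip_sum_left {I : Type*} (s : Finset I) (Φ : I → X →₀ ℂ) (Ψ : X →₀ ℂ) :
    ip (∑ i ∈ s, Φ i) Ψ = ∑ i ∈ s, ip (Φ i) Ψ := by
  rw [← ip_conj, map_sum, map_sum]
  simp_rw [ip_conj]

lemma ip_single_left (Ψ : X →₀ ℂ) (x : X) (a : ℂ) :
    ip (Finsupp.single x a) Ψ = conj a * Ψ x := by
  rw [← ip_conj, ip_single_right]; simp

lemma ip_single_single [DecidableEq X] (x y : X) (a b : ℂ) :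
    ip (Finsupp.single x a) (Finsupp.single y b) = if x = y then conj a * b else 0 := by
  rw [ip_single_left, Finsupp.single_apply]
  split_ifs with h1 h2 h2 <;> simp_all

lemma ip_mapDomain {f : X → Y} (hf : Function.Injective f) (Φ Ψ : X →₀ ℂ) :
    ip (Finsupp.mapDomain f Φ) (Finsupp.mapDomain f Ψ) = ip Φ Ψ := by
  induction Ψ using Finsupp.induction_linear with
  | zero => simp
  | add a b ha hb => rw [Finsupp.mapDomain_add, map_add, map_add, ha, hb]
  | single x a => rw [Finsupp.mapDomain_single, ip_single_right, ip_single_right,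
      Finsupp.mapDomain_apply hf]

lemma ip_self (Φ : X →₀ ℂ) : ip Φ Φ = ((Φ.sum fun _ a => ‖a‖ ^ 2 : ℝ) : ℂ) := by
  rw [ip_def, Finsupp.sum, Finsupp.sum, Complex.ofReal_sum]
  refine Finset.sum_congr rfl fun x _ => ?_
  rw [Complex.mul_conj, Complex.normSq_eq_norm_sq]

lemma ip_self_eq_zero {Φ : X →₀ ℂ} (h : ip Φ Φ = 0) : Φ = 0 := by
  rw [ip_self, Complex.ofReal_eq_zero, Finsupp.sum,
    Finset.sum_eq_zero_iff_of_nonneg (fun _ _ => by positivity)] at h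
  ext x
  by_contra hx
  exact hx (by simpa using h x (by simpa using hx))

/-- A linear map that preserves the inner product. -/
def Isom (L : (X →₀ ℂ) →ₗ[ℂ] (Y →₀ ℂ)) : Prop := ∀ Φ Ψ, ip (L Φ) (L Ψ) = ip Φ Ψ

/-- It suffices that the images of the basis states are orthonormal. -/
lemma Isom.of_basis [DecidableEq X] (L : (X →₀ ℂ) →ₗ[ℂ] (Y →₀ ℂ))
    (h : ∀ x y, ip (L (Finsupp.single x 1)) (L (Finsupp.single y 1)) = if x = y then 1 else 0) :
    Isom L := by
  have key : ∀ x a y b, ip (L (Finsupp.single x a)) (L (Finsupp.single y b)) =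
      ip (Finsupp.single x a) (Finsupp.single y b) := by
    intro x a y b
    rw [← mul_one a, ← mul_one b, ← smul_eq_mul, ← smul_eq_mul, ← Finsupp.smul_single,
      ← Finsupp.smul_single]
    simp only [map_smul, ip_smul_left, h, ip_single_single]
    split_ifs <;> simp
  intro Φ Ψ
  induction Φ using Finsupp.induction_linear with
  | zero => simp [ip_zero_left]
  | add a b ha hb => rw [map_add, ip_add_left, ip_add_left, ha, hb]
  | single x a =>
    induction Ψ using Finsupp.induction_linear with
    | zero => simp
    | add a b ha hb => rw [map_add, map_add, map_add, ha, hb]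
    | single y b => exact key x a y b

lemma Isom.comp {L : (Y →₀ ℂ) →ₗ[ℂ] (Z →₀ ℂ)} {L' : (X →₀ ℂ) →ₗ[ℂ] (Y →₀ ℂ)} (h : Isom L)
    (h' : Isom L') : Isom (L ∘ₗ L') := fun Φ Ψ => by simp [h _ _, h' _ _]

lemma Isom.ne_zero {L : (X →₀ ℂ) →ₗ[ℂ] (Y →₀ ℂ)} (h : Isom L) {Φ : X →₀ ℂ} (hΦ : Φ ≠ 0) :
    L Φ ≠ 0 := fun h0 => hΦ (ip_self_eq_zero (by rw [← h, h0]; simp))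

/-- Polarization: a linear map that preserves norms preserves inner products. -/
lemma Isom.of_norm (L : (X →₀ ℂ) →ₗ[ℂ] (Y →₀ ℂ)) (h : ∀ Φ, ip (L Φ) (L Φ) = ip Φ Φ) :
    Isom L := by
  intro Φ Ψ
  have h1 := h (Φ + Ψ)
  have h2 := h (Φ + Complex.I • Ψ)
  simp only [map_add, map_smul, ip_add_left, ip_smul_left, h, smul_eq_mul, Complex.conj_I] at h1 h2
  have hI := Complex.I_mul_I
  linear_combination (1 / 2) * h1 - (Complex.I / 2) * h2 +
    (1 / 2) * (ip (L Φ) (L Ψ) - ip (L Ψ) (L Φ) - ip Φ Ψ + ip Ψ Φ) * hI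

/-- A linear map expands along the basis of its argument. -/
lemma exists_of_apply_ne_zero (L : (X →₀ ℂ) →ₗ[ℂ] (Y →₀ ℂ)) (Φ : X →₀ ℂ) (y : Y)
    (h : L Φ y ≠ 0) : ∃ x, Φ x ≠ 0 ∧ L (Finsupp.single x 1) y ≠ 0 := by
  by_contra! hcon
  apply h
  have hΦ : Φ = Φ.sum fun x a => a • Finsupp.single x (1 : ℂ) := by
    conv_lhs => rw [← Finsupp.sum_single Φ]
    simp
  rw [hΦ, Finsupp.sum, map_sum, Finsupp.finsetSum_apply]
  refine Finset.sum_eq_zero fun x hx => ?_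
  rw [map_smul, Finsupp.smul_apply, hcon x (by simpa using hx), smul_zero]

end ip

/-! ### Local operators: a finite matrix acting on a finite-dimensional part of a basis state -/

section lens
variable {Z Λ : Type*}

/-- A way of reading (`loc`) and replacing (`put`) a finite part of a basis state. -/
structure Lens (Z Λ : Type*) where
  loc : Z → Λ
  put : Z → Λ → Z
  loc_put : ∀ z a, loc (put z a) = a
  put_loc : ∀ z, put z (loc z) = z
  put_put : ∀ z a b, put (put z a) b = put z b

/-- The values of `put` are equal if and only if the new parts and the remaining parts are. -/
lemma Lens.put_eq_iff (l : Lens Z Λ) {z z' : Z} {a a' : Λ} :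
    l.put z a = l.put z' a' ↔ a = a' ∧ z = l.put z' (l.loc z) := by
  constructor
  · intro h
    have ha : a = a' := by rw [← l.loc_put z a, h, l.loc_put]
    refine ⟨ha, ?_⟩
    rw [← l.put_put z' a' (l.loc z), ← h, l.put_put, l.put_loc]
  · rintro ⟨rfl, h⟩
    rw [h, l.put_put]

variable [Fintype Λ]

/-- The operator that applies the matrix `R z` to the part of `z` seen by the lens. -/
noncomputable def Lens.op (l : Lens Z Λ) (R : Z → Matrix Λ Λ ℂ) : (Z →₀ ℂ) →ₗ[ℂ] (Z →₀ ℂ) :=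
  Finsupp.linearCombination ℂ fun z => ∑ a, Finsupp.single (l.put z a) (R z a (l.loc z))

lemma Lens.op_single (l : Lens Z Λ) (R : Z → Matrix Λ Λ ℂ) (z : Z) :
    l.op R (Finsupp.single z 1) = ∑ a, Finsupp.single (l.put z a) (R z a (l.loc z)) := by
  simp [Lens.op]

/-- An operator given by unitary matrices is an isometry, if the matrix does not depend on the part
of the state on which it acts. -/
lemma Lens.isom_op [DecidableEq Λ] (l : Lens Z Λ) (R : Z → Matrix Λ Λ ℂ)
    (hR : ∀ z a, R (l.put z a) = R z) (hU : ∀ z, (R z).conjTranspose * R z = 1) :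
    Isom (l.op R) := by
  classical
  refine Isom.of_basis _ fun z z' => ?_
  simp only [Lens.op_single, ip_sum_left, map_sum, ip_single_single, l.put_eq_iff]
  by_cases hz : z = l.put z' (l.loc z)
  · have hRz : R z = R z' := by rw [hz, hR]
    have := congrFun (congrFun (hU z) (l.loc z)) (l.loc z')
    simp only [Matrix.mul_apply, Matrix.conjTranspose_apply, Matrix.one_apply] at this
    simp only [and_iff_left hz, ← hRz]
    refine Eq.trans (Finset.sum_congr rfl fun a _ => ?_) (this.trans ?_)
    · rw [Finset.sum_ite_eq' Finset.univ a, if_pos (Finset.mem_univ a)]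
      rfl
    congr 1
    rw [eq_iff_iff]
    constructor
    · intro h; rw [hz, h, l.put_loc]
    · intro h; rw [h]
  · have : z ≠ z' := by rintro rfl; exact hz (l.put_loc z).symm
    simp [this, hz]

/-- An operator given by Hermitian matrices is self-adjoint, if the matrix does not depend on the
part of the state on which it acts. -/
lemma Lens.op_adjoint (l : Lens Z Λ) (R : Z → Matrix Λ Λ ℂ)
    (hR : ∀ z a, R (l.put z a) = R z) (hH : ∀ z, (R z).IsHermitian) (Φ Ψ : Z →₀ ℂ) :
    ip (l.op R Φ) Ψ = ip Φ (l.op R Ψ) := by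
  classical
  have key : ∀ z z' : Z, ip (l.op R (Finsupp.single z 1)) (Finsupp.single z' 1) =
      ip (Finsupp.single z 1) (l.op R (Finsupp.single z' 1)) := by
    intro z z'
    simp only [Lens.op_single, ip_sum_left, map_sum, ip_single_single]
    have e2 : ∀ a, (z = l.put z' a) ↔ (a = l.loc z ∧ z = l.put z' (l.loc z)) := fun a => by
      constructor
      · intro h
        have ha : a = l.loc z := by rw [h, l.loc_put]
        exact ⟨ha, ha ▸ h⟩
      · rintro ⟨rfl, h⟩
        exact h
    have e1 : ∀ a, (l.put z a = z') ↔ (a = l.loc z' ∧ z = l.put z' (l.loc z)) := fun a => by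
      constructor
      · intro h
        have ha : a = l.loc z' := by rw [← h, l.loc_put]
        exact ⟨ha, by rw [← h, l.put_put, l.put_loc]⟩
      · rintro ⟨rfl, h⟩
        rw [h, l.put_put, l.put_loc]
    by_cases hz : z = l.put z' (l.loc z)
    · have hRz : R z = R z' := by rw [hz, hR]
      replace e1 := fun a => (e1 a).trans (and_iff_left hz)
      replace e2 := fun a => (e2 a).trans (and_iff_left hz)
      simp only [e1, e2, Finset.sum_ite_eq',
        Finset.mem_univ, if_true, hRz, map_one, mul_one, one_mul]
      exact (hH z').apply _ _
    · rw [Finset.sum_eq_zero fun a _ => if_neg fun h => hz ((e1 a).1 h).2,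
        Finset.sum_eq_zero fun a _ => if_neg fun h => hz ((e2 a).1 h).2]
  induction Φ using Finsupp.induction_linear with
  | zero => simp [ip_zero_left]
  | add a b ha hb => rw [map_add, ip_add_left, ip_add_left, ha, hb]
  | single x a =>
    induction Ψ using Finsupp.induction_linear with
    | zero => simp
    | add a b ha hb => rw [map_add, map_add, map_add, ha, hb]
    | single y b =>
      rw [← mul_one a, ← mul_one b, ← smul_eq_mul, ← smul_eq_mul, ← Finsupp.smul_single,
        ← Finsupp.smul_single]
      simp only [map_smul, ip_smul_left, key]

end lens

end SquaredFunction

/-! ### Gates on plain configurations -/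

namespace SquaredFunction

open ComplexConjugate

/-- Configurations without the requirement that almost all cells be blank; tapes are indexed by an
arbitrary type, and tape `i` has the alphabet `Γ i`. -/
@[ext]
structure PC {ι : Type} (Γ : ι → Type) (S : Type) where
  /-- the state -/
  st : S
  /-- the head positions -/
  hd : ι → ℤ
  /-- the contents of the tapes -/
  tp : ∀ i, ℤ → Γ i

section gates
variable {ι : Type} {Γ : ι → Type} {S : Type}

/-- The scanned symbols. -/
def PC.scan (c : PC Γ S) : ∀ i, Γ i := fun i => c.tp i (c.hd i)

/-- Enter state `q`, write `τ`, then move the heads by `d`. -/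
def PC.next (c : PC Γ S) (q : S) (τ : ∀ i, Γ i) (d : ι → HeadMove) : PC Γ S where
  st := q
  hd i := c.hd i + (d i).toInt
  tp i := Function.update (c.tp i) (c.hd i) (τ i)

/-- One instruction of a machine: in state `p`, reading `σ`, it branches into the alternatives
`a : Λ`; branch `a` has amplitude `wt p σ a` and leads to the state, the written symbols and the
head moves given by `tgt p σ a`. Several branches may lead to the same configuration. -/
structure Gate (Γ : ι → Type) (S : Type) where
  Λ : Type
  [fin : Fintype Λ]
  tgt : S → (∀ i, Γ i) → Λ → S × (∀ i, Γ i) × (ι → HeadMove)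
  wt : S → (∀ i, Γ i) → Λ → ℂ

attribute [instance] Gate.fin

/-- The configuration reached from `c` in branch `a` of a gate. -/
def Gate.branch (g : Gate Γ S) (c : PC Γ S) (a : g.Λ) : PC Γ S :=
  c.next (g.tgt c.st c.scan a).1 (g.tgt c.st c.scan a).2.1 (g.tgt c.st c.scan a).2.2

/-- The linear operator of a gate. -/
noncomputable def Gate.op (g : Gate Γ S) : (PC Γ S →₀ ℂ) →ₗ[ℂ] (PC Γ S →₀ ℂ) :=
  Finsupp.linearCombination ℂ fun c =>
    ∑ a, Finsupp.single (g.branch c a) (g.wt c.st c.scan a)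

lemma Gate.op_single (g : Gate Γ S) (c : PC Γ S) :
    g.op (Finsupp.single c 1) = ∑ a, Finsupp.single (g.branch c a) (g.wt c.st c.scan a) := by
  simp [Gate.op]

open Classical in
/-- The total amplitude with which a gate makes a given transition. -/
noncomputable def Gate.amp (g : Gate Γ S) (p : S) (σ : ∀ i, Γ i) (q : S) (τ : ∀ i, Γ i)
    (d : ι → HeadMove) : ℂ :=
  ∑ a, if g.tgt p σ a = (q, τ, d) then g.wt p σ a else 0

lemma Gate.exists_branch (g : Gate Γ S) {c c' : PC Γ S}
    (h : g.op (Finsupp.single c 1) c' ≠ 0) : ∃ a, c' = g.branch c a := by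
  by_contra! hcon
  apply h
  rw [g.op_single, Finsupp.finsetSum_apply]
  exact Finset.sum_eq_zero fun a _ => Finsupp.single_eq_of_ne (hcon a)

/-- The deterministic gate with transition `f` and amplitudes `sg` (intended to be signs). -/
@[simps]
def Gate.classical (f : S → (∀ i, Γ i) → S × (∀ i, Γ i) × (ι → HeadMove))
    (sg : S → (∀ i, Γ i) → ℂ) : Gate Γ S where
  Λ := Unit
  tgt p σ _ := f p σ
  wt p σ _ := sg p σ

lemma Gate.classical_op (f : S → (∀ i, Γ i) → S × (∀ i, Γ i) × (ι → HeadMove))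
    (sg : S → (∀ i, Γ i) → ℂ) (c : PC Γ S) :
    (Gate.classical f sg).op (Finsupp.single c 1) =
      Finsupp.single ((Gate.classical f sg).branch c ()) (sg c.st c.scan) := by
  rw [Gate.op_single]
  exact Fintype.sum_unique (ι := Unit) _

lemma Gate.classical_isom (f : S → (∀ i, Γ i) → S × (∀ i, Γ i) × (ι → HeadMove))
    (sg : S → (∀ i, Γ i) → ℂ) (hsg : ∀ p σ, sg p σ = 1 ∨ sg p σ = -1)
    (hf : Function.Injective fun c => (Gate.classical f sg).branch c ()) :
    Isom (Gate.classical f sg).op := by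
  classical
  refine Isom.of_basis _ fun c c' => ?_
  rw [Gate.classical_op, Gate.classical_op, ip_single_single]
  by_cases h : c = c'
  · subst h
    rcases hsg c.st c.scan with h | h <;> simp [h]
  · rw [if_neg (fun h' => h (hf h')), if_neg h]

lemma Gate.classical_amp_mem (f : S → (∀ i, Γ i) → S × (∀ i, Γ i) × (ι → HeadMove))
    (sg : S → (∀ i, Γ i) → ℂ) (hsg : ∀ p σ, sg p σ = 1 ∨ sg p σ = -1) {K : Set ℂ}
    (hK : {0, 1, -1} ⊆ K) (p : S) (σ : ∀ i, Γ i) (q : S) (τ : ∀ i, Γ i) (d : ι → HeadMove) :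
    (Gate.classical f sg).amp p σ q τ d ∈ K := by
  classical
  have : (Gate.classical f sg).amp p σ q τ d = if f p σ = (q, τ, d) then sg p σ else 0 :=
    Fintype.sum_unique (ι := Unit) _
  rw [this]
  split_ifs
  · rcases hsg p σ with h | h <;> rw [h] <;> exact hK (by simp)
  · exact hK (by simp)

lemma single_sum {X I : Type*} (s : Finset I) (x : X) (f : I → ℂ) :
    Finsupp.single x (∑ i ∈ s, f i) = ∑ i ∈ s, Finsupp.single x (f i) :=
  map_sum (Finsupp.singleAddHom x) f s

/-- A superposition over the possible transitions of a gate is a sum over its branches. -/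
lemma Gate.sum_single_amp {X : Type*} [Fintype S] [Fintype (∀ i, Γ i)]
    [Fintype (ι → HeadMove)] (g : Gate Γ S) (p : S) (σ : ∀ i, Γ i)
    (h : S → (∀ i, Γ i) → (ι → HeadMove) → X) :
    ∑ s, ∑ τ, ∑ d, Finsupp.single (h s τ d) (g.amp p σ s τ d) =
      ∑ a, Finsupp.single (h (g.tgt p σ a).1 (g.tgt p σ a).2.1 (g.tgt p σ a).2.2) (g.wt p σ a) := by
  classical
  have step : ∑ s, ∑ τ, ∑ d, Finsupp.single (h s τ d) (g.amp p σ s τ d) =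
      ∑ z : S × (∀ i, Γ i) × (ι → HeadMove),
        Finsupp.single (h z.1 z.2.1 z.2.2) (g.amp p σ z.1 z.2.1 z.2.2) := by
    rw [Fintype.sum_prod_type]
    refine Finset.sum_congr rfl fun s _ => ?_
    rw [Fintype.sum_prod_type]
  rw [step]
  simp only [Gate.amp, single_sum]
  rw [Finset.sum_comm]
  refine Finset.sum_congr rfl fun a _ => ?_
  rw [Finset.sum_eq_single (g.tgt p σ a)]
  · simp
  · intro z _ hz
    rw [if_neg (fun h' => hz h'.symm), Finsupp.single_zero]
  · simp

end gates

/-! ### Quantum Turing machines from cyclic programs of gates -/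

/-- A cyclic straight-line program of gates. Its tapes use the alphabets of the tapes of a given
machine `M`, as prescribed by `base`, so that the alphabet conditions on a machine hold
automatically. The program starts in `s₀` and may halt in the states of `F`, but only at the end of
a pass through the instructions `g`. -/
structure Program (M : QTM) where
  ι : Type
  [fι : Fintype ι]
  [dι : DecidableEq ι]
  base : ι → Fin M.k
  inp : ι
  out : ι
  base_inp : base inp = M.inputTape
  S : Type
  [fS : Fintype S]
  s₀ : S
  F : Set S
  F_nonempty : F.Nonempty
  s₀_notMem : s₀ ∉ F
  /-- the number of instructions minus one -/
  n : ℕ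
  g : Fin (n + 1) → Gate (fun i => M.tapeAlph (base i)) S

attribute [instance] Program.fι Program.dι Program.fS

lemma update_congr {A B : Type*} [DecidableEq A] {f f' : A → B} {x x' : A} {y y' : B}
    (hf : f = f') (hx : x = x') (hy : y = y') :
    Function.update f x y = Function.update f' x' y' := by rw [hf, hx, hy]

namespace Program
variable {M : QTM} (P : Program M)

/-- The alphabet of tape `i` as a type. -/
abbrev Γ (i : P.ι) : Type := M.tapeAlph (P.base i)

/-- The numbering of the tapes. -/
noncomputable def e : Fin (Fintype.card P.ι) ≃ P.ι := (Fintype.equivFin P.ι).symm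

/-- The machine that runs the program: its states carry a program counter, and it halts in the
states of `F` at the beginning of the program. -/
noncomputable def toQTM : QTM where
  k := Fintype.card P.ι
  Q := Fin (P.n + 1) × P.S
  q₀ := (0, P.s₀)
  Qf := {p | p.1 = 0 ∧ p.2 ∈ P.F}
  Qf_nonempty := P.F_nonempty.elim fun s hs => ⟨(0, s), rfl, hs⟩
  q₀_notMem h := P.s₀_notMem h.2
  Symb := M.Symb
  blank := M.blank
  bit := M.bit
  bit_injective := M.bit_injective
  bit_ne_blank := M.bit_ne_blank
  ioAlph i := M.ioAlph (P.base (P.e i))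
  tapeAlph i := M.tapeAlph (P.base (P.e i))
  ioAlph_subset i := M.ioAlph_subset _
  blank_mem i := M.blank_mem _
  blank_notMem i := M.blank_notMem _
  inputTape := P.e.symm P.inp
  outputTape := P.e.symm P.out
  bit_mem b := by rw [Equiv.apply_symm_apply, P.base_inp]; exact M.bit_mem b
  δ p σ q τ d := if q.1 = p.1 + 1 then
      (P.g p.1).amp p.2 (Equiv.piCongrLeft P.Γ P.e σ) q.2 (Equiv.piCongrLeft P.Γ P.e τ)
        (d ∘ P.e.symm)
    else 0

/-- Plain configurations of the program. -/
abbrev Cfg : Type := PC P.Γ P.S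

/-- A configuration of the machine as program counter and plain configuration. -/
noncomputable def plain (c : P.toQTM.Conf) : Fin (P.n + 1) × P.Cfg :=
  (c.state.1, ⟨c.state.2, c.head ∘ P.e.symm, Equiv.piCongrLeft (fun i => ℤ → P.Γ i) P.e c.tape⟩)

/-- The tuple of symbols indexed by `ι` that corresponds to a tuple of symbols of the machine. -/
noncomputable def symb (σ : P.toQTM.Symbols) : ∀ i, P.Γ i := Equiv.piCongrLeft P.Γ P.e σ

lemma symb_apply (σ : P.toQTM.Symbols) (i : Fin P.toQTM.k) : P.symb σ (P.e i) = σ i :=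
  Equiv.piCongrLeft_apply_apply P.Γ P.e σ i

lemma plain_tp (c : P.toQTM.Conf) (i : Fin P.toQTM.k) :
    (P.plain c).2.tp (P.e i) = c.tape i :=
  Equiv.piCongrLeft_apply_apply (fun i => ℤ → P.Γ i) P.e c.tape i

lemma plain_hd (c : P.toQTM.Conf) (i : Fin P.toQTM.k) :
    (P.plain c).2.hd (P.e i) = c.head i :=
  congrArg c.head (P.e.symm_apply_apply i)

lemma plain_injective : Function.Injective P.plain := by
  intro c c' h
  refine QTM.Conf.ext ?_ ?_ ?_
  · exact Prod.ext (congrArg (fun z => z.1) h) (congrArg (fun z => z.2.st) h)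
  · funext i
    exact (P.plain_hd c i).symm.trans ((congrArg (fun z => z.2.hd (P.e i)) h).trans
      (P.plain_hd c' i))
  · funext i
    exact (P.plain_tp c i).symm.trans ((congrArg (fun z => z.2.tp (P.e i)) h).trans
      (P.plain_tp c' i))

lemma scan_plain (c : P.toQTM.Conf) : (P.plain c).2.scan = P.symb c.scanned := by
  funext i
  obtain ⟨a, rfl⟩ := P.e.surjective i
  refine Eq.trans ?_ (P.symb_apply c.scanned a).symm
  show (P.plain c).2.tp (P.e a) ((P.plain c).2.hd (P.e a)) = c.tape a (c.head a)
  exact congrFun (P.plain_tp c a) _ |>.trans (congrArg (c.tape a) (P.plain_hd c a))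

lemma plain_next (c : P.toQTM.Conf) (q : P.toQTM.Q) (τ : P.toQTM.Symbols)
    (d : Fin P.toQTM.k → HeadMove) :
    P.plain (c.next q τ d) =
      (q.1, (P.plain c).2.next q.2 (P.symb τ) (d ∘ P.e.symm)) := by
  refine Prod.ext rfl (PC.ext rfl rfl (funext fun i => ?_))
  obtain ⟨a, rfl⟩ := P.e.surjective i
  refine (P.plain_tp (c.next q τ d) a).trans ?_
  show Function.update (c.tape a) (c.head a) (τ a) =
    Function.update ((P.plain c).2.tp (P.e a)) ((P.plain c).2.hd (P.e a)) (P.symb τ (P.e a))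
  have h1 := P.plain_tp c a
  have h2 := P.plain_hd c a
  have h3 := P.symb_apply τ a
  exact update_congr h1.symm h2.symm h3.symm

/-- The evolution operator on plain configurations with program counter. -/
noncomputable def plainU : (Fin (P.n + 1) × P.Cfg →₀ ℂ) →ₗ[ℂ] (Fin (P.n + 1) × P.Cfg →₀ ℂ) :=
  Finsupp.linearCombination ℂ fun z =>
    Finsupp.mapDomain (Prod.mk (z.1 + 1)) ((P.g z.1).op (Finsupp.single z.2 1))

lemma plainU_mk (i : Fin (P.n + 1)) (Φ : P.Cfg →₀ ℂ) :
    P.plainU (Finsupp.mapDomain (Prod.mk i) Φ) =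
      Finsupp.mapDomain (Prod.mk (i + 1)) ((P.g i).op Φ) := by
  induction Φ using Finsupp.induction_linear with
  | zero => simp
  | add a b ha hb => simp only [Finsupp.mapDomain_add, map_add, ha, hb]
  | single c a =>
    rw [Finsupp.mapDomain_single, plainU, Finsupp.linearCombination_single,
      ← Finsupp.mapDomain_smul, ← map_smul, Finsupp.smul_single_one]

lemma mapDomain_plain_U_single (c : P.toQTM.Conf) :
    Finsupp.mapDomain P.plain (P.toQTM.U (Finsupp.single c 1)) =
      P.plainU (Finsupp.single (P.plain c) 1) := by
  classical
  rw [plainU, Finsupp.linearCombination_single, one_smul, Gate.op_single, QTM.U,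
    Finsupp.linearCombination_single, one_smul, QTM.stepVec]
  simp only [Finsupp.mapDomain_finsetSum, Finsupp.mapDomain_single, plain_next]
  have hδ : ∀ q τ d, P.toQTM.δ c.state c.scanned q τ d =
      if q.1 = (P.plain c).1 + 1 then
        (P.g (P.plain c).1).amp (P.plain c).2.st (P.plain c).2.scan q.2
          (P.symb τ) (d ∘ P.e.symm) else 0 := fun q τ d => by
    rw [scan_plain]; rfl
  simp only [hδ]
  obtain ⟨i, z⟩ := P.plain c
  simp only
  let G : Fin (P.n + 1) × P.S → (∀ i, P.Γ i) → (P.ι → HeadMove) → (Fin (P.n + 1) × P.Cfg →₀ ℂ) :=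
    fun q τ d => Finsupp.single (q.1, z.next q.2 τ d)
      (if q.1 = i + 1 then (P.g i).amp z.st z.scan q.2 τ d else 0)
  have step1 : (∑ q : Fin (P.n + 1) × P.S, ∑ τ : P.toQTM.Symbols,
      ∑ d : Fin (Fintype.card P.ι) → HeadMove,
        G q (P.symb τ) (d ∘ P.e.symm)) =
      ∑ q : Fin (P.n + 1) × P.S, ∑ τ : ∀ i, P.Γ i, ∑ d : P.ι → HeadMove, G q τ d := by
    refine Finset.sum_congr rfl fun q _ => ?_
    refine Fintype.sum_equiv (Equiv.piCongrLeft P.Γ P.e) _ _ fun τ => ?_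
    exact Fintype.sum_equiv (P.e.arrowCongr (Equiv.refl HeadMove)) _ _ fun d => rfl
  refine Eq.trans step1 ?_
  rw [Fintype.sum_prod_type, Finset.sum_eq_single (i + 1)]
  · simp only [G, if_true]
    exact (P.g i).sum_single_amp z.st z.scan fun s τ d => (i + 1, z.next s τ d)
  · intro j _ hj
    refine Finset.sum_eq_zero fun s _ => Finset.sum_eq_zero fun τ _ =>
      Finset.sum_eq_zero fun d _ => ?_
    simp [G, hj]
  · simp

lemma mapDomain_plain_U (Φ : P.toQTM.Superposition) :
    Finsupp.mapDomain P.plain (P.toQTM.U Φ) = P.plainU (Finsupp.mapDomain P.plain Φ) := by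
  induction Φ using Finsupp.induction_linear with
  | zero => simp
  | add a b ha hb => simp only [Finsupp.mapDomain_add, map_add, ha, hb]
  | single c a =>
    rw [← Finsupp.smul_single_one, map_smul, Finsupp.mapDomain_smul, Finsupp.mapDomain_smul,
      map_smul, Finsupp.mapDomain_single, mapDomain_plain_U_single]

lemma plainU_isom (h : ∀ i, Isom (P.g i).op) : Isom P.plainU := by
  classical
  refine Isom.of_basis _ fun z z' => ?_
  obtain ⟨i, c⟩ := z
  obtain ⟨j, c'⟩ := z'
  rw [plainU, Finsupp.linearCombination_single, Finsupp.linearCombination_single, one_smul,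
    one_smul]
  by_cases hij : i = j
  · subst hij
    rw [ip_mapDomain (Prod.mk_right_injective _), h i, ip_single_single]
    simp
  · rw [if_neg (by simp [hij]), ip_def]
    refine Finset.sum_eq_zero fun z hz => ?_
    have hz1 : z.1 = j + 1 := by
      obtain ⟨w, -, rfl⟩ := Finset.mem_image.1 (Finsupp.mapDomain_support hz)
      rfl
    refine mul_eq_zero_of_right _ ?_
    rw [Finsupp.mapDomain_of_notMem_range, map_zero]
    rintro ⟨w, rfl⟩
    exact hij (add_right_cancel hz1)

end Program

section norm

lemma l2norm_eq {M : QTM} (Φ : M.Superposition) : QTM.l2norm Φ = Real.sqrt (ip Φ Φ).re := by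
  rw [ip_self, Complex.ofReal_re]; rfl

/-- The evolution operator of a well-formed machine preserves inner products. -/
lemma isom_of_wellFormed {M : QTM} (h : M.WellFormed) : Isom M.U := by
  refine Isom.of_norm _ fun Φ => ?_
  have := h Φ
  rw [QTM.l2norm, QTM.l2norm, Real.sqrt_inj (by exact Finset.sum_nonneg fun _ _ => by positivity)
    (by exact Finset.sum_nonneg fun _ _ => by positivity)] at this
  rw [ip_self, ip_self, this]

lemma wellFormed_of_isom {M : QTM} (h : Isom M.U) : M.WellFormed := fun Φ => by
  rw [l2norm_eq, l2norm_eq, h]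

end norm

/-- Steps from different values of the program counter lead to different values, and hence to
orthogonal superpositions. -/
lemma Program.toQTM_wellFormed {M : QTM} (P : Program M) (h : ∀ i, Isom (P.g i).op) :
    P.toQTM.WellFormed := by
  refine wellFormed_of_isom fun Φ Ψ => ?_
  rw [← ip_mapDomain P.plain_injective, P.mapDomain_plain_U, P.mapDomain_plain_U,
    P.plainU_isom h, ip_mapDomain P.plain_injective]

lemma Program.toQTM_hasAmplitudes {M : QTM} (P : Program M) {K : Set ℂ} (h0 : (0 : ℂ) ∈ K)
    (h : ∀ i p σ q τ d, (P.g i).amp p σ q τ d ∈ K) : P.toQTM.HasAmplitudes K := by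
  intro p σ q τ d
  show (if _ then _ else _) ∈ K
  split_ifs
  · exact h _ _ _ _ _ _
  · exact h0

end SquaredFunction

/-! ### Running time and acceptance probability of a program -/

namespace SquaredFunction

open ComplexConjugate

namespace Program
variable {M : QTM} (P : Program M)

/-- The program counter after `m` instructions. -/
def pc (m : ℕ) : Fin (P.n + 1) := ⟨m % (P.n + 1), Nat.mod_lt _ (Nat.succ_pos _)⟩

lemma pc_zero : P.pc 0 = 0 := Fin.ext (Nat.zero_mod _)

lemma pc_succ (m : ℕ) : P.pc (m + 1) = P.pc m + 1 :=
  Fin.ext (by simp [pc, Fin.val_add])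

lemma pc_add (t m : ℕ) : P.pc ((P.n + 1) * t + m) = P.pc m :=
  Fin.ext (by simp [pc])

lemma pc_mul (t : ℕ) : P.pc ((P.n + 1) * t) = 0 := (P.pc_add t 0).trans P.pc_zero

lemma dvd_of_pc {m : ℕ} (h : P.pc m = 0) : P.n + 1 ∣ m :=
  Nat.dvd_of_mod_eq_zero (congrArg Fin.val h)

/-- The operator of the first `m` instructions, the program being repeated cyclically. -/
noncomputable def run : ℕ → (P.Cfg →₀ ℂ) →ₗ[ℂ] (P.Cfg →₀ ℂ)
  | 0 => LinearMap.id
  | m + 1 => (P.g (P.pc m)).op ∘ₗ run m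

/-- The operator of one pass through the program. -/
noncomputable def loop : (P.Cfg →₀ ℂ) →ₗ[ℂ] (P.Cfg →₀ ℂ) := P.run (P.n + 1)

lemma run_add (t m : ℕ) : P.run ((P.n + 1) * t + m) = P.run m ∘ₗ P.run ((P.n + 1) * t) := by
  induction m with
  | zero => rfl
  | succ m ih =>
    rw [← add_assoc, run, ih, run, LinearMap.comp_assoc, pc_add]

lemma run_mul (t : ℕ) : P.run ((P.n + 1) * t) = P.loop ^ t := by
  induction t with
  | zero => rfl
  | succ t ih => rw [mul_add, mul_one, run_add, ih, pow_succ', Module.End.mul_eq_comp, loop]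

lemma plainU_pow (m : ℕ) (Φ : P.Cfg →₀ ℂ) :
    (P.plainU ^ m) (Finsupp.mapDomain (Prod.mk 0) Φ) =
      Finsupp.mapDomain (Prod.mk (P.pc m)) (P.run m Φ) := by
  induction m with
  | zero => simp [run, pc_zero]
  | succ m ih =>
    rw [pow_succ', Module.End.mul_apply, ih, plainU_mk, pc_succ]; rfl

lemma mapDomain_plain_U_pow (m : ℕ) (Φ : P.toQTM.Superposition) :
    Finsupp.mapDomain P.plain ((P.toQTM.U ^ m) Φ) =
      (P.plainU ^ m) (Finsupp.mapDomain P.plain Φ) := by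
  induction m with
  | zero => simp
  | succ m ih => rw [pow_succ', Module.End.mul_apply, mapDomain_plain_U, ih, pow_succ',
      Module.End.mul_apply]

lemma stringCell_mem (M : QTM) (x : List Bool) (z : ℤ) :
    M.stringCell x z ∈ M.tapeAlph M.inputTape := by
  unfold QTM.stringCell
  split_ifs with hz
  · cases x[z.toNat]? with
    | none => exact M.blank_mem _
    | some b => exact M.ioAlph_subset _ (M.bit_mem b)
  · exact M.blank_mem _

/-- The initial plain configuration on input `x`. -/
def start (x : List Bool) : P.Cfg where
  st := P.s₀
  hd _ := 0
  tp i z := ⟨if i = P.inp then M.stringCell x z else M.blank, by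
    split_ifs with h
    · subst h; rw [P.base_inp]; exact stringCell_mem M x z
    · exact M.blank_mem _⟩

lemma plain_tp_val (c : P.toQTM.Conf) (i : P.ι) (z : ℤ) :
    ((P.plain c).2.tp i z : M.Symb) = (c.tape (P.e.symm i) z).1 := by
  obtain ⟨a, rfl⟩ := P.e.surjective i
  have h : ∀ b, b = a → ((P.plain c).2.tp (P.e a) z : M.Symb) = (c.tape b z).1 := by
    rintro _ rfl
    exact congrArg Subtype.val (congrFun (P.plain_tp c _) z)
  exact h _ (P.e.symm_apply_apply a)

lemma plain_init (x : List Bool) : P.plain (P.toQTM.init x) = (0, P.start x) := by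
  refine Prod.ext rfl (PC.ext rfl rfl (funext fun i => funext fun z => Subtype.ext ?_))
  rw [plain_tp_val]
  show (if P.e.symm i = P.e.symm P.inp then P.toQTM.stringCell x z else M.blank) =
    if i = P.inp then M.stringCell x z else M.blank
  simp only [EmbeddingLike.apply_eq_iff_eq]
  rfl

lemma mapDomain_plain_pow_init (x : List Bool) (m : ℕ) :
    Finsupp.mapDomain P.plain ((P.toQTM.U ^ m) (Finsupp.single (P.toQTM.init x) 1)) =
      Finsupp.mapDomain (Prod.mk (P.pc m)) (P.run m (Finsupp.single (P.start x) 1)) := by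
  rw [mapDomain_plain_U_pow, Finsupp.mapDomain_single, plain_init, ← plainU_pow,
    Finsupp.mapDomain_single]

open Classical in
/-- The acceptance probability, computed from the plain evolution. -/
lemma acceptProb_eq (x : List Bool) (τ : ℕ)
    (hτ : P.toQTM.runningTime (Finsupp.single (P.toQTM.init x) 1) = (P.n + 1) * τ) :
    P.toQTM.acceptProb x = ((P.loop ^ τ) (Finsupp.single (P.start x) 1)).sum fun c a =>
      if c.st ∈ P.F ∧ (c.tp P.out 0 : M.Symb) = M.bit true then ‖a‖ ^ 2 else 0 := by
  have h := P.mapDomain_plain_pow_init x ((P.n + 1) * τ)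
  rw [pc_mul, run_mul] at h
  rw [QTM.acceptProb, QTM.finalSuperposition, hτ]
  let f : Fin (P.n + 1) × P.Cfg → ℂ → ℝ := fun z a =>
    if z.1 = 0 ∧ z.2.st ∈ P.F ∧ (z.2.tp P.out 0 : M.Symb) = M.bit true then ‖a‖ ^ 2 else 0
  have h1 := Finsupp.sum_mapDomain_index_inj (h := f) P.plain_injective
    (s := (P.toQTM.U ^ ((P.n + 1) * τ)) (Finsupp.single (P.toQTM.init x) 1))
  have h2 := Finsupp.sum_mapDomain_index_inj (h := f) (Prod.mk_right_injective (0 : Fin (P.n + 1)))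
    (s := (P.loop ^ τ) (Finsupp.single (P.start x) 1))
  rw [h, h2] at h1
  simp only [f, true_and] at h1
  rw [h1]
  refine Finset.sum_congr rfl fun c _ => ?_
  have : P.toQTM.Accepting c ↔ (P.plain c).1 = 0 ∧ (P.plain c).2.st ∈ P.F ∧
      ((P.plain c).2.tp P.out 0 : M.Symb) = M.bit true := by
    rw [plain_tp_val, ← and_assoc]
    rfl
  simp only [this]

lemma step_plain {c c' : P.toQTM.Conf} (h : P.toQTM.Step c c') :
    (P.plain c').1 = (P.plain c).1 + 1 ∧
      (P.g (P.plain c).1).op (Finsupp.single (P.plain c).2 1) (P.plain c').2 ≠ 0 := by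
  classical
  have h1 : Finsupp.mapDomain P.plain (P.toQTM.U (Finsupp.single c 1)) (P.plain c') ≠ 0 := by
    rw [Finsupp.mapDomain_apply P.plain_injective]; exact h
  rw [mapDomain_plain_U_single, plainU, Finsupp.linearCombination_single, one_smul] at h1
  have h2 := Finsupp.mapDomain_support (Finsupp.mem_support_iff.2 h1)
  obtain ⟨w, hw, hwe⟩ := Finset.mem_image.1 h2
  have e1 : (P.plain c').1 = (P.plain c).1 + 1 := by rw [← hwe]
  have e2 : (P.plain c').2 = w := by rw [← hwe]
  exact ⟨e1, by rw [e2]; simpa using hw⟩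

lemma exists_step (hg : ∀ i, Isom (P.g i).op) (c : P.toQTM.Conf) : ∃ c', P.toQTM.Step c c' := by
  have hU : Isom P.toQTM.U := isom_of_wellFormed (P.toQTM_wellFormed hg)
  by_contra! hcon
  refine hU.ne_zero (Φ := Finsupp.single c 1) (by simp) (Finsupp.ext fun c' => ?_)
  have := hcon c'
  simpa [QTM.Step] using this

/-- An infinite computation path starts in every configuration, as isometries do not annihilate
basis states. -/
lemma exists_path (hg : ∀ i, Isom (P.g i).op) (c : P.toQTM.Conf) :
    ∃ γ : ℕ → P.toQTM.Conf, γ 0 = c ∧ ∀ s, P.toQTM.Step (γ s) (γ (s + 1)) := by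
  choose f hf using P.exists_step hg
  exact ⟨fun s => f^[s] c, rfl, fun s => by
    dsimp only
    rw [Function.iterate_succ_apply']; exact hf _⟩

/-- If the part `ctl c` of a configuration evolves deterministically, then at each time it has the
same value on all computation paths as on the plain superposition. -/
lemma ctl_eq {C : Type*} (ctl : P.Cfg → C)
    (hctl : ∀ i c d c' d', ctl c = ctl d → (P.g i).op (Finsupp.single c 1) c' ≠ 0 →
      (P.g i).op (Finsupp.single d 1) d' ≠ 0 → ctl c' = ctl d')
    (x : List Bool) (γ : ℕ → P.toQTM.Conf) (h0 : γ 0 = P.toQTM.init x) (t : ℕ)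
    (hγ : ∀ s < t, P.toQTM.Step (γ s) (γ (s + 1))) :
    (P.plain (γ t)).1 = P.pc t ∧ ∀ d,
      P.run t (Finsupp.single (P.start x) 1) d ≠ 0 → ctl (P.plain (γ t)).2 = ctl d := by
  induction t with
  | zero =>
    rw [h0, plain_init]
    refine ⟨P.pc_zero.symm, fun d hd => ?_⟩
    have : d = P.start x := by
      by_contra hne
      exact hd (Finsupp.single_eq_of_ne hne)
    rw [this]
  | succ t ih =>
    obtain ⟨ih1, ih2⟩ := ih fun s hs => hγ s (by omega)
    obtain ⟨h1, h2⟩ := P.step_plain (hγ t (by omega))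
    rw [ih1] at h1 h2
    refine ⟨by rw [h1, pc_succ], fun d hd => ?_⟩
    rw [run, LinearMap.comp_apply] at hd
    obtain ⟨d₀, hd0, hd1⟩ := exists_of_apply_ne_zero _ _ _ hd
    exact hctl _ _ _ _ _ (ih2 d₀ hd0) h2 hd1

/-- A qustring of length `n` is supported on inputs of length `n`, and its support is not empty. -/
lemma initQ_support (M : QTM) {n : ℕ} (φ : Qustring n) :
    (∀ c ∈ (M.initQ φ).support, ∃ x : List Bool, x.length = n ∧ c = M.init x) ∧
      ∃ x : List Bool, x.length = n ∧ M.init x ∈ (M.initQ φ).support := by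
  classical
  have hinj : ∀ x y : List.Vector Bool n, M.init x.toList = M.init y.toList → x = y := by
    intro x y h
    refine Subtype.ext (List.ext_getElem (by simp) fun i h1 h2 => ?_)
    have h3 : ((M.init x.toList).tape M.inputTape i : M.Symb) =
        ((M.init y.toList).tape M.inputTape i : M.Symb) := by rw [h]
    simp only [QTM.init, if_true, QTM.stringCell, Int.natCast_nonneg, Int.toNat_natCast] at h3
    have e1 : x.toList[i]? = some (x.1[i]) := List.getElem?_eq_getElem h1
    have e2 : y.toList[i]? = some (y.1[i]) := List.getElem?_eq_getElem h2
    rw [e1, e2] at h3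
    exact M.bit_injective h3
  have happ : ∀ c, M.initQ φ c =
      ∑ x : List.Vector Bool n, if M.init x.toList = c then φ.1 x else 0 := fun c => by
    rw [QTM.initQ, Finsupp.finsetSum_apply]
    simp only [Finsupp.single_apply]
  constructor
  · intro c hc
    rw [Finsupp.mem_support_iff, happ] at hc
    obtain ⟨x, -, hx⟩ := Finset.exists_ne_zero_of_sum_ne_zero hc
    exact ⟨x.toList, by simp, by by_contra h; exact hx (if_neg (Ne.symm h))⟩
  · have h1 := φ.2
    obtain ⟨x, hx⟩ : ∃ x, φ.1 x ≠ 0 := by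
      by_contra! hcon
      simp [hcon] at h1
    refine ⟨x.toList, by simp, ?_⟩
    rw [Finsupp.mem_support_iff, happ, Finset.sum_eq_single x]
    · simpa using hx
    · intro y _ hy
      exact if_neg fun h => hy (hinj _ _ h)
    · simp

/-- A criterion for the running time of a program: if the control part `ctl` of the configurations
is deterministic and decides whether a state is final, then it suffices to look at one
configuration in the superposition after each pass. Interference cannot do harm here: a computation
path may end in a configuration of amplitude zero, but its control part is that of the
configurations with nonzero amplitude. -/
lemma haltsAt (hg : ∀ i, Isom (P.g i).op) {C : Type*} (ctl : P.Cfg → C)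
    (hctl : ∀ i c d c' d', ctl c = ctl d → (P.g i).op (Finsupp.single c 1) c' ≠ 0 →
      (P.g i).op (Finsupp.single d 1) d' ≠ 0 → ctl c' = ctl d')
    (hF : ∀ c d, ctl c = ctl d → (c.st ∈ P.F ↔ d.st ∈ P.F)) (n τ : ℕ)
    (h1 : ∀ x : List Bool, x.length = n → ∀ t < τ,
      ∃ c, (P.loop ^ t) (Finsupp.single (P.start x) 1) c ≠ 0 ∧ c.st ∉ P.F)
    (h2 : ∀ x : List Bool, x.length = n →
      ∃ c, (P.loop ^ τ) (Finsupp.single (P.start x) 1) c ≠ 0 ∧ c.st ∈ P.F)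
    (φ : Qustring n) : P.toQTM.HaltsAt (P.toQTM.initQ φ) ((P.n + 1) * τ) := by
  obtain ⟨hs1, x, hx, hxs⟩ := initQ_support P.toQTM φ
  constructor
  · intro γ hγ
    obtain ⟨y, hy, hy0⟩ := hs1 _ hγ.1
    obtain ⟨k1, k2⟩ := P.ctl_eq ctl hctl y γ hy0 _ hγ.2
    obtain ⟨c, hc, hcF⟩ := h2 y hy
    rw [run_mul] at k2
    refine ⟨k1.trans (P.pc_mul τ), ?_⟩
    exact (hF _ _ (k2 c hc)).2 hcF
  · intro s hs
    by_contra! hlt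
    obtain ⟨γ, hγ0, hγ⟩ := P.exists_path hg (P.toQTM.init x)
    obtain ⟨hf1, hf2⟩ := hs γ ⟨hγ0 ▸ hxs, fun s _ => hγ s⟩
    obtain ⟨k1, k2⟩ := P.ctl_eq ctl hctl x γ hγ0 s fun s _ => hγ s
    have hdvd : P.n + 1 ∣ s := P.dvd_of_pc (k1.symm.trans hf1)
    obtain ⟨t, rfl⟩ := hdvd
    obtain ⟨c, hc, hcF⟩ := h1 x hx t (Nat.lt_of_mul_lt_mul_left hlt)
    rw [run_mul] at k2
    exact hcF ((hF _ _ (k2 c hc)).1 hf2)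

end Program

lemma runningTime_eq {M : QTM} {Φ : M.Superposition} {t : ℕ} (h : M.HaltsAt Φ t) :
    M.runningTime Φ = t := IsLeast.csInf_eq h

/-- A classical input as a qustring. -/
lemma exists_qustring (M : QTM) (x : List Bool) :
    ∃ φ : Qustring x.length, M.initQ φ = Finsupp.single (M.init x) 1 := by
  classical
  let v : List.Vector Bool x.length := ⟨x, rfl⟩
  refine ⟨⟨fun y => if y = v then 1 else 0, ?_⟩, ?_⟩
  · rw [Finset.sum_eq_single v]
    · simp
    · intro y _ hy; simp [hy]
    · simp
  · unfold QTM.initQ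
    rw [Finset.sum_eq_single v]
    · show Finsupp.single (M.init x) (if v = v then (1 : ℂ) else 0) = _
      rw [if_pos rfl]
    · intro y _ hy; simp [hy]
    · simp

end SquaredFunction

/-! ### Two copies of the configuration space and the reflections `J r` -/

namespace SquaredFunction

open ComplexConjugate

/-- The residues modulo 3 as head moves. -/
def dir (a : ZMod 3) : HeadMove := if a = 0 then .N else if a = 1 then .R else .L

lemma dir_cast (a : ZMod 3) : (((dir a).toInt : ℤ) : ZMod 3) = a := by
  revert a; decide

lemma dir_bijective : Function.Bijective dir := by decide

lemma dir_zero : dir 0 = .N := rfl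

lemma toInt_injective : Function.Injective HeadMove.toInt := by
  intro a b; cases a <;> cases b <;> simp [HeadMove.toInt]

lemma abs_toInt_le (d : HeadMove) : |d.toInt| ≤ 1 := by cases d <;> simp [HeadMove.toInt]

/-- The unique integer at distance at most one from `h` that is congruent to `r` modulo 3. -/
def center (r : ZMod 3) (h : ℤ) : ℤ := h - (dir (h - r)).toInt

lemma center_cast (r : ZMod 3) (h : ℤ) : ((center r h : ℤ) : ZMod 3) = r := by
  rw [center, Int.cast_sub, dir_cast]; ring

lemma center_add (r l : ZMod 3) (z : ℤ) (hz : ((z : ℤ) : ZMod 3) = r) :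
    center r (z + (dir (l - r)).toInt) = z := by
  rw [center, Int.cast_add, hz, dir_cast, add_sub_cancel_left, add_sub_cancel_right]

lemma center_eq_self {r : ZMod 3} {h : ℤ} (hr : (h : ZMod 3) = r) : center r h = h := by
  rw [center, hr, sub_self, dir_zero]; exact sub_zero _

variable (M : QTM)

lemma U_single (c : M.Conf) : M.U (Finsupp.single c 1) = M.stepVec c := by simp [QTM.U]

lemma next_injective (c : M.Conf) : Function.Injective
    fun z : M.Q × M.Symbols × (Fin M.k → HeadMove) => c.next z.1 z.2.1 z.2.2 := by
  rintro ⟨q, τ, d⟩ ⟨q', τ', d'⟩ h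
  have h1 : q = q' := congrArg QTM.Conf.state h
  have h2 := congrArg QTM.Conf.head h
  have h3 := congrArg QTM.Conf.tape h
  refine Prod.ext h1 (Prod.ext (funext fun i => ?_) (funext fun i => ?_))
  · simpa [QTM.Conf.next] using congrFun (congrFun h3 i) (c.head i)
  · exact toInt_injective (add_left_cancel (congrFun h2 i))

/-- The transition amplitudes of a well-formed machine form an isometry. -/
lemma delta_orthonormal [DecidableEq M.Q] [DecidableEq M.Symbols] (hM : M.WellFormed)
    (p p' : M.Q) (σ σ' : M.Symbols) :
    ∑ q, ∑ τ, ∑ d, conj (M.δ p σ q τ d) * M.δ p' σ' q τ d =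
      if (p, σ) = (p', σ') then 1 else 0 := by
  classical
  -- The images of configurations that differ only in state and scanned symbols are superpositions
  -- of the same configurations, so that their inner product is that of the amplitudes.
  let conf : M.Q → M.Symbols → M.Conf := fun p σ =>
    { state := p
      head := fun _ => 0
      tape := fun i z => if z = 0 then σ i else M.blankAt i
      finite_nonblank := fun i => (Set.finite_singleton (0 : ℤ)).subset fun z hz => by
        by_contra h
        exact hz (if_neg h) }
  have hnext : ∀ q τ d, (conf p' σ').next q τ d = (conf p σ).next q τ d := fun q τ d => by
    refine QTM.Conf.ext rfl rfl (funext fun i => funext fun z => ?_)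
    by_cases hz : z = 0
    · simp [QTM.Conf.next, conf, hz]
    · simp [QTM.Conf.next, conf, hz, Function.update_of_ne]
  have hscan : ∀ p σ, (conf p σ).scanned = σ := fun p σ => funext fun i => by
    simp [conf, QTM.Conf.scanned]
  have h := isom_of_wellFormed hM (Finsupp.single (conf p σ) 1) (Finsupp.single (conf p' σ') 1)
  let v : M.Q → M.Symbols → (M.Q × M.Symbols × (Fin M.k → HeadMove) →₀ ℂ) := fun p σ =>
    Finsupp.equivFunOnFinite.symm fun z => M.δ p σ z.1 z.2.1 z.2.2
  have hstep : ∀ p' σ', (∀ q τ d, (conf p' σ').next q τ d = (conf p σ).next q τ d) →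
      M.U (Finsupp.single (conf p' σ') 1) =
      Finsupp.mapDomain (fun z => (conf p σ).next z.1 z.2.1 z.2.2) (v p' σ') := by
    intro p' σ' hn
    rw [U_single, QTM.stepVec, Finsupp.mapDomain, Finsupp.sum_fintype _ _ (by simp),
      Fintype.sum_prod_type]
    refine Finset.sum_congr rfl fun q _ => ?_
    rw [Fintype.sum_prod_type]
    refine Finset.sum_congr rfl fun τ _ => Finset.sum_congr rfl fun d _ => ?_
    rw [hn, hscan]; rfl
  rw [hstep p σ (fun _ _ _ => rfl), hstep p' σ' hnext, ip_mapDomain (next_injective M _), ip_def,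
    Finsupp.sum_fintype _ _ (by simp), Fintype.sum_prod_type, ip_single_single] at h
  simp only [Fintype.sum_prod_type] at h
  have hc : conf p σ = conf p' σ' ↔ (p, σ) = (p', σ') := by
    constructor
    · intro h
      have h1 : p = p' := congrArg QTM.Conf.state h
      have h2 : (conf p σ).scanned = (conf p' σ').scanned := by rw [h]
      rw [hscan, hscan] at h2
      rw [h1, h2]
    · intro h
      obtain ⟨rfl, rfl⟩ := Prod.ext_iff.1 h
      rfl
  simp only [hc, map_one, mul_one] at h
  rw [← h]
  refine Finset.sum_congr rfl fun q _ => Finset.sum_congr rfl fun τ _ =>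
    Finset.sum_congr rfl fun d _ => mul_comm _ _

/-- The data on which a reflection acts: the copy, the state, the head positions modulo 3, and
the symbols in the cells around which the reflection is centred. -/
abbrev Loc : Type := Bool × M.Q × (Fin M.k → ZMod 3) × M.Symbols

open Classical in
/-- The columns of this matrix are the vectors `|0, p, σ⟩ - |1, U (p, σ)⟩` (of norm `√2`), for a
machine in state `p` that scans `σ` with heads at positions congruent to `r` modulo 3. -/
noncomputable def reflVec (r : Fin M.k → ZMod 3) : Matrix (Loc M) (M.Q × M.Symbols) ℂ :=
  fun a c => if a.1 then - M.δ c.1 c.2 a.2.1 a.2.2.2 (fun i => dir (a.2.2.1 i - r i))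
    else if a.2 = (c.1, r, c.2) then 1 else 0

/-- The residues modulo 3 and the head moves correspond to each other, relative to `r`. -/
noncomputable def dirEquiv {k : ℕ} (r : Fin k → ZMod 3) : (Fin k → ZMod 3) ≃ (Fin k → HeadMove) :=
  (Equiv.subRight r).trans (Equiv.piCongrRight fun _ => Equiv.ofBijective dir dir_bijective)

open Classical in
/-- The columns of `reflVec M r` are orthogonal, with squared norm `2`. -/
lemma reflVec_gram (hM : M.WellFormed) (r : Fin M.k → ZMod 3) :
    (reflVec M r).conjTranspose * reflVec M r = 1 + 1 := by
  ext ⟨p, σ⟩ ⟨p', σ'⟩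
  have h := delta_orthonormal M hM p p' σ σ'
  rw [Matrix.add_apply, Matrix.one_apply, Matrix.mul_apply, Fintype.sum_prod_type, Fintype.sum_bool]
  congr 1
  · rw [← h, Fintype.sum_prod_type]
    refine Finset.sum_congr rfl fun q _ => ?_
    rw [Fintype.sum_prod_type, Finset.sum_comm]
    refine Finset.sum_congr rfl fun τ _ => ?_
    refine Fintype.sum_equiv (dirEquiv r) _ _ fun l => ?_
    simp [reflVec, dirEquiv]
    rfl
  · simp only [reflVec, Matrix.conjTranspose_apply]
    rw [Finset.sum_eq_single (p, r, σ)]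
    · simp
    · intro a _ ha
      simp [ha]
    · simp

/-- The reflection `1 - X Xᴴ` about the (pairwise orthogonal) columns of `X = reflVec M r`. -/
noncomputable def reflMat (r : Fin M.k → ZMod 3) [DecidableEq (Loc M)] :
    Matrix (Loc M) (Loc M) ℂ := 1 - reflVec M r * (reflVec M r).conjTranspose

lemma reflMat_isHermitian (r : Fin M.k → ZMod 3) [DecidableEq (Loc M)] :
    (reflMat M r).IsHermitian := by
  simp [reflMat, Matrix.IsHermitian, Matrix.conjTranspose_sub, Matrix.conjTranspose_mul]

lemma reflMat_unitary (hM : M.WellFormed) (r : Fin M.k → ZMod 3) [DecidableEq (Loc M)] :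
    (reflMat M r).conjTranspose * reflMat M r = 1 := by
  classical
  rw [(reflMat_isHermitian M r).eq, reflMat]
  have h := reflVec_gram M hM r
  set X := reflVec M r
  have : X * X.conjTranspose * (X * X.conjTranspose) =
      X * X.conjTranspose + X * X.conjTranspose := by
    rw [Matrix.mul_assoc, ← Matrix.mul_assoc X.conjTranspose, h, Matrix.add_mul, Matrix.one_mul,
      Matrix.mul_add]
  rw [sub_mul, mul_sub, mul_sub, this, one_mul, mul_one, one_mul]
  abel

/-- Access to the copy, the state, and, on each tape, the head and the centre of its block, that
is, the cell congruent to `r` at distance at most one from the head. The head is placed by its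
residue modulo 3, within the same block. -/
def dataLens (r : Fin M.k → ZMod 3) : Lens (Bool × M.Conf) (Loc M) where
  loc y := (y.1, y.2.state, fun i => (y.2.head i : ZMod 3),
    fun i => y.2.tape i (center (r i) (y.2.head i)))
  put y a := (a.1,
    { state := a.2.1
      head := fun i => center (r i) (y.2.head i) + (dir (a.2.2.1 i - r i)).toInt
      tape := fun i => Function.update (y.2.tape i) (center (r i) (y.2.head i)) (a.2.2.2 i)
      finite_nonblank := fun i => by
        refine ((y.2.finite_nonblank i).insert (center (r i) (y.2.head i))).subset fun z hz => ?_
        by_cases h : z = center (r i) (y.2.head i)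
        · exact Or.inl h
        · right
          simpa [Function.update_of_ne h] using hz })
  loc_put y a := by
    refine Prod.ext rfl (Prod.ext rfl (Prod.ext (funext fun i => ?_) (funext fun i => ?_)))
    · simp [center_cast, dir_cast]
    · simp [center_add _ _ _ (center_cast _ _)]
  put_loc y := by
    refine Prod.ext rfl (QTM.Conf.ext rfl (funext fun i => ?_) (funext fun i => ?_))
    · simp [center]
    · simp
  put_put y a b := by
    refine Prod.ext rfl (QTM.Conf.ext rfl (funext fun i => ?_) (funext fun i => ?_))
    · simp [center_add _ _ _ (center_cast _ _)]
    · simp [center_add _ _ _ (center_cast _ _)]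

open Classical in
/-- The reflection about the vectors `|0, c⟩ - |1, U c⟩`, for all `c` whose heads are at positions
congruent to `r` modulo 3. -/
noncomputable def J (r : Fin M.k → ZMod 3) : (Bool × M.Conf →₀ ℂ) →ₗ[ℂ] (Bool × M.Conf →₀ ℂ) :=
  (dataLens M r).op fun _ => reflMat M r

lemma J_adjoint (r : Fin M.k → ZMod 3) (Φ Ψ : Bool × M.Conf →₀ ℂ) :
    ip (J M r Φ) Ψ = ip Φ (J M r Ψ) := by
  classical
  exact Lens.op_adjoint _ _ (fun _ _ => rfl) (fun _ => reflMat_isHermitian M r) _ _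

/-- The superposition `Φ` in copy `b`. -/
noncomputable def copy (b : Bool) : (M.Conf →₀ ℂ) →ₗ[ℂ] (Bool × M.Conf →₀ ℂ) :=
  Finsupp.lmapDomain ℂ ℂ (Prod.mk b)

variable {M}

lemma copy_single (b : Bool) (c : M.Conf) (a : ℂ) :
    copy M b (Finsupp.single c a) = Finsupp.single (b, c) a := by
  simp [copy]

lemma ip_copy (b : Bool) (Φ Ψ : M.Conf →₀ ℂ) : ip (copy M b Φ) (copy M b Ψ) = ip Φ Ψ :=
  ip_mapDomain (Prod.mk_right_injective b) Φ Ψ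

lemma ip_single_copy (b : Bool) (c : M.Conf) (Φ : M.Conf →₀ ℂ) :
    ip (Finsupp.single (!b, c) 1) (copy M b Φ) = 0 := by
  rw [ip_single_left, copy, Finsupp.lmapDomain_apply, Finsupp.mapDomain_of_notMem_range, mul_zero]
  rintro ⟨w, hw⟩
  have := congrArg Prod.fst hw
  simp at this

/-- The columns of `reflVec M r` are the local form of the vectors `|0, c⟩ - |1, U c⟩`. -/
lemma sum_reflVec (r : Fin M.k → ZMod 3) (y : Bool × M.Conf) (p : M.Q) (σ : M.Symbols) :
    ∑ a, Finsupp.single ((dataLens M r).put y a) (reflVec M r a (p, σ)) =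
      copy M false (Finsupp.single ((dataLens M r).put y (false, p, r, σ)).2 1) -
        copy M true (M.U (Finsupp.single ((dataLens M r).put y (false, p, r, σ)).2 1)) := by
  classical
  set c₂ := ((dataLens M r).put y (false, p, r, σ)).2 with hc₂
  rw [Fintype.sum_prod_type, Fintype.sum_bool, add_comm, sub_eq_add_neg]
  congr 1
  · rw [Finset.sum_eq_single (p, r, σ)]
    · rw [copy_single]; simp [reflVec, hc₂]; rfl
    · intro a _ ha
      simp [reflVec, ha]
    · simp
  · rw [U_single, QTM.stepVec, map_sum, ← Finset.sum_neg_distrib, Fintype.sum_prod_type]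
    refine Finset.sum_congr rfl fun q _ => ?_
    rw [Fintype.sum_prod_type, Finset.sum_comm, map_sum, ← Finset.sum_neg_distrib]
    refine Finset.sum_congr rfl fun τ _ => ?_
    rw [map_sum, ← Finset.sum_neg_distrib]
    refine Fintype.sum_equiv (dirEquiv r) _ _ fun l => ?_
    rw [copy_single, ← Finsupp.single_neg]
    have hs : c₂.scanned = σ := by
      funext i
      simp [hc₂, QTM.Conf.scanned, dataLens, dir_zero, HeadMove.toInt]
    have hst : c₂.state = p := rfl
    have hput : (dataLens M r).put y (true, q, l, τ) = (true, c₂.next q τ (dirEquiv r l)) := by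
      refine Prod.ext rfl (QTM.Conf.ext rfl (funext fun i => ?_) (funext fun i => ?_))
      · simp [hc₂, dataLens, QTM.Conf.next, dir_zero, HeadMove.toInt, dirEquiv]
      · simp [hc₂, dataLens, QTM.Conf.next, dir_zero, HeadMove.toInt]
    rw [hput, hs, hst]
    rfl

lemma J_single (r : Fin M.k → ZMod 3) (y : Bool × M.Conf) :
    J M r (Finsupp.single y 1) = Finsupp.single y 1 - ∑ z : M.Q × M.Symbols,
      conj (reflVec M r ((dataLens M r).loc y) z) •
      (copy M false (Finsupp.single ((dataLens M r).put y (false, z.1, r, z.2)).2 1) -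
        copy M true (M.U (Finsupp.single ((dataLens M r).put y (false, z.1, r, z.2)).2 1))) := by
  classical
  rw [J, Lens.op_single]
  simp only [reflMat, Matrix.sub_apply, Finsupp.single_sub, Finset.sum_sub_distrib]
  congr 1
  · rw [Finset.sum_eq_single ((dataLens M r).loc y)]
    · rw [Matrix.one_apply_eq, Lens.put_loc]
    · intro a _ ha
      rw [Matrix.one_apply_ne ha, Finsupp.single_zero]
    · simp
  · simp only [Matrix.mul_apply, single_sum]
    rw [Finset.sum_comm]
    refine Finset.sum_congr rfl fun z _ => ?_
    rw [← sum_reflVec, Finset.smul_sum]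
    refine Finset.sum_congr rfl fun a _ => ?_
    rw [Finsupp.smul_single, Matrix.conjTranspose_apply, smul_eq_mul, mul_comm]
    rfl

/-- The reflection `J r` fixes the other basis states of copy `0`. -/
lemma J_copy_false_of_ne (r : Fin M.k → ZMod 3) (c : M.Conf)
    (h : (fun i => (c.head i : ZMod 3)) ≠ r) :
    J M r (copy M false (Finsupp.single c 1)) = copy M false (Finsupp.single c 1) := by
  rw [copy_single, J_single, Finset.sum_eq_zero, sub_zero]
  intro z _
  have : reflVec M r ((dataLens M r).loc (false, c)) z = 0 := by
    simp [reflVec, dataLens, h]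
  rw [this]; simp

/-- The reflection `J r` exchanges `|0, c⟩` and `|1, U c⟩`, if the heads of `c` are at positions
congruent to `r`. -/
lemma J_copy_false_of_eq (r : Fin M.k → ZMod 3) (c : M.Conf)
    (h : (fun i => (c.head i : ZMod 3)) = r) :
    J M r (copy M false (Finsupp.single c 1)) = copy M true (M.U (Finsupp.single c 1)) := by
  have hcen : ∀ i, center (r i) (c.head i) = c.head i := fun i =>
    center_eq_self (by rw [← h])
  have hloc : (dataLens M r).loc (false, c) = (false, c.state, r, c.scanned) := by
    refine Prod.ext rfl (Prod.ext rfl (Prod.ext h (funext fun i => ?_)))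
    exact congrArg (c.tape i) (hcen i)
  rw [copy_single, J_single, Finset.sum_eq_single (c.state, c.scanned)]
  · have h1 : reflVec M r ((dataLens M r).loc (false, c)) (c.state, c.scanned) = 1 := by
      rw [hloc]; simp [reflVec]
    have h2 : ((dataLens M r).put (false, c) (false, c.state, r, c.scanned)).2 = c := by
      refine QTM.Conf.ext rfl (funext fun i => ?_) (funext fun i => ?_)
      · simp [dataLens, hcen, dir_zero, HeadMove.toInt]
      · simp [dataLens, hcen, QTM.Conf.scanned]
    rw [h1, h2, map_one, one_smul, copy_single]
    abel
  · rintro ⟨p, σ⟩ _ hz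
    have : reflVec M r ((dataLens M r).loc (false, c)) (p, σ) = 0 := by
      rw [hloc]
      have hne : ¬ ((c.state, r, c.scanned) = (p, r, σ)) := fun h' => by
        obtain ⟨rfl, h''⟩ := Prod.ext_iff.1 h'
        exact hz (Prod.ext rfl (Prod.ext_iff.1 h'').2.symm)
      simp only [reflVec, Bool.false_eq_true, if_false]
      exact if_neg hne
    rw [this]; simp
  · simp

/-- The reflection `J r` fixes `|1, U c⟩` if the heads of `c` are not at positions congruent to `r`:
since `U` is an isometry, this vector is orthogonal to those reflected. -/
lemma J_copy_true_of_ne (hM : M.WellFormed) (r : Fin M.k → ZMod 3) (c : M.Conf)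
    (h : (fun i => (c.head i : ZMod 3)) ≠ r) :
    J M r (copy M true (M.U (Finsupp.single c 1))) = copy M true (M.U (Finsupp.single c 1)) := by
  classical
  ext y
  have key : ip (J M r (Finsupp.single y 1)) (copy M true (M.U (Finsupp.single c 1))) =
      ip (Finsupp.single y 1) (copy M true (M.U (Finsupp.single c 1))) := by
    rw [J_single, ip_sub_left, ip_sum_left, Finset.sum_eq_zero, sub_zero]
    intro z _
    have hne : ((dataLens M r).put y (false, z.1, r, z.2)).2 ≠ c := by
      rintro rfl
      refine h (funext fun i => ?_)
      simp [dataLens, dir_zero, HeadMove.toInt, center_cast]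
    rw [ip_smul_left, ip_sub_left, copy_single, ip_copy, isom_of_wellFormed hM, ip_single_single,
      if_neg hne, sub_zero]
    have := ip_single_copy true ((dataLens M r).put y (false, z.1, r, z.2)).2
      (M.U (Finsupp.single c 1))
    rw [Bool.not_true] at this
    rw [this, mul_zero]
  rw [J_adjoint, ip_single_left, ip_single_left] at key
  simpa using key

/-! ### A unitary dilation of the evolution operator -/

variable (M) in
/-- The composition of the reflections `J r`, for `r` in the list `l`, the head of `l` first. -/
noncomputable def Jlist : List (Fin M.k → ZMod 3) →
    (Bool × M.Conf →₀ ℂ) →ₗ[ℂ] (Bool × M.Conf →₀ ℂ)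
  | [] => LinearMap.id
  | r :: l => Jlist l ∘ₗ J M r

lemma Jlist_append (l l' : List (Fin M.k → ZMod 3)) :
    Jlist M (l ++ l') = Jlist M l' ∘ₗ Jlist M l := by
  induction l with
  | nil => rfl
  | cons r l ih => rw [List.cons_append, Jlist, ih, Jlist, LinearMap.comp_assoc]

lemma Jlist_adjoint (l : List (Fin M.k → ZMod 3)) (Φ Ψ : Bool × M.Conf →₀ ℂ) :
    ip (Jlist M l Φ) Ψ = ip Φ (Jlist M l.reverse Ψ) := by
  induction l generalizing Φ with
  | nil => rfl
  | cons r l ih =>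
    rw [Jlist, LinearMap.comp_apply, ih, J_adjoint, List.reverse_cons, Jlist_append]
    rfl

lemma Jlist_copy_true (hM : M.WellFormed) (l : List (Fin M.k → ZMod 3)) (c : M.Conf)
    (h : (fun i => (c.head i : ZMod 3)) ∉ l) :
    Jlist M l (copy M true (M.U (Finsupp.single c 1))) =
      copy M true (M.U (Finsupp.single c 1)) := by
  induction l with
  | nil => rfl
  | cons r l ih =>
    rw [List.mem_cons, not_or] at h
    rw [Jlist, LinearMap.comp_apply, J_copy_true_of_ne hM r c h.1, ih h.2]

lemma Jlist_copy_false_single (hM : M.WellFormed) (l : List (Fin M.k → ZMod 3)) (hl : l.Nodup)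
    (c : M.Conf) (h : (fun i => (c.head i : ZMod 3)) ∈ l) :
    Jlist M l (copy M false (Finsupp.single c 1)) = copy M true (M.U (Finsupp.single c 1)) := by
  induction l with
  | nil => simp at h
  | cons r l ih =>
    rw [List.nodup_cons] at hl
    rw [Jlist, LinearMap.comp_apply]
    by_cases hr : (fun i => (c.head i : ZMod 3)) = r
    · rw [J_copy_false_of_eq r c hr, Jlist_copy_true hM l c (hr ▸ hl.1)]
    · rw [J_copy_false_of_ne r c hr, ih hl.2 ((List.mem_cons.1 h).resolve_left hr)]

/-- Each basis state of copy `0` is moved by exactly one of the reflections, after which the others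
fix its image. -/
lemma Jlist_copy_false (hM : M.WellFormed) (l : List (Fin M.k → ZMod 3)) (hl : l.Nodup)
    (hl' : ∀ r, r ∈ l) (Φ : M.Conf →₀ ℂ) :
    Jlist M l (copy M false Φ) = copy M true (M.U Φ) := by
  induction Φ using Finsupp.induction_linear with
  | zero => simp
  | add a b ha hb => simp only [map_add, ha, hb]
  | single c a =>
    rw [← Finsupp.smul_single_one, map_smul, map_smul, map_smul, map_smul,
      Jlist_copy_false_single hM l hl c (hl' _)]

variable (M) in
/-- Exchange of the two copies. -/
noncomputable def flip : (Bool × M.Conf →₀ ℂ) →ₗ[ℂ] (Bool × M.Conf →₀ ℂ) :=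
  Finsupp.lmapDomain ℂ ℂ fun y => (!y.1, y.2)

lemma flip_copy (b : Bool) (Φ : M.Conf →₀ ℂ) : flip M (copy M b Φ) = copy M (!b) Φ := by
  rw [flip, copy, Finsupp.lmapDomain_apply, Finsupp.lmapDomain_apply, ← Finsupp.mapDomain_comp]
  rfl

lemma flip_flip (Φ : Bool × M.Conf →₀ ℂ) : flip M (flip M Φ) = Φ := by
  rw [flip, Finsupp.lmapDomain_apply, Finsupp.lmapDomain_apply, ← Finsupp.mapDomain_comp]
  conv_rhs => rw [← Finsupp.mapDomain_id (v := Φ)]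
  congr 1
  funext y
  simp

lemma flip_adjoint (Φ Ψ : Bool × M.Conf →₀ ℂ) : ip (flip M Φ) Ψ = ip Φ (flip M Ψ) := by
  have hinj : Function.Injective fun y : Bool × M.Conf => (!y.1, y.2) := by
    rintro ⟨a, c⟩ ⟨a', c'⟩ h
    simpa using h
  calc ip (flip M Φ) Ψ = ip (flip M Φ) (flip M (flip M Ψ)) := by rw [flip_flip]
    _ = ip Φ (flip M Ψ) := by
      generalize flip M Ψ = Ψ'
      rw [flip, Finsupp.lmapDomain_apply, Finsupp.lmapDomain_apply, ip_mapDomain hinj]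

variable (M) in
/-- A unitary operator on two copies of the configuration space which acts on copy `0` as `U`. -/
noncomputable def G (l : List (Fin M.k → ZMod 3)) :
    (Bool × M.Conf →₀ ℂ) →ₗ[ℂ] (Bool × M.Conf →₀ ℂ) := flip M ∘ₗ Jlist M l

section G
variable (hM : M.WellFormed) {l : List (Fin M.k → ZMod 3)} (hl : l.Nodup) (hl' : ∀ r, r ∈ l)
include hM hl hl'

lemma G_pow_copy_false (m : ℕ) (Φ : M.Conf →₀ ℂ) :
    (G M l ^ m) (copy M false Φ) = copy M false ((M.U ^ m) Φ) := by
  induction m with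
  | zero => rfl
  | succ m ih =>
    rw [pow_succ', Module.End.mul_apply, ih, G, LinearMap.comp_apply,
      Jlist_copy_false hM l hl hl', flip_copy, pow_succ', Module.End.mul_apply]
    rfl

/-- On copy `1`, the adjoint of `G` acts as `U`. -/
lemma ip_copy_true_G_pow (m : ℕ) (Φ : M.Conf →₀ ℂ) (Ψ : Bool × M.Conf →₀ ℂ) :
    ip (copy M true Φ) ((G M l ^ m) Ψ) = ip (copy M true ((M.U ^ m) Φ)) Ψ := by
  induction m generalizing Ψ with
  | zero => rfl
  | succ m ih =>
    rw [pow_succ, Module.End.mul_apply, ih, G, LinearMap.comp_apply, ← flip_adjoint, flip_copy,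
      ← ip_conj, Jlist_adjoint, ip_conj, Bool.not_true,
      Jlist_copy_false hM l.reverse (List.nodup_reverse.2 hl) (by simpa using hl'),
      pow_succ', Module.End.mul_apply]

end G

/-! ### Locality -/

variable (M) in
/-- The data whose heads are at distance at most `R` from the start cell, and whose tapes agree
with `c₀` at larger distances. -/
def Near (c₀ : M.Conf) (R : ℕ) : Set (Bool × M.Conf) :=
  {y | (∀ i, |y.2.head i| ≤ R) ∧ ∀ i z, (R : ℤ) < |z| → y.2.tape i z = c₀.tape i z}

/-- A reflection changes head positions by at most two: one move to the centre of the block, one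
move away from it. -/
lemma J_near {c₀ : M.Conf} {R : ℕ} (r : Fin M.k → ZMod 3) {Φ : Bool × M.Conf →₀ ℂ}
    (h : ∀ y, Φ y ≠ 0 → y ∈ Near M c₀ R) (y : Bool × M.Conf) (hy : J M r Φ y ≠ 0) :
    y ∈ Near M c₀ (R + 2) := by
  classical
  obtain ⟨z, hz, hzy⟩ := exists_of_apply_ne_zero _ _ _ hy
  obtain ⟨hz1, hz2⟩ := h z hz
  rw [J, Lens.op_single, Finsupp.finsetSum_apply] at hzy
  obtain ⟨a, -, ha⟩ := Finset.exists_ne_zero_of_sum_ne_zero hzy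
  have hya : (dataLens M r).put z a = y := by
    by_contra hne
    exact ha (Finsupp.single_eq_of_ne (Ne.symm hne))
  subst hya
  have hc : ∀ i, |center (r i) (z.2.head i)| ≤ R + 1 := fun i => by
    have h1 := hz1 i
    have h2 := abs_toInt_le (dir ((z.2.head i : ZMod 3) - r i))
    rw [center]
    rw [abs_le] at *
    constructor <;> omega
  refine ⟨fun i => ?_, fun i x hx => ?_⟩
  · have h1 := hc i
    have h2 := abs_toInt_le (dir (a.2.2.1 i - r i))
    simp only [dataLens]
    rw [abs_le] at *
    push_cast
    constructor <;> omega
  · push_cast at hx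
    have h1 := hc i
    have hne : x ≠ center (r i) (z.2.head i) := by
      rintro rfl
      omega
    simp only [dataLens]
    rw [Function.update_of_ne hne]
    exact hz2 i x (by omega)

lemma Jlist_near {c₀ : M.Conf} {R : ℕ} (l : List (Fin M.k → ZMod 3)) {Φ : Bool × M.Conf →₀ ℂ}
    (h : ∀ y, Φ y ≠ 0 → y ∈ Near M c₀ R) (y : Bool × M.Conf) (hy : Jlist M l Φ y ≠ 0) :
    y ∈ Near M c₀ (R + 2 * l.length) := by
  induction l generalizing R Φ with
  | nil => exact h y hy
  | cons r l ih =>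
    have := ih (J_near r h) hy
    rw [List.length_cons]
    convert this using 1
    ring_nf

lemma flip_near {c₀ : M.Conf} {R : ℕ} {Φ : Bool × M.Conf →₀ ℂ}
    (h : ∀ y, Φ y ≠ 0 → y ∈ Near M c₀ R) (y : Bool × M.Conf) (hy : flip M Φ y ≠ 0) :
    y ∈ Near M c₀ R := by
  classical
  obtain ⟨z, hz, rfl⟩ := Finset.mem_image.1
    (Finsupp.mapDomain_support (Finsupp.mem_support_iff.2 hy))
  exact h z (Finsupp.mem_support_iff.1 hz)

lemma G_pow_near {c₀ : M.Conf} {R : ℕ} (l : List (Fin M.k → ZMod 3)) (m : ℕ)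
    {Φ : Bool × M.Conf →₀ ℂ} (h : ∀ y, Φ y ≠ 0 → y ∈ Near M c₀ R) (y : Bool × M.Conf)
    (hy : (G M l ^ m) Φ y ≠ 0) : y ∈ Near M c₀ (R + 2 * l.length * m) := by
  induction m generalizing y with
  | zero => exact h y hy
  | succ m ih =>
    rw [pow_succ', Module.End.mul_apply] at hy
    have := flip_near (Jlist_near l ih) y hy
    convert this using 1
    ring_nf

end SquaredFunction

/-! ### The gates of the squaring program -/

namespace SquaredFunction

open ComplexConjugate

/-- The tapes of the squaring program: those of the simulated machine, one tape with a marked start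
cell for each of these, `D` clock tapes, the input tape and the output tape. -/
inductive Tp (k D : ℕ) : Type
  | m (i : Fin k)
  | mark (i : Fin k)
  | clk (i : Fin D)
  | inp
  | out
  deriving DecidableEq, Fintype

/-- The states of the squaring program: the phase, the directions of the clock heads, and, for the
simulated machine, its state `q`, the copy `b` and the head positions `l` modulo 3. In each pass
the program acts with the gates `gOp`, `gCheck`, those of the simulation, and `gTick`, in this
order; `gTick` passes to the next phase if all clock heads are in their initial positions, and then
makes the moves of the current phase. From phase 5 on, the simulated heads are accompanied by the
heads on the marked tapes. The phases are:

* 0: the start cells are marked;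
* 1: the clock heads, the input head and the simulated input head move to cell `-1`;
* 2: moving right, they copy the input to the clock tapes and to the simulated input tape;
* 3: they return to cell `-1`;
* 4: the input head and the simulated input head move to cell `0`, the clock heads stay in cell
  `-1`;
* 5: `M` is simulated;
* 6, 7, 8, 9: the simulated heads sweep to the right, back, to the left, and back; the sign of the
  output is applied in 7 and 8;
* 10: the copies are exchanged;
* 11: `M` is simulated again;
* 12: copy, state and head positions are compared with the initial ones;
* 13, 14, 15: the simulated heads sweep to the right, back, and to the left, while the simulated
  tapes are compared with the initial ones;
* 16: the result is written;
* 17: the final phase. -/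
@[ext]
structure St (M : QTM) (D : ℕ) : Type where
  φ : Fin 18
  dirs : Fin D → Bool
  q : M.Q
  b : Bool
  l : Fin M.k → ZMod 3

noncomputable instance (M : QTM) (D : ℕ) : Fintype (St M D) :=
  Fintype.ofInjective
    (fun s : St M D => (s.φ, s.dirs, s.q, s.b, s.l)) fun s s' h => by
      simp only [Prod.mk.injEq] at h
      exact St.ext h.1 h.2.1 h.2.2.1 h.2.2.2.1 h.2.2.2.2

/-- The move in the opposite direction. -/
def negMove : HeadMove → HeadMove
  | .L => .R
  | .N => .N
  | .R => .L

lemma negMove_toInt (d : HeadMove) : (negMove d).toInt = - d.toInt := by cases d <;> rfl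

section noMove
variable {ι : Type} {Γ : ι → Type} {S : Type}

@[simp] lemma PC.next_scan_tp (c : PC Γ S) (q : S) (d : ι → HeadMove) :
    (c.next q c.scan d).tp = c.tp := by
  funext i
  exact Function.update_eq_self _ _

lemma PC.scan_next_N (c : PC Γ S) (q : S) (τ : ∀ i, Γ i) : (c.next q τ fun _ => .N).scan = τ := by
  funext i
  simp [PC.scan, PC.next, HeadMove.toInt]

lemma PC.next_next_N (c : PC Γ S) (q q' : S) (τ τ' : ∀ i, Γ i) (d : ι → HeadMove) :
    (c.next q τ fun _ => .N).next q' τ' d = c.next q' τ' d := by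
  refine PC.ext rfl (funext fun i => ?_) (funext fun i => ?_)
  · simp [PC.next, HeadMove.toInt]
  · simp [PC.next, HeadMove.toInt]

lemma PC.next_self (c : PC Γ S) : (c.next c.st c.scan fun _ => .N) = c :=
  PC.ext rfl (funext fun i => by simp [PC.next, HeadMove.toInt]) (PC.next_scan_tp c _ _)

/-- A deterministic gate without moves is injective if its transition is an involution. -/
lemma branch_injective_of_involutive (f : S → (∀ i, Γ i) → S × (∀ i, Γ i))
    (sg : S → (∀ i, Γ i) → ℂ) (hf : ∀ s σ, f (f s σ).1 (f s σ).2 = (s, σ)) :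
    Function.Injective fun c =>
      (Gate.classical (fun s σ => ((f s σ).1, (f s σ).2, fun _ => HeadMove.N)) sg).branch c () := by
  refine Function.LeftInverse.injective (g := fun c =>
    (Gate.classical (fun s σ => ((f s σ).1, (f s σ).2, fun _ => HeadMove.N)) sg).branch c ())
    fun c => ?_
  simp only [Gate.branch, Gate.classical_tgt, PC.scan_next_N, PC.next_next_N]
  show c.next (f (f c.st c.scan).1 (f c.st c.scan).2).1
    (f (f c.st c.scan).1 (f c.st c.scan).2).2 _ = c
  rw [hf]
  exact PC.next_self c

end noMove

section defs
variable (M : QTM) (D : ℕ)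

/-- The symbols of the auxiliary tapes. -/
abbrev Sym : Type := M.tapeAlph M.inputTape

/-- The blank of the auxiliary tapes. -/
def blk : Sym M := M.blankAt M.inputTape

/-- The symbol `1` of the auxiliary tapes. -/
def one : Sym M := ⟨M.bit true, M.ioAlph_subset _ (M.bit_mem true)⟩

lemma one_ne_blk : one M ≠ blk M := fun h => M.bit_ne_blank true (congrArg Subtype.val h)

/-- The tape of `M` whose alphabet a tape of the squaring program uses. -/
def base : Tp M.k D → Fin M.k
  | .m i => i
  | .mark _ => M.inputTape
  | .clk _ => M.inputTape
  | .inp => M.inputTape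
  | .out => M.inputTape

/-- The alphabets of the squaring program. -/
abbrev Al (i : Tp M.k D) : Type := M.tapeAlph (base M D i)

/-- Tuples of symbols of the squaring program. -/
abbrev Sg : Type := ∀ i, Al M D i

variable {M D}

/-- Assembles a family indexed by the tapes from its parts. -/
def mk {A : Tp M.k D → Type*} (m : ∀ i, A (.m i)) (mark : ∀ i, A (.mark i))
    (clk : ∀ i, A (.clk i)) (inp : A .inp) (out : A .out) : ∀ i, A i
  | .m i => m i
  | .mark i => mark i
  | .clk i => clk i
  | .inp => inp
  | .out => out

/-- The clock is in a position that is active for a monomial of degree `j`: the first `j` heads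
scan the input on their way right, the others are in their initial positions. -/
def Act (j : ℕ) (s : St M D) (σ : Sg M D) : Prop :=
  ∀ i : Fin D, if i.1 < j then s.dirs i = true ∧ σ (.clk i) ≠ blk M
    else s.dirs i = false ∧ σ (.clk i) = blk M

/-- Clock head `i` is in its initial position. -/
def AtStart (s : St M D) (σ : Sg M D) (i : Fin D) : Prop :=
  s.dirs i = false ∧ σ (.clk i) = blk M

/-- The phases in which the machine `M` is simulated. -/
def Comp (φ : Fin 18) : Prop := φ = 5 ∨ φ = 11

/-- The phases in which the clock runs. -/
def Adv (φ : Fin 18) : Prop :=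
  φ = 5 ∨ φ = 6 ∨ φ = 7 ∨ φ = 8 ∨ φ = 9 ∨ φ = 11 ∨ φ = 13 ∨ φ = 14 ∨ φ = 15

/-- The move of the simulated heads in each phase. -/
def sweep (φ : Fin 18) : HeadMove :=
  if φ = 6 ∨ φ = 9 ∨ φ = 13 then .R else if φ = 7 ∨ φ = 8 ∨ φ = 14 ∨ φ = 15 then .L else .N

/-- The move of the input head and of the simulated input head in each phase. -/
def mvIn (φ : Fin 18) : HeadMove :=
  if φ = 1 ∨ φ = 3 then .L else if φ = 2 ∨ φ = 4 then .R else sweep φ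

/-- The move of the clock heads in the phases in which the clock does not run. -/
def mvClk (φ : Fin 18) : HeadMove :=
  if φ = 1 ∨ φ = 3 then .L else if φ = 2 then .R else .N

open Classical in
/-- Exchanges the symbols `a` and `b`. Writing `b` on a blank as `sw blk b` is reversible. -/
noncomputable def sw (a b x : Sym M) : Sym M := Equiv.swap a b x

lemma sw_sw (a b x : Sym M) : sw a b (sw a b x) = x := by simp [sw]

lemma sw_left (a b : Sym M) : sw a b a = b := by simp [sw]

/-- Replaces the symbol of the input tape of `M`. -/
def updIn (τ : M.Symbols) (a : Sym M) : M.Symbols := Function.update τ M.inputTape a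

lemma updIn_self (τ : M.Symbols) (a : Sym M) : updIn τ a M.inputTape = a :=
  Function.update_self _ _ _

lemma updIn_of_ne (τ : M.Symbols) (a : Sym M) {i : Fin M.k} (h : i ≠ M.inputTape) :
    updIn τ a i = τ i := Function.update_of_ne h _ _

/-- The symbols written by the gate `gOp`. -/
noncomputable def opWrite (s : St M D) (σ : Sg M D) : Sg M D :=
  if s.φ = 0 then mk (fun i => σ (.m i)) (fun i => sw (blk M) (one M) (σ (.mark i)))
      (fun i => σ (.clk i)) (σ .inp) (σ .out)
  else if s.φ = 2 then mk
      (updIn (fun i => σ (.m i)) (sw (blk M) (σ .inp) (σ (.m M.inputTape))))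
      (fun i => σ (.mark i)) (fun i => sw (blk M) (σ .inp) (σ (.clk i))) (σ .inp) (σ .out)
  else if s.φ = 16 then mk (fun i => σ (.m i)) (fun i => σ (.mark i))
      (fun i => σ (.clk i)) (σ .inp) (sw (blk M) (one M) (σ .out))
  else σ

open Classical in
/-- The sign of the gate `gOp`. -/
noncomputable def opSign (s : St M D) (σ : Sg M D) : ℂ :=
  if (s.φ = 7 ∨ s.φ = 8) ∧ σ (.mark M.outputTape) = one M ∧
    (σ (.m M.outputTape) : M.Symb) ≠ M.bit true then -1 else 1

/-- The copy is changed in phase 10. -/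
def opState (s : St M D) : St M D := if s.φ = 10 then { s with b := !s.b } else s

/-- Writes the marks (phase 0), copies a symbol of the input (phase 2), changes the sign if the
marked cell of the output tape of `M` does not hold the symbol `1` (phases 7 and 8), changes the
copy (phase 10), and writes the result (phase 16). -/
noncomputable def gOp : Gate (Al M D) (St M D) :=
  Gate.classical (fun s σ => (opState s, opWrite s σ, fun _ => .N)) opSign

/-- A deviation from the initial configuration of `M` in copy `1` is visible. -/
def Fail (s : St M D) (σ : Sg M D) : Prop :=
  (s.φ = 12 ∧ (s.b = false ∨ s.q ≠ M.q₀ ∨ ∃ i, σ (.mark i) ≠ one M)) ∨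
  ((s.φ = 13 ∨ s.φ = 14 ∨ s.φ = 15) ∧
    ∃ i, (σ (.m i) : M.Symb) ≠ if i = M.inputTape then (σ .inp : M.Symb) else M.blank)

open Classical in
/-- Counts deviations by the position of the output head, which moves to the right when one is
visible. -/
noncomputable def gCheck : Gate (Al M D) (St M D) :=
  Gate.classical (fun s σ => (s, σ, fun i => if i = .out ∧ Fail s σ then .R else .N)) fun _ _ => 1

/-- Moves of the simulated heads and of the heads on the marked tapes. -/
def simMoves (d : Fin M.k → HeadMove) : Tp M.k D → HeadMove :=
  mk d d (fun _ => .N) .N .N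

open Classical in
/-- Moves the simulated heads to the centres of their blocks, where block `i` consists of a cell in
a position congruent to `r i` modulo 3 and its two neighbours. As the other gates of the
simulation, this one acts in simulation phases only, when the clock is active for degree `j`. -/
noncomputable def gGather (j : ℕ) (r : Fin M.k → ZMod 3) : Gate (Al M D) (St M D) :=
  Gate.classical (fun s σ => (s, σ, if Comp s.φ ∧ Act j s σ then
    simMoves (fun i => negMove (dir (s.l i - r i))) else fun _ => .N)) fun _ _ => 1

open Classical in
/-- Moves the simulated heads from the centres of their blocks to their positions. -/
noncomputable def gScatter (j : ℕ) (r : Fin M.k → ZMod 3) : Gate (Al M D) (St M D) :=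
  Gate.classical (fun s σ => (s, σ, if Comp s.φ ∧ Act j s σ then
    simMoves (fun i => dir (s.l i - r i)) else fun _ => .N)) fun _ _ => 1

open Classical in
/-- Exchanges the two copies, to complete a step `G` of the simulation. -/
noncomputable def gFlip (j : ℕ) : Gate (Al M D) (St M D) :=
  Gate.classical (fun s σ => (if Comp s.φ ∧ Act j s σ then { s with b := !s.b } else s, σ,
    fun _ => .N)) fun _ _ => 1

/-- The part of state and scanned symbols that belongs to the simulated machine. -/
def simLoc (s : St M D) (σ : Sg M D) : Loc M := (s.b, s.q, s.l, fun i => σ (.m i))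

/-- Replaces the state of the simulated machine. -/
def simSt (s : St M D) (a : Loc M) : St M D := { s with b := a.1, q := a.2.1, l := a.2.2.1 }

/-- Replaces the symbols scanned by the simulated machine. -/
def simSg (σ : Sg M D) (a : Loc M) : Sg M D :=
  mk a.2.2.2 (fun i => σ (.mark i)) (fun i => σ (.clk i)) (σ .inp) (σ .out)

open Classical in
/-- The matrix applied by `gRefl`. -/
noncomputable def simMat (j : ℕ) (r : Fin M.k → ZMod 3) (s : St M D) (σ : Sg M D) :
    Matrix (Loc M) (Loc M) ℂ :=
  if Comp s.φ ∧ Act j s σ then reflMat M r else 1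

/-- The reflection `J r`, with the simulated heads at the centres of their blocks. -/
noncomputable def gRefl (j : ℕ) (r : Fin M.k → ZMod 3) : Gate (Al M D) (St M D) where
  Λ := Loc M
  tgt s σ a := (simSt s a, simSg σ a, fun _ => .N)
  wt s σ a := simMat j r s σ a (simLoc s σ)

open Classical in
/-- The phase after a tick. -/
noncomputable def tickPhase (s : St M D) (σ : Sg M D) : Fin 18 :=
  if ∀ i, AtStart s σ i then s.φ + 1 else s.φ

open Classical in
/-- The directions of the clock heads after a tick: a head that is about to move turns round on a
blank, that is, at the ends of the input. -/
noncomputable def tickDirs (s : St M D) (σ : Sg M D) (i : Fin D) : Bool :=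
  if Adv (tickPhase s σ) ∧ ∀ j < i, AtStart s σ j then xor (s.dirs i) (decide (σ (.clk i) = blk M))
  else s.dirs i

open Classical in
/-- The moves of the clock heads in a tick: an odometer, whose `i`-th wheel advances if all lower
wheels are in their initial positions. -/
noncomputable def tickClk (s : St M D) (σ : Sg M D) (i : Fin D) : HeadMove :=
  if Adv (tickPhase s σ) then
    if ∀ j < i, AtStart s σ j then if tickDirs s σ i then .R else .L else .N
  else mvClk (tickPhase s σ)

/-- Advances the phase if the clock is in its initial position; then moves the heads. -/
noncomputable def gTick : Gate (Al M D) (St M D) :=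
  Gate.classical (fun s σ => ({ s with φ := tickPhase s σ, dirs := tickDirs s σ }, σ,
    mk (fun i => if i = M.inputTape then mvIn (tickPhase s σ) else sweep (tickPhase s σ))
      (fun _ => sweep (tickPhase s σ)) (tickClk s σ) (mvIn (tickPhase s σ)) .N)) fun _ _ => 1

end defs

/-! ### The gates are isometries -/

section isom
variable {M : QTM} {D : ℕ}

lemma opWrite_opWrite (s : St M D) (σ : Sg M D) : opWrite (opState s) (opWrite s σ) = σ := by
  have hφ : (opState s).φ = s.φ := by rw [opState]; split_ifs <;> rfl
  unfold opWrite
  rw [hφ]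
  split_ifs with h0 h2 h16
  · funext i
    cases i with
    | mark i => exact sw_sw _ _ _
    | _ => rfl
  · funext i
    cases i with
    | m i =>
      by_cases hi : i = M.inputTape
      · subst hi
        exact (updIn_self _ _).trans
          ((congrArg (sw (blk M) (σ .inp)) (updIn_self _ _)).trans (sw_sw _ _ _))
      · exact (updIn_of_ne _ _ hi).trans (updIn_of_ne _ _ hi)
    | clk i => exact sw_sw _ _ _
    | _ => rfl
  · funext i
    cases i with
    | out => exact sw_sw _ _ _
    | _ => rfl
  · rfl

lemma opState_opState (s : St M D) : opState (opState s) = s := by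
  unfold opState
  by_cases h : s.φ = 10
  · rw [if_pos h]
    refine (if_pos h).trans ?_
    simp
  · rw [if_neg h, if_neg h]

lemma gOp_isom : Isom (gOp : Gate (Al M D) (St M D)).op := by
  refine Gate.classical_isom _ _ (fun s σ => ?_) ?_
  · unfold opSign; split_ifs <;> simp
  · refine branch_injective_of_involutive (fun s σ => (opState s, opWrite s σ)) _ fun s σ => ?_
    exact Prod.ext (opState_opState s) (opWrite_opWrite s σ)

lemma gFlip_isom (j : ℕ) : Isom (gFlip j : Gate (Al M D) (St M D)).op := by
  classical
  refine Gate.classical_isom _ _ (fun s σ => Or.inl rfl) ?_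
  refine branch_injective_of_involutive
    (fun s σ => (if Comp s.φ ∧ Act j s σ then { s with b := !s.b } else s, σ)) _ fun s σ => ?_
  refine Prod.ext ?_ rfl
  by_cases h : Comp s.φ ∧ Act j s σ
  · have h' : Comp ({ s with b := !s.b } : St M D).φ ∧ Act j { s with b := !s.b } σ := h
    simp only [if_pos h, if_pos h', Bool.not_not]
  · simp only [if_neg h]

/-- Deterministic gates that write nothing are injective if the state and the moves can be recovered
from the result. -/
lemma branch_injective_of_read {ι : Type} {Γ : ι → Type} {S : Type}
    (f : S → (∀ i, Γ i) → S) (g : S → (∀ i, Γ i) → ι → HeadMove)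
    (h : ∀ c c' : PC Γ S, c.tp = c'.tp → f c.st c.scan = f c'.st c'.scan →
      (∀ i, c.hd i + (g c.st c.scan i).toInt = c'.hd i + (g c'.st c'.scan i).toInt) →
      c.st = c'.st ∧ c.hd = c'.hd) :
    Function.Injective fun c =>
      (Gate.classical (fun s σ => (f s σ, σ, g s σ)) fun _ _ => 1).branch c () := by
  intro c c' hcc
  have h1 : f c.st c.scan = f c'.st c'.scan := congrArg PC.st hcc
  have h2 := congrFun (congrArg PC.hd hcc)
  have h3 : (c.next (f c.st c.scan) c.scan (g c.st c.scan)).tp =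
    (c'.next (f c'.st c'.scan) c'.scan (g c'.st c'.scan)).tp := congrArg PC.tp hcc
  rw [PC.next_scan_tp, PC.next_scan_tp] at h3
  obtain ⟨h4, h5⟩ := h c c' h3 h1 h2
  exact PC.ext h4 h5 h3

lemma scan_eq {ι : Type} {Γ : ι → Type} {S : Type} {c c' : PC Γ S} (ht : c.tp = c'.tp) {i : ι}
    (hi : c.hd i = c'.hd i) : c.scan i = c'.scan i := by
  rw [PC.scan, PC.scan, ht, hi]

lemma gCheck_isom : Isom (gCheck : Gate (Al M D) (St M D)).op := by
  classical
  refine Gate.classical_isom _ _ (fun s σ => Or.inl rfl)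
    (branch_injective_of_read (fun s _ => s) _ fun c c' ht hs hm => ?_)
  have hs' : c.st = c'.st := hs
  have h1 : ∀ i, i ≠ .out → c.hd i = c'.hd i := fun i hi => by simpa [hi] using hm i
  have h2 : ∀ i, i ≠ .out → c.scan i = c'.scan i := fun i hi => scan_eq ht (h1 i hi)
  have h3 : Fail c.st c.scan ↔ Fail c'.st c'.scan := by
    unfold Fail
    rw [hs', h2 .inp (by simp)]
    simp only [fun i => h2 (.m i) (by simp), fun i => h2 (.mark i) (by simp)]
  refine ⟨hs', funext fun i => ?_⟩
  have := hm i
  simp only [h3] at this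
  exact add_right_cancel this

lemma act_congr {j : ℕ} {s s' : St M D} {σ σ' : Sg M D} (h : s.dirs = s'.dirs)
    (h' : ∀ i, σ (.clk i) = σ' (.clk i)) : Act j s σ ↔ Act j s' σ' := by
  unfold Act; simp only [h, h']

open Classical in
lemma sim_moves_isom (j : ℕ) (d : St M D → Fin M.k → HeadMove) :
    Isom (Gate.classical (fun (s : St M D) (σ : Sg M D) => (s, σ,
      if Comp s.φ ∧ Act j s σ then simMoves (d s) else fun _ => .N)) fun _ _ => 1).op := by
  refine Gate.classical_isom _ _ (fun s σ => Or.inl rfl)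
    (branch_injective_of_read (fun s _ => s) _ fun c c' ht hs hm => ?_)
  have hs' : c.st = c'.st := hs
  have h1 : ∀ i, c.hd (.clk i) = c'.hd (.clk i) := fun i => by
    have := hm (.clk i)
    split_ifs at this <;> simpa [simMoves, mk, HeadMove.toInt] using this
  have h3 : Act j c.st c.scan ↔ Act j c'.st c'.scan :=
    act_congr (by rw [hs']) fun i => scan_eq ht (h1 i)
  refine ⟨hs', funext fun i => ?_⟩
  have := hm i
  rw [hs'] at h3 this
  simp only [h3] at this
  exact add_right_cancel this

lemma gGather_isom (j : ℕ) (r : Fin M.k → ZMod 3) :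
    Isom (gGather j r : Gate (Al M D) (St M D)).op := sim_moves_isom j _

lemma gScatter_isom (j : ℕ) (r : Fin M.k → ZMod 3) :
    Isom (gScatter j r : Gate (Al M D) (St M D)).op := sim_moves_isom j _

/-- Access to the scanned part of the simulated machine. -/
def simLens : Lens (PC (Al M D) (St M D)) (Loc M) where
  loc c := simLoc c.st c.scan
  put c a := c.next (simSt c.st a) (simSg c.scan a) fun _ => .N
  loc_put c a := by
    rw [PC.scan_next_N]; rfl
  put_loc c := by
    have h2 : simSg c.scan (simLoc c.st c.scan) = c.scan := by
      funext i; cases i <;> rfl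
    rw [h2]
    exact PC.next_self c
  put_put c a b := by
    rw [PC.next_next_N, PC.scan_next_N]
    rfl

lemma gRefl_op (j : ℕ) (r : Fin M.k → ZMod 3) :
    (gRefl j r : Gate (Al M D) (St M D)).op =
      simLens.op fun c => simMat j r c.st c.scan := rfl

lemma gRefl_isom (hM : M.WellFormed) (j : ℕ) (r : Fin M.k → ZMod 3) :
    Isom (gRefl j r : Gate (Al M D) (St M D)).op := by
  classical
  rw [gRefl_op]
  refine Lens.isom_op _ _ (fun c a => ?_) fun c => ?_
  · simp only [simLens, PC.scan_next_N]
    rfl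
  · unfold simMat
    split_ifs
    · exact reflMat_unitary M hM r
    · simp

/-- A tick can be undone: from the lowest wheel upwards, the new positions and directions of the
clock heads determine the old ones, and then the old phase. -/
lemma gTick_isom : Isom (gTick : Gate (Al M D) (St M D)).op := by
  classical
  refine Gate.classical_isom _ _ (fun s σ => Or.inl rfl)
    (branch_injective_of_read
      (fun s σ => ({ s with φ := tickPhase s σ, dirs := tickDirs s σ } : St M D)) _
      fun c c' ht hs hm => ?_)
  have hφ : tickPhase c.st c.scan = tickPhase c'.st c'.scan := congrArg St.φ hs
  have hd : tickDirs c.st c.scan = tickDirs c'.st c'.scan := congrArg St.dirs hs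
  have hclk : ∀ i, c.hd (.clk i) = c'.hd (.clk i) ∧ c.st.dirs i = c'.st.dirs i := by
    intro i
    induction i using WellFoundedLT.induction with
    | ind i ih =>
      have h1 := hm (.clk i)
      simp only [mk] at h1
      unfold tickClk at h1
      have h2 := congrFun hd i
      unfold tickDirs at h2
      rw [hφ] at h1 h2
      rw [hd] at h1
      by_cases hA : Adv (tickPhase c'.st c'.scan)
      · have hW : (∀ j < i, AtStart c.st c.scan j) ↔ ∀ j < i, AtStart c'.st c'.scan j := by
          refine forall₂_congr fun j hj => ?_
          unfold AtStart
          rw [(ih j hj).2, scan_eq ht (ih j hj).1]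
        simp only [hA, if_true, hW] at h1
        simp only [hA, true_and, hW] at h2
        by_cases hW' : ∀ j < i, AtStart c'.st c'.scan j
        · simp only [if_pos hW'] at h1 h2
          have h3 : c.hd (.clk i) = c'.hd (.clk i) := add_right_cancel h1
          rw [scan_eq ht h3] at h2
          exact ⟨h3, by simpa using h2⟩
        · simp only [if_neg hW'] at h1 h2
          exact ⟨add_right_cancel h1, h2⟩
      · simp only [hA, if_false, false_and] at h1 h2
        exact ⟨add_right_cancel h1, h2⟩
  have hW : ∀ i, AtStart c.st c.scan i ↔ AtStart c'.st c'.scan i := fun i => by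
    unfold AtStart
    rw [(hclk i).2, scan_eq ht (hclk i).1]
  have hφ' : c.st.φ = c'.st.φ := by
    unfold tickPhase at hφ
    simp only [hW] at hφ
    split_ifs at hφ
    · exact add_right_cancel hφ
    · exact hφ
  refine ⟨St.ext hφ' (funext fun i => (hclk i).2) ?_ ?_ ?_, funext fun i => ?_⟩
  · exact congrArg (fun s => s.q) hs
  · exact congrArg (fun s => s.b) hs
  · exact congrArg (fun s => s.l) hs
  · have h1 := hm i
    cases i with
    | clk i => exact (hclk i).1
    | _ =>
      simp only [mk, hφ] at h1
      exact add_right_cancel h1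

end isom

end SquaredFunction

/-! ### The squaring program -/

namespace SquaredFunction

open ComplexConjugate

section amplitudes

lemma sum_mem_of_add {K : Set ℂ} (h0 : (0 : ℂ) ∈ K) (hadd : ∀ a ∈ K, ∀ b ∈ K, a + b ∈ K)
    {I : Type*} (s : Finset I) (f : I → ℂ) (hf : ∀ i, f i ∈ K) : ∑ i ∈ s, f i ∈ K :=
  Finset.sum_induction f (· ∈ K) (fun a b ha hb => hadd a ha b hb) h0 fun i _ => hf i

variable {M : QTM} {D : ℕ} {K : Set ℂ} (hK : {0, 1, -1} ⊆ K) (hadm : Admissible K)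
  (hM : M.HasAmplitudes K)

include hK hadm hM in
/-- The entries of the reflections are polynomials in the amplitudes and their conjugates. -/
lemma simMat_mem (j : ℕ) (r : Fin M.k → ZMod 3) (s : St M D) (σ : Sg M D) (a b : Loc M) :
    simMat j r s σ a b ∈ K := by
  classical
  have h0 : (0 : ℂ) ∈ K := hK (by simp)
  have h1 : (1 : ℂ) ∈ K := hK (by simp)
  have hX : ∀ a z, reflVec M r a z ∈ K := fun a z => by
    unfold reflVec
    split_ifs
    · rw [← zero_sub]; exact hadm.sub _ h0 _ (hM _ _ _ _ _)
    · exact h1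
    · exact h0
  unfold simMat
  split_ifs
  · rw [reflMat, Matrix.sub_apply, Matrix.mul_apply]
    refine hadm.sub _ ?_ _ (sum_mem_of_add h0 hadm.add _ _ fun z =>
      hadm.mul _ (hX _ _) _ (hadm.conj _ (hX _ _)))
    rw [Matrix.one_apply]; split_ifs <;> assumption
  · rw [Matrix.one_apply]; split_ifs <;> assumption

include hK hadm hM in
lemma gRefl_amp_mem (j : ℕ) (r : Fin M.k → ZMod 3) (p : St M D) (σ : Sg M D) (q : St M D)
    (τ : Sg M D) (d : Tp M.k D → HeadMove) : (gRefl j r).amp p σ q τ d ∈ K := by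
  have h0 : (0 : ℂ) ∈ K := hK (by simp)
  refine sum_mem_of_add h0 hadm.add _ _ fun a => ?_
  split_ifs
  · exact simMat_mem hK hadm hM _ _ _ _ _ _
  · exact h0

end amplitudes

section program
variable {ι : Type} {Γ : ι → Type} {S : Type}

/-- The operator of a list of gates, the head of the list being applied first. -/
noncomputable def listOp : List (Gate Γ S) → (PC Γ S →₀ ℂ) →ₗ[ℂ] (PC Γ S →₀ ℂ)
  | [] => LinearMap.id
  | g :: l => listOp l ∘ₗ g.op

lemma listOp_append (l l' : List (Gate Γ S)) : listOp (l ++ l') = listOp l' ∘ₗ listOp l := by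
  induction l with
  | nil => rfl
  | cons g l ih => rw [List.cons_append, listOp, ih, listOp, LinearMap.comp_assoc]

lemma Program.run_eq_listOp {M : QTM} (P : Program M) (l : List (Gate P.Γ P.S))
    (hl : l.length = P.n + 1) (hg : ∀ i : Fin (P.n + 1), P.g i = l.get (i.cast hl.symm)) (m : ℕ)
    (hm : m ≤ l.length) : P.run m = listOp (l.take m) := by
  induction m with
  | zero => rfl
  | succ m ih =>
    have hm' : m < l.length := hm
    have hpc : P.g (P.pc m) = l[m] := by
      rw [hg]
      simp [pc, Nat.mod_eq_of_lt (hl ▸ hm')]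
    rw [run, ih hm'.le, List.take_succ_eq_append_getElem hm', listOp_append, hpc]
    rfl

lemma Program.loop_eq_listOp {M : QTM} (P : Program M) (l : List (Gate P.Γ P.S))
    (hl : l.length = P.n + 1) (hg : ∀ i : Fin (P.n + 1), P.g i = l.get (i.cast hl.symm)) :
    P.loop = listOp l := by
  rw [loop, ← hl, P.run_eq_listOp l hl hg _ le_rfl, List.take_length]

variable (M : QTM) (D : ℕ) (degs : List ℕ) (rs : List (Fin M.k → ZMod 3))

/-- The gates that apply, for a monomial of degree `j`, the operator `G` if the clock is in an
active position. -/
noncomputable def gatesG (j : ℕ) : List (Gate (Al M D) (St M D)) :=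
  rs.flatMap (fun r => [gGather j r, gRefl j r, gScatter j r]) ++ [gFlip j]

/-- The program after its first gate. -/
noncomputable def gatesTail : List (Gate (Al M D) (St M D)) :=
  gCheck :: (degs.flatMap (gatesG M D rs) ++ [gTick])

/-- The initial state of the squaring program. -/
def initSt : St M D where
  φ := 0
  dirs _ := false
  q := M.q₀
  b := false
  l _ := 0

/-- The squaring program for the machine `M`, with `D` clock tapes. In one cycle of the clock it
simulates `∑ j ∈ degs, n ^ j` steps of `M` on inputs of length `n`. -/
noncomputable def prog : Program M where
  ι := Tp M.k D
  base := base M D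
  inp := .inp
  out := .out
  base_inp := rfl
  S := St M D
  s₀ := initSt M D
  F := {s | s.φ = 17}
  F_nonempty := ⟨{ initSt M D with φ := 17 }, rfl⟩
  s₀_notMem h := by simp [initSt] at h
  n := (gatesTail M D degs rs).length
  g := (gOp :: gatesTail M D degs rs).get

lemma prog_loop : (prog M D degs rs).loop = listOp (gOp :: gatesTail M D degs rs) :=
  (prog M D degs rs).loop_eq_listOp (gOp :: gatesTail M D degs rs) rfl fun _ => rfl

variable {M D degs rs} in
lemma mem_gates {x : Gate (Al M D) (St M D)} (h : x ∈ gOp :: gatesTail M D degs rs) :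
    x = gOp ∨ x = gCheck ∨ x = gTick ∨ (∃ j r, x = gGather j r) ∨ (∃ j r, x = gRefl j r) ∨
      (∃ j r, x = gScatter j r) ∨ ∃ j, x = gFlip j := by
  simp only [gatesTail, gatesG, List.mem_cons, List.mem_append, List.mem_flatMap,
    List.not_mem_nil, or_false] at h
  rcases h with h | h | ⟨j, -, ⟨r, -, h | h | h⟩ | h⟩ | h
  · exact Or.inl h
  · exact Or.inr (Or.inl h)
  · exact Or.inr (Or.inr (Or.inr (Or.inl ⟨j, r, h⟩)))
  · exact Or.inr (Or.inr (Or.inr (Or.inr (Or.inl ⟨j, r, h⟩))))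
  · exact Or.inr (Or.inr (Or.inr (Or.inr (Or.inr (Or.inl ⟨j, r, h⟩)))))
  · exact Or.inr (Or.inr (Or.inr (Or.inr (Or.inr (Or.inr ⟨j, h⟩)))))
  · exact Or.inr (Or.inr (Or.inl h))

lemma prog_g (i : Fin ((prog M D degs rs).n + 1)) :
    (prog M D degs rs).g i = gOp ∨ (prog M D degs rs).g i = gCheck ∨
      (prog M D degs rs).g i = gTick ∨ (∃ j r, (prog M D degs rs).g i = gGather j r) ∨
      (∃ j r, (prog M D degs rs).g i = gRefl j r) ∨
      (∃ j r, (prog M D degs rs).g i = gScatter j r) ∨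
      ∃ j, (prog M D degs rs).g i = gFlip j :=
  mem_gates (M := M) (D := D) (degs := degs) (rs := rs) (List.get_mem _ _)

variable {M}

lemma prog_isom (hM : M.WellFormed) (i : Fin ((prog M D degs rs).n + 1)) :
    Isom ((prog M D degs rs).g i).op := by
  rcases prog_g M D degs rs i with h | h | h | ⟨j, r, h⟩ | ⟨j, r, h⟩ | ⟨j, r, h⟩ | ⟨j, h⟩ <;> rw [h]
  · exact gOp_isom
  · exact gCheck_isom
  · exact gTick_isom
  · exact gGather_isom j r
  · exact gRefl_isom hM j r
  · exact gScatter_isom j r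
  · exact gFlip_isom j

/-- Besides `0`, `1` and `-1`, the amplitudes are the entries of the reflection matrices. -/
lemma prog_amp_mem {K : Set ℂ} (hK : {0, 1, -1} ⊆ K) (hadm : Admissible K)
    (hM : M.HasAmplitudes K) (i : Fin ((prog M D degs rs).n + 1)) (p : St M D) (σ : Sg M D)
    (q : St M D) (τ : Sg M D) (d : Tp M.k D → HeadMove) :
    ((prog M D degs rs).g i).amp p σ q τ d ∈ K := by
  rcases prog_g M D degs rs i with h | h | h | ⟨j, r, h⟩ | ⟨j, r, h⟩ | ⟨j, r, h⟩ | ⟨j, h⟩ <;> rw [h]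
  · refine Gate.classical_amp_mem _ _ (fun s σ => ?_) hK _ _ _ _ _
    unfold opSign; split_ifs <;> simp
  · exact Gate.classical_amp_mem _ _ (fun _ _ => Or.inl rfl) hK _ _ _ _ _
  · exact Gate.classical_amp_mem _ _ (fun _ _ => Or.inl rfl) hK _ _ _ _ _
  · exact Gate.classical_amp_mem _ _ (fun _ _ => Or.inl rfl) hK _ _ _ _ _
  · exact gRefl_amp_mem hK hadm hM j r _ _ _ _ _
  · exact Gate.classical_amp_mem _ _ (fun _ _ => Or.inl rfl) hK _ _ _ _ _
  · exact Gate.classical_amp_mem _ _ (fun _ _ => Or.inl rfl) hK _ _ _ _ _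

/-! ### The classical control -/

/-- The part of a configuration that evolves deterministically: the phase, the clock, and the
input tape. -/
@[ext]
structure Ctl (M : QTM) (D : ℕ) : Type where
  φ : Fin 18
  dirs : Fin D → Bool
  clk : Fin D → ℤ
  inp : ℤ
  clkTp : Fin D → ℤ → Sym M
  inpTp : ℤ → Sym M

variable {D}

/-- The control part of a configuration. -/
def ctl (c : PC (Al M D) (St M D)) : Ctl M D where
  φ := c.st.φ
  dirs := c.st.dirs
  clk i := c.hd (.clk i)
  inp := c.hd .inp
  clkTp i := c.tp (.clk i)
  inpTp := c.tp .inp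

lemma ctl_next (c : PC (Al M D) (St M D)) (q : St M D) (τ : Sg M D) (d : Tp M.k D → HeadMove) :
    ctl (c.next q τ d) = {
      φ := q.φ
      dirs := q.dirs
      clk := fun i => (ctl c).clk i + (d (.clk i)).toInt
      inp := (ctl c).inp + (d .inp).toInt
      clkTp := fun i => Function.update ((ctl c).clkTp i) ((ctl c).clk i) (τ (.clk i))
      inpTp := Function.update (ctl c).inpTp (ctl c).inp (τ .inp) } := rfl

lemma ctl_next_of_eq (c : PC (Al M D) (St M D)) (q : St M D) (τ : Sg M D)
    (d : Tp M.k D → HeadMove) (h1 : q.φ = c.st.φ) (h2 : q.dirs = c.st.dirs)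
    (h3 : ∀ i, τ (.clk i) = c.scan (.clk i)) (h4 : τ .inp = c.scan .inp)
    (h5 : ∀ i, d (.clk i) = .N) (h6 : d .inp = .N) : ctl (c.next q τ d) = ctl c := by
  rw [ctl_next]
  refine Ctl.ext h1 h2 (funext fun i => ?_) ?_ (funext fun i => ?_) ?_
  · simp only [h5]; exact add_zero _
  · rw [h6]; exact add_zero _
  · show Function.update (c.tp (.clk i)) (c.hd (.clk i)) (τ (.clk i)) = c.tp (.clk i)
    rw [h3]; exact Function.update_eq_self _ _
  · show Function.update (c.tp .inp) (c.hd .inp) (τ .inp) = c.tp .inp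
    rw [h4]; exact Function.update_eq_self _ _

lemma ctl_scan {c c' : PC (Al M D) (St M D)} (h : ctl c = ctl c') :
    c.st.φ = c'.st.φ ∧ c.st.dirs = c'.st.dirs ∧ (∀ i, c.scan (.clk i) = c'.scan (.clk i)) ∧
      c.scan .inp = c'.scan .inp := by
  refine ⟨congrArg Ctl.φ h, congrArg Ctl.dirs h, fun i => ?_, ?_⟩
  · exact congrArg (fun k : Ctl M D => k.clkTp i (k.clk i)) h
  · exact congrArg (fun k : Ctl M D => k.inpTp k.inp) h

lemma opState_φ (s : St M D) : (opState s).φ = s.φ := by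
  unfold opState; split_ifs <;> rfl

lemma opState_dirs (s : St M D) : (opState s).dirs = s.dirs := by
  unfold opState; split_ifs <;> rfl

lemma ctl_gOp {c c' : PC (Al M D) (St M D)} (h : ctl c = ctl c') :
    ctl (c.next (opState c.st) (opWrite c.st c.scan) fun _ => .N) =
      ctl (c'.next (opState c'.st) (opWrite c'.st c'.scan) fun _ => .N) := by
  obtain ⟨h1, -, h3, h4⟩ := ctl_scan h
  have h5 : ∀ i, opWrite c.st c.scan (.clk i) = opWrite c'.st c'.scan (.clk i) := fun i => by
    unfold opWrite
    rw [h1]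
    split_ifs
    · exact h3 i
    · exact congrArg₂ (fun a b : Sym M => sw (blk M) a b) h4 (h3 i)
    · exact h3 i
    · exact h3 i
  have h6 : opWrite c.st c.scan .inp = opWrite c'.st c'.scan .inp := by
    unfold opWrite
    rw [h1]
    split_ifs <;> exact h4
  rw [ctl_next, ctl_next]
  simp only [opState_φ, opState_dirs, h, h5, h6]
  rw [show c.st.φ = c'.st.φ from h1, show c.st.dirs = c'.st.dirs from congrArg Ctl.dirs h]

/-- A tick depends on the phase and on the clock only. -/
lemma tick_congr {s s' : St M D} {σ σ' : Sg M D} (h1 : s.φ = s'.φ) (h2 : s.dirs = s'.dirs)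
    (h3 : ∀ i, σ (.clk i) = σ' (.clk i)) : tickPhase s σ = tickPhase s' σ' ∧
      tickDirs s σ = tickDirs s' σ' ∧ tickClk s σ = tickClk s' σ' := by
  classical
  have e0 : ∀ i, AtStart s σ i ↔ AtStart s' σ' i := fun i => by
    unfold AtStart; rw [h2, h3]
  have e1 : tickPhase s σ = tickPhase s' σ' := by
    unfold tickPhase; rw [h1]; exact if_congr (forall_congr' e0) rfl rfl
  have e2 : tickDirs s σ = tickDirs s' σ' := by
    funext i; unfold tickDirs; rw [e1, h2, h3]
    exact if_congr (and_congr_right' (forall₂_congr fun j _ => e0 j)) rfl rfl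
  refine ⟨e1, e2, ?_⟩
  funext i; unfold tickClk; rw [e1, e2]
  exact if_congr Iff.rfl (if_congr (forall₂_congr fun j _ => e0 j) rfl rfl) rfl

lemma ctl_gTick {c c' : PC (Al M D) (St M D)} (h : ctl c = ctl c') :
    ctl ((gTick : Gate (Al M D) (St M D)).branch c ()) =
      ctl ((gTick : Gate (Al M D) (St M D)).branch c' ()) := by
  obtain ⟨h1, h2, h3, h4⟩ := ctl_scan h
  obtain ⟨e1, e2, e3⟩ := tick_congr h1 h2 h3
  show ctl (c.next _ _ _) = ctl (c'.next _ _ _)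
  rw [ctl_next, ctl_next, h]
  refine Ctl.ext e1 e2 (funext fun i => ?_) ?_ (funext fun i => ?_) ?_
  · show _ + (tickClk c.st c.scan i).toInt = _ + (tickClk c'.st c'.scan i).toInt
    rw [e3]
  · show _ + (mvIn (tickPhase c.st c.scan)).toInt = _ + (mvIn (tickPhase c'.st c'.scan)).toInt
    rw [e1]
  · exact congrArg (Function.update _ _) (h3 i)
  · exact congrArg (Function.update _ _) h4

variable (D)

/-- The control part evolves deterministically under each gate. -/
lemma prog_ctl (i : Fin ((prog M D degs rs).n + 1)) (c d c' d' : PC (Al M D) (St M D))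
    (h : ctl c = ctl d) (hc : ((prog M D degs rs).g i).op (Finsupp.single c 1) c' ≠ 0)
    (hd : ((prog M D degs rs).g i).op (Finsupp.single d 1) d' ≠ 0) : ctl c' = ctl d' := by
  obtain ⟨a, rfl⟩ := Gate.exists_branch _ hc
  obtain ⟨b, rfl⟩ := Gate.exists_branch _ hd
  clear hc hd
  revert a b
  rcases prog_g M D degs rs i with hg | hg | hg | ⟨j, r, hg⟩ | ⟨j, r, hg⟩ | ⟨j, r, hg⟩ | ⟨j, hg⟩ <;>
    rw [hg] <;> intro a b
  · exact ctl_gOp h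
  · refine (ctl_next_of_eq _ _ _ _ rfl rfl (fun _ => rfl) rfl (fun _ => ?_) ?_).trans
      (h.trans (ctl_next_of_eq _ _ _ _ rfl rfl (fun _ => rfl) rfl (fun _ => ?_) ?_).symm) <;>
    · dsimp only [gCheck, Gate.classical]
      rw [if_neg (by simp)]
  · exact ctl_gTick h
  · refine (ctl_next_of_eq _ _ _ _ rfl rfl (fun _ => rfl) rfl (fun _ => ?_) ?_).trans
      (h.trans (ctl_next_of_eq _ _ _ _ rfl rfl (fun _ => rfl) rfl (fun _ => ?_) ?_).symm) <;>
    dsimp only [gGather, Gate.classical] <;> split_ifs <;> rfl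
  · exact (ctl_next_of_eq _ _ _ _ rfl rfl (fun _ => rfl) rfl (fun _ => rfl) rfl).trans
      (h.trans (ctl_next_of_eq _ _ _ _ rfl rfl (fun _ => rfl) rfl (fun _ => rfl) rfl).symm)
  · refine (ctl_next_of_eq _ _ _ _ rfl rfl (fun _ => rfl) rfl (fun _ => ?_) ?_).trans
      (h.trans (ctl_next_of_eq _ _ _ _ rfl rfl (fun _ => rfl) rfl (fun _ => ?_) ?_).symm) <;>
    dsimp only [gScatter, Gate.classical] <;> split_ifs <;> rfl
  · refine (ctl_next_of_eq _ _ _ _ ?_ ?_ (fun _ => rfl) rfl (fun _ => rfl) rfl).trans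
      (h.trans (ctl_next_of_eq _ _ _ _ ?_ ?_ (fun _ => rfl) rfl (fun _ => rfl) rfl).symm) <;>
    dsimp only [gFlip, Gate.classical] <;> split_ifs <;> rfl

end program

end SquaredFunction

/-! ### The clock -/

namespace SquaredFunction

open ComplexConjugate

section ring

/-- The direction of a clock head (`true` for right) in state `v` of its round trip over the input
of length `n`, which starts in cell `-1`, turns in cell `n`, and returns. -/
def ringDir (n : ℕ) (v : Fin (2 * n + 2)) : Bool := decide (1 ≤ v.1 ∧ v.1 ≤ n + 1)

/-- The position of a clock head in state `v` of its round trip. -/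
def ringPos (n : ℕ) (v : Fin (2 * n + 2)) : ℤ :=
  if v.1 ≤ n + 1 then (v.1 : ℤ) - 1 else 2 * n + 1 - v.1

variable {n : ℕ} (v : Fin (2 * n + 2))

/-- The initial state of a round trip can be recognized: it is the only one in which the head scans
a blank and has direction left. -/
lemma ring_eq_zero_iff :
    ringDir n v = false ∧ (ringPos n v < 0 ∨ n ≤ ringPos n v) ↔ v = 0 := by
  have := v.2
  rw [Fin.ext_iff, Fin.val_zero, ringDir, ringPos, decide_eq_false_iff_not]
  split_ifs <;> omega

/-- In the states from `1` to `n` of a round trip, and only there, the head scans the input on its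
way to the right. -/
lemma ring_active_iff :
    ringDir n v = true ∧ ¬ (ringPos n v < 0 ∨ n ≤ ringPos n v) ↔ 1 ≤ v.1 ∧ v.1 ≤ n := by
  have := v.2
  rw [ringDir, ringPos, decide_eq_true_iff]
  split_ifs <;> omega

lemma val_succ_cases : (v.1 = 2 * n + 1 ∧ (v + 1).1 = 0) ∨ (v + 1).1 = v.1 + 1 := by
  have := v.2
  rw [Fin.val_add, show (1 : Fin (2 * n + 2)).1 = 1 from rfl]
  by_cases h : v.1 = 2 * n + 1
  · left; rw [h]; exact ⟨rfl, Nat.mod_self _⟩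
  · right; exact Nat.mod_eq_of_lt (by omega)

lemma ringDir_succ :
    ringDir n (v + 1) = xor (ringDir n v) (decide (ringPos n v < 0 ∨ n ≤ ringPos n v)) := by
  have := v.2
  have key : (1 ≤ (v + 1).1 ∧ (v + 1).1 ≤ n + 1) ↔
      ¬ ((1 ≤ v.1 ∧ v.1 ≤ n + 1) ↔ (ringPos n v < 0 ∨ n ≤ ringPos n v)) := by
    rcases val_succ_cases v with h | h <;> rw [ringPos] <;> split_ifs <;> omega
  by_cases h1 : 1 ≤ v.1 ∧ v.1 ≤ n + 1 <;>
    by_cases h2 : ringPos n v < 0 ∨ n ≤ ringPos n v <;>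
    simp [ringDir, key, h1, h2]

lemma ringPos_succ :
    ringPos n (v + 1) = ringPos n v + (if ringDir n (v + 1) then HeadMove.R else .L).toInt := by
  have := v.2
  unfold ringDir
  simp only [decide_eq_true_eq]
  rcases val_succ_cases v with h | h <;> rw [ringPos, ringPos] <;> split_ifs <;>
    simp only [HeadMove.toInt] <;> omega

end ring

section odometer
variable {N : ℕ} [NeZero N]

/-- One step of the odometer: a wheel advances if all lower wheels are at `0`. -/
def odo {D : ℕ} (v : Fin D → Fin N) (i : Fin D) : Fin N := if ∀ j < i, v j = 0 then v i + 1 else v i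

lemma odo_cons {D : ℕ} (a : Fin N) (v : Fin D → Fin N) :
    odo (Fin.cons a v : Fin (D + 1) → Fin N) = Fin.cons (a + 1) (if a = 0 then odo v else v) := by
  funext i
  refine Fin.cases ?_ (fun i => ?_) i
  · simp [odo]
  · by_cases ha : a = 0
    · subst ha
      simp [odo, Fin.forall_fin_succ]
    · simp [odo, Fin.forall_fin_succ, ha]

lemma odo_block {D : ℕ} (v : Fin D → Fin N) {t : ℕ} (ht : t < N) :
    odo^[t + 1] (Fin.cons 0 v : Fin (D + 1) → Fin N) = Fin.cons (Fin.ofNat N (t + 1)) (odo v) := by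
  induction t with
  | zero =>
    rw [Function.iterate_one, odo_cons, if_pos rfl, zero_add]
    rfl
  | succ t ih =>
    have hne : Fin.ofNat N (t + 1) ≠ 0 := fun h => by
      have := congrArg Fin.val h
      rw [Fin.val_ofNat, Nat.mod_eq_of_lt ht, Fin.val_zero] at this
      omega
    rw [Function.iterate_succ_apply', ih (by omega), odo_cons, if_neg hne]
    congr 1
    refine Fin.ext ?_
    rw [Fin.val_add, Fin.val_ofNat, Fin.val_ofNat, Fin.val_one', ← Nat.add_mod]

lemma odo_block_end {D : ℕ} (v : Fin D → Fin N) :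
    odo^[N] (Fin.cons 0 v : Fin (D + 1) → Fin N) = Fin.cons 0 (odo v) := by
  have hN := NeZero.pos N
  have h := odo_block v (t := N - 1) (by omega)
  rw [Nat.sub_add_cancel hN] at h
  rw [h]
  congr 1
  exact Fin.ext (by simp)

lemma odo_blocks {D : ℕ} (v : Fin D → Fin N) (q : ℕ) :
    odo^[N * q] (Fin.cons 0 v : Fin (D + 1) → Fin N) = Fin.cons 0 (odo^[q] v) := by
  induction q with
  | zero => rfl
  | succ q ih =>
    rw [mul_add, mul_one, add_comm (N * q), Function.iterate_add_apply, ih, odo_block_end,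
      Function.iterate_succ_apply']

lemma sum_odo_block {D : ℕ} (v : Fin D → Fin N) (f : (Fin (D + 1) → Fin N) → ℕ) :
    ∑ t ∈ Finset.range N, f (odo^[t] (Fin.cons 0 v)) + f (Fin.cons 0 (odo v)) =
      f (Fin.cons 0 v) + ∑ a, f (Fin.cons a (odo v)) := by
  have hN := NeZero.pos N
  obtain ⟨m, rfl⟩ : ∃ m, N = m + 1 := ⟨N - 1, by omega⟩
  have h : ∑ t ∈ Finset.range m, f (odo^[t + 1] (Fin.cons 0 v)) =
      ∑ i : Fin m, f (Fin.cons i.succ (odo v)) := by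
    rw [Finset.sum_range]
    refine Finset.sum_congr rfl fun i _ => ?_
    rw [odo_block v (by omega)]
    congr 2
    exact Fin.ext (by rw [Fin.val_ofNat, Fin.val_succ, Nat.mod_eq_of_lt (by omega)])
  rw [Finset.sum_range_succ', Fin.sum_univ_succ, h]
  simp only [Function.iterate_zero, id]
  ring

/-- The odometer runs through all states in one cycle. -/
lemma odo_cycle (N : ℕ) [NeZero N] (D : ℕ) : odo^[N ^ D] (0 : Fin D → Fin N) = 0 ∧
    ∀ f : (Fin D → Fin N) → ℕ, ∑ t ∈ Finset.range (N ^ D), f (odo^[t] 0) = ∑ v, f v := by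
  induction D with
  | zero => exact ⟨Subsingleton.elim _ _, fun f => by
      rw [pow_zero, Finset.sum_range_one, Fintype.sum_unique]
      exact congrArg f (Subsingleton.elim _ _)⟩
  | succ D ih =>
    obtain ⟨ih1, ih2⟩ := ih
    have h0 : (0 : Fin (D + 1) → Fin N) = Fin.cons 0 0 := by
      funext i; refine Fin.cases rfl (fun i => rfl) i
    constructor
    · rw [h0, pow_succ', odo_blocks, ih1]
    · intro f
      have h1 : ∀ Q, ∑ t ∈ Finset.range (N * Q), f (odo^[t] (Fin.cons 0 (0 : Fin D → Fin N))) =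
          ∑ q ∈ Finset.range Q, ∑ t ∈ Finset.range N, f (odo^[t] (Fin.cons 0 (odo^[q] 0))) := by
        intro Q
        induction Q with
        | zero => simp
        | succ Q ihQ =>
          rw [mul_add, mul_one, Finset.sum_range_add, ihQ, Finset.sum_range_succ]
          congr 1
          refine Finset.sum_congr rfl fun t _ => ?_
          rw [add_comm (N * Q), Function.iterate_add_apply, odo_blocks]
      have h2 : ∀ g : (Fin D → Fin N) → ℕ,
          ∑ q ∈ Finset.range (N ^ D), g (odo (odo^[q] 0)) = ∑ v, g v := by
        intro g
        rw [← ih2 g]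
        have e1 := Finset.sum_range_succ (fun q => g (odo^[q] 0)) (N ^ D)
        rw [Finset.sum_range_succ', ih1] at e1
        simp only [Function.iterate_succ_apply'] at e1
        exact Nat.add_right_cancel e1
      have h3 := Finset.sum_congr (rfl : Finset.range (N ^ D) = _)
        fun q _ => sum_odo_block (odo^[q] (0 : Fin D → Fin N)) f
      rw [Finset.sum_add_distrib, Finset.sum_add_distrib, h2 fun v => f (Fin.cons 0 v),
        ih2 fun v => f (Fin.cons 0 v), h2 fun v => ∑ a, f (Fin.cons a v), add_comm] at h3
      rw [h0, pow_succ', h1, Nat.add_left_cancel h3, Finset.sum_comm]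
      rw [← (Fin.consEquiv fun _ => Fin N).sum_comp, Fintype.sum_prod_type]
      rfl

/-- The odometer does not return to its initial state before the end of the cycle. -/
lemma odo_ne_zero {D t : ℕ} (h0 : 0 < t) (ht : t < N ^ D) :
    odo^[t] (0 : Fin D → Fin N) ≠ 0 := by
  intro h
  have h1 := (odo_cycle N D).2 fun v => if v = 0 then 1 else 0
  rw [Finset.sum_ite_eq' Finset.univ, if_pos (Finset.mem_univ _)] at h1
  have h2 := Finset.sum_le_sum_of_subset (f := fun t => if odo^[t] (0 : Fin D → Fin N) = 0 then 1
    else 0) (show {0, t} ⊆ Finset.range (N ^ D) by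
      intro s hs
      rcases Finset.mem_insert.1 hs with rfl | hs
      · exact Finset.mem_range.2 (by omega)
      · rw [Finset.mem_singleton.1 hs]; exact Finset.mem_range.2 ht)
  rw [Finset.sum_pair (by omega)] at h2
  simp only [h, if_true, Function.iterate_zero, id] at h2
  omega

/-- The sum over a cycle may be taken from time `1` to time `N ^ D`. -/
lemma sum_odo_succ (N : ℕ) [NeZero N] (D : ℕ) (f : (Fin D → Fin N) → ℕ) :
    ∑ t ∈ Finset.range (N ^ D), f (odo^[t + 1] 0) = ∑ v, f v := by
  obtain ⟨h1, h2⟩ := odo_cycle N D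
  rw [← h2 f]
  have e1 := Finset.sum_range_succ (fun q => f (odo^[q] 0)) (N ^ D)
  rw [Finset.sum_range_succ', h1] at e1
  exact Nat.add_right_cancel e1

end odometer

/-- The states of the clock in which one step of a monomial of degree `j` is executed. -/
def clkAct {n D : ℕ} (j : ℕ) (v : Fin D → Fin (2 * n + 2)) : Prop :=
  ∀ i : Fin D, if i.1 < j then 1 ≤ (v i).1 ∧ (v i).1 ≤ n else v i = 0

open Classical in
/-- In each of the first `j` wheels `n` states are active, and the other wheels are at rest. -/
lemma card_clkAct (n : ℕ) {D j : ℕ} (hj : j ≤ D) :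
    (∑ v : Fin D → Fin (2 * n + 2), if clkAct j v then 1 else 0) = n ^ j := by
  rw [← Finset.card_filter]
  have : (Finset.univ.filter fun v : Fin D → Fin (2 * n + 2) => clkAct j v) =
      Fintype.piFinset fun i : Fin D => Finset.univ.filter fun a : Fin (2 * n + 2) =>
        if i.1 < j then 1 ≤ a.1 ∧ a.1 ≤ n else a = 0 := by
    ext v
    rw [Finset.mem_filter, Fintype.mem_piFinset]
    refine (and_iff_right (Finset.mem_univ _)).trans (forall_congr' fun i => ?_)
    rw [Finset.mem_filter]
    exact (and_iff_right (Finset.mem_univ _)).symm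
  rw [this, Fintype.card_piFinset]
  have h1 : ∀ i : Fin D, (Finset.univ.filter fun a : Fin (2 * n + 2) =>
      if i.1 < j then 1 ≤ a.1 ∧ a.1 ≤ n else a = 0).card = if i.1 < j then n else 1 := fun i => by
    split_ifs
    · have : (Finset.univ.filter fun a : Fin (2 * n + 2) => 1 ≤ a.1 ∧ a.1 ≤ n) =
          (Finset.Icc 1 n).attachFin fun a ha => by have := (Finset.mem_Icc.1 ha).2; omega := by
        ext a; simp [Finset.mem_attachFin]
      rw [this, Finset.card_attachFin, Nat.card_Icc, Nat.add_sub_cancel]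
    · rw [Finset.card_eq_one]
      exact ⟨0, Finset.ext fun a => by
        rw [Finset.mem_filter, Finset.mem_singleton]; exact and_iff_right (Finset.mem_univ _)⟩
  rw [Finset.prod_congr rfl fun i _ => h1 i, Finset.prod_ite, Finset.prod_const_one, mul_one,
    Finset.prod_const, Fin.card_filter_val_lt, min_eq_right hj]

/-- Polynomials with natural coefficients are sums of lists of powers. -/
lemma exists_degs (p : Polynomial ℕ) :
    ∃ l : List ℕ, ∀ n, (l.map fun j => n ^ j).sum = p.eval n := by
  induction p using Polynomial.induction_on' with
  | add p q hp hq =>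
    obtain ⟨l, hl⟩ := hp
    obtain ⟨l', hl'⟩ := hq
    exact ⟨l ++ l', fun n => by simp [hl, hl']⟩
  | monomial d a => exact ⟨List.replicate a d, fun n => by simp⟩

end SquaredFunction

/-! ### The simulation -/

namespace SquaredFunction

open ComplexConjugate

/-- An operator that acts on encoded basis states as `A` does on the data acts so on
superpositions. -/
lemma map_mapDomain_of_single {X Y Z W : Type*} (L : (Y →₀ ℂ) →ₗ[ℂ] (W →₀ ℂ)) (e : X → Y)
    (e' : Z → W) (A : (X →₀ ℂ) →ₗ[ℂ] (Z →₀ ℂ))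
    (h : ∀ y, L (Finsupp.single (e y) 1) = Finsupp.mapDomain e' (A (Finsupp.single y 1)))
    (Φ : X →₀ ℂ) : L (Finsupp.mapDomain e Φ) = Finsupp.mapDomain e' (A Φ) := by
  induction Φ using Finsupp.induction_linear with
  | zero => simp
  | add a b ha hb => simp only [Finsupp.mapDomain_add, map_add, ha, hb]
  | single c a =>
    rw [Finsupp.mapDomain_single, ← Finsupp.smul_single_one, ← Finsupp.smul_single_one c, map_smul,
      map_smul, Finsupp.mapDomain_smul, h]

section emb
variable {M : QTM} {D : ℕ}

variable (M) in
/-- The tape that holds the input `x`. -/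
def strTp (x : List Bool) (z : ℤ) : Sym M := ⟨M.stringCell x z, Program.stringCell_mem M x z⟩

lemma strTp_eq_blk {x : List Bool} {z : ℤ} : strTp M x z = blk M ↔ z < 0 ∨ x.length ≤ z := by
  rw [Subtype.ext_iff]
  show M.stringCell x z = M.blank ↔ _
  unfold QTM.stringCell
  by_cases hz : 0 ≤ z
  · rw [if_pos hz]
    by_cases hl : z.toNat < x.length
    · rw [List.getElem?_eq_getElem hl]
      exact iff_of_false (M.bit_ne_blank _) (by omega)
    · rw [List.getElem?_eq_none (by omega)]
      exact iff_of_true rfl (by omega)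
  · rw [if_neg hz]
    exact iff_of_true rfl (by omega)

variable (M) in
/-- The tape with a mark in the start cell. -/
def markTp (z : ℤ) : Sym M := if z = 0 then one M else blk M

lemma markTp_eq_one {z : ℤ} : markTp M z = one M ↔ z = 0 := by
  unfold markTp
  split_ifs with h
  · simp [h]
  · simp [h, (one_ne_blk M).symm]

/-- The configuration of the squaring program on input `x` in phase `φ` that holds the data `y`, the
clock being in state `v`, the simulated heads being displaced by `o`, and the output head scanning
cell `h` of the output tape `w`. -/
def emb (x : List Bool) (φ : Fin 18) (v : Fin D → Fin (2 * x.length + 2)) (o h : ℤ) (w : ℤ → Sym M)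
    (y : Bool × M.Conf) : PC (Al M D) (St M D) where
  st :=
    { φ := φ
      dirs := fun i => ringDir _ (v i)
      q := y.2.state
      b := y.1
      l := fun i => (y.2.head i : ZMod 3) }
  hd := mk (fun i => y.2.head i + o) (fun i => y.2.head i + o) (fun i => ringPos _ (v i)) o h
  tp := mk y.2.tape (fun _ => markTp M) (fun _ => strTp M x) (strTp M x) w

variable {x : List Bool} {φ : Fin 18} {v : Fin D → Fin (2 * x.length + 2)} {o h : ℤ}
  {w : ℤ → Sym M} {y : Bool × M.Conf}

lemma eq_of_emb_eq {h' : ℤ} {w' : ℤ → Sym M} {y' : Bool × M.Conf}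
    (he : emb x φ v o h w y = emb x φ v o h' w' y') : y = y' := by
  refine Prod.ext (congrArg (fun c => c.st.b) he) (QTM.Conf.ext (congrArg (fun c => c.st.q) he)
    (funext fun i => ?_) (funext fun i => congrArg (fun c => c.tp (.m i)) he))
  exact add_right_cancel (congrArg (fun c => c.hd (.m i)) he : y.2.head i + o = y'.2.head i + o)

lemma emb_scan_clk_eq_blk (i : Fin D) : (emb x φ v o h w y).scan (.clk i) = blk M ↔
    (ringPos _ (v i) < 0 ∨ x.length ≤ ringPos _ (v i)) := strTp_eq_blk

lemma emb_atStart (i : Fin D) :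
    AtStart (emb x φ v o h w y).st (emb x φ v o h w y).scan i ↔ v i = 0 := by
  rw [AtStart, emb_scan_clk_eq_blk]
  exact ring_eq_zero_iff (v i)

lemma emb_act (j : ℕ) :
    Act j (emb x φ v o h w y).st (emb x φ v o h w y).scan ↔ clkAct j v := by
  unfold Act clkAct
  refine forall_congr' fun i => ?_
  split_ifs
  · exact (and_congr_right' (not_congr (emb_scan_clk_eq_blk i))).trans (ring_active_iff (v i))
  · exact emb_atStart i

end emb

section simulation
variable {M : QTM} {D : ℕ}

lemma classical_op_self (f : St M D → Sg M D → St M D × Sg M D × (Tp M.k D → HeadMove))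
    (c : PC (Al M D) (St M D)) (h : f c.st c.scan = (c.st, c.scan, fun _ => .N)) :
    (Gate.classical f fun _ _ => 1).op (Finsupp.single c 1) = Finsupp.single c 1 := by
  rw [Gate.classical_op]
  show Finsupp.single (c.next (f c.st c.scan).1 (f c.st c.scan).2.1 (f c.st c.scan).2.2) 1 = _
  rw [h, PC.next_self]

lemma lens_op_one {Z Λ : Type*} [Fintype Λ] [DecidableEq Λ] (ℓ : Lens Z Λ) (A : Z → Matrix Λ Λ ℂ)
    (z : Z) (h : A z = 1) : ℓ.op A (Finsupp.single z 1) = Finsupp.single z 1 := by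
  rw [Lens.op_single, h, Finset.sum_eq_single (ℓ.loc z)]
  · rw [Matrix.one_apply_eq, Lens.put_loc]
  · intro a _ ha
    rw [Matrix.one_apply_ne ha, Finsupp.single_zero]
  · simp

/-- The gates of a step do nothing if the clock is not active. -/
lemma gatesG_inactive (rs : List (Fin M.k → ZMod 3)) (j : ℕ) (c : PC (Al M D) (St M D))
    (h : ¬ (Comp c.st.φ ∧ Act j c.st c.scan)) :
    listOp (gatesG M D rs j) (Finsupp.single c 1) = Finsupp.single c 1 := by
  classical
  rw [gatesG, listOp_append, LinearMap.comp_apply]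
  have h1 : listOp (rs.flatMap fun r => [gGather j r, gRefl j r, gScatter j r])
      (Finsupp.single c 1) = Finsupp.single c 1 := by
    induction rs with
    | nil => rfl
    | cons r rs ih =>
      rw [List.flatMap_cons, listOp_append, LinearMap.comp_apply]
      have e1 : (gGather j r).op (Finsupp.single c 1) = Finsupp.single c 1 :=
        classical_op_self _ _ (by rw [if_neg h])
      have e2 : (gRefl j r).op (Finsupp.single c 1) = Finsupp.single c 1 :=
        lens_op_one simLens _ _ (if_neg h)
      have e3 : (gScatter j r).op (Finsupp.single c 1) = Finsupp.single c 1 :=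
        classical_op_self _ _ (by rw [if_neg h])
      simp only [listOp, LinearMap.comp_apply, e1, e2, e3, LinearMap.id_apply, ih]
  rw [h1]
  exact classical_op_self _ _ (by rw [if_neg h])

variable {x : List Bool} {φ : Fin 18} {v : Fin D → Fin (2 * x.length + 2)} {h : ℤ}
  {w : ℤ → Sym M}

/-- Gathering the heads, reflecting locally and scattering the heads amounts to `J r`. -/
lemma gates_J (hφ : Comp φ) {j : ℕ} (hv : clkAct j v) (r : Fin M.k → ZMod 3)
    (y : Bool × M.Conf) :
    listOp [gGather j r, gRefl j r, gScatter j r] (Finsupp.single (emb x φ v 0 h w y) 1) =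
      Finsupp.mapDomain (emb x φ v 0 h w) (J M r (Finsupp.single y 1)) := by
  classical
  set c := emb x φ v 0 h w y with hc
  have hact : Comp c.st.φ ∧ Act j c.st c.scan := ⟨hφ, (emb_act j).2 hv⟩
  set c' := (gGather j r).branch c () with hc'
  have hc'1 : c' = c.next c.st c.scan (simMoves fun i => negMove (dir (c.st.l i - r i))) := by
    exact congrArg (c.next c.st c.scan) (if_pos hact)
  have hclk : ∀ i, c'.scan (.clk i) = c.scan (.clk i) := fun i => by
    refine scan_eq ?_ ?_
    · rw [hc'1, PC.next_scan_tp]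
    · rw [hc'1]; exact add_zero _
  have hst : c'.st = c.st := rfl
  have hact' : Comp c'.st.φ ∧ Act j c'.st c'.scan :=
    ⟨hφ, (act_congr rfl hclk).2 hact.2⟩
  have hhd : ∀ i, c'.hd (.m i) = center (r i) (y.2.head i) := fun i => by
    rw [hc'1]
    show y.2.head i + 0 + (negMove (dir ((y.2.head i : ZMod 3) - r i))).toInt = _
    rw [negMove_toInt, center]; ring
  have hhd2 : ∀ i, c'.hd (.mark i) = center (r i) (y.2.head i) := fun i =>
    (show c'.hd (.mark i) = c'.hd (.m i) by rw [hc'1]; rfl).trans (hhd i)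
  have hloc : simLoc c'.st c'.scan = (dataLens M r).loc y := by
    refine Prod.ext rfl (Prod.ext rfl (Prod.ext rfl (funext fun i => ?_)))
    show c'.tp (.m i) (c'.hd (.m i)) = y.2.tape i (center (r i) (y.2.head i))
    rw [hhd, hc'1, PC.next_scan_tp]; rfl
  have hput : ∀ a, (gScatter j r).branch (simLens.put c' a) () =
      emb x φ v 0 h w ((dataLens M r).put y a) := by
    intro a
    set d := simLens.put c' a with hd
    have hdhd : d.hd = c'.hd := funext fun i => add_zero _
    have hdtp : d.tp = fun i => Function.update (c'.tp i) (c'.hd i) (simSg c'.scan a i) := rfl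
    have hdclk : ∀ i, d.scan (.clk i) = c'.scan (.clk i) := fun i => by
      rw [hd]; exact congrFun (PC.scan_next_N c' _ _) (.clk i)
    have hact2 : Comp d.st.φ ∧ Act j d.st d.scan := ⟨hφ, (act_congr rfl hdclk).2 hact'.2⟩
    have hb : (gScatter j r).branch d () =
        d.next d.st d.scan (simMoves fun i => dir (d.st.l i - r i)) := by
      exact congrArg (d.next d.st d.scan) (if_pos hact2)
    rw [hb]
    refine PC.ext ?_ (funext fun i => ?_) ?_
    · refine St.ext rfl rfl rfl rfl (funext fun i => ?_)
      show a.2.2.1 i = ((center (r i) (y.2.head i) + (dir (a.2.2.1 i - r i)).toInt : ℤ) : ZMod 3)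
      rw [Int.cast_add, center_cast, dir_cast]; ring
    · show d.hd i + _ = _
      rw [hdhd]
      cases i with
      | m i =>
        rw [hhd]
        show _ = center (r i) (y.2.head i) + (dir (a.2.2.1 i - r i)).toInt + 0
        rw [add_zero]; rfl
      | mark i =>
        rw [hhd2]
        show _ = center (r i) (y.2.head i) + (dir (a.2.2.1 i - r i)).toInt + 0
        rw [add_zero]; rfl
      | clk i => rw [hc'1]; exact (add_zero _).trans (add_zero _)
      | inp => rw [hc'1]; exact (add_zero _).trans (add_zero _)
      | out => rw [hc'1]; exact (add_zero _).trans (add_zero _)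
    · rw [PC.next_scan_tp, hdtp]
      have htp : c'.tp = c.tp := by rw [hc'1, PC.next_scan_tp]
      funext i
      cases i with
      | m i =>
        rw [hhd, htp]; rfl
      | _ => exact (Function.update_eq_self _ _).trans (congrFun htp _)
  have hg : (gGather j r).op (Finsupp.single c 1) = Finsupp.single c' 1 :=
    Gate.classical_op _ _ _
  have hs : ∀ d, (gScatter j r).op (Finsupp.single d 1) =
      Finsupp.single ((gScatter j r : Gate (Al M D) (St M D)).branch d ()) 1 := fun d =>
    Gate.classical_op _ _ _
  simp only [listOp, LinearMap.comp_apply, LinearMap.id_apply]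
  rw [hg, gRefl_op, Lens.op_single, J, Lens.op_single, map_sum, Finsupp.mapDomain_finsetSum]
  refine Finset.sum_congr rfl fun a _ => ?_
  have hm : simMat j r c'.st c'.scan = reflMat M r := if_pos hact'
  rw [← Finsupp.smul_single_one, map_smul, hs, hput, Finsupp.mapDomain_single, hm,
    Finsupp.smul_single_one]
  congr 2

/-- The gates of a step apply `G` if the clock is active. -/
lemma gatesG_active (hφ : Comp φ) {j : ℕ} (hv : clkAct j v) (rs : List (Fin M.k → ZMod 3))
    (Φ : Bool × M.Conf →₀ ℂ) :
    listOp (gatesG M D rs j) (Finsupp.mapDomain (emb x φ v 0 h w) Φ) =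
      Finsupp.mapDomain (emb x φ v 0 h w) (G M rs Φ) := by
  classical
  rw [gatesG, listOp_append, LinearMap.comp_apply, G, LinearMap.comp_apply]
  have h1 : ∀ Φ, listOp (rs.flatMap fun r => [gGather j r, gRefl j r, gScatter j r])
      (Finsupp.mapDomain (emb x φ v 0 h w) Φ) =
      Finsupp.mapDomain (emb x φ v 0 h w) (Jlist M rs Φ) := by
    induction rs with
    | nil => exact fun _ => rfl
    | cons r rs ih =>
      intro Φ
      rw [List.flatMap_cons, listOp_append, LinearMap.comp_apply,
        map_mapDomain_of_single _ _ _ _ (gates_J hφ hv r), ih]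
      rfl
  rw [h1]
  refine map_mapDomain_of_single _ _ _ _ (fun y => ?_) _
  show (gFlip j).op _ = _
  rw [gFlip, Gate.classical_op, flip, Finsupp.lmapDomain_apply, Finsupp.mapDomain_single,
    Finsupp.mapDomain_single]
  congr 1
  set c := emb x φ v 0 h w y
  refine PC.ext ((if_pos ⟨hφ, (emb_act j).2 hv⟩).trans ?_) (funext fun i => add_zero _)
    (PC.next_scan_tp _ _ _)
  rfl

open Classical in
/-- The number of monomials (given by the list of their degrees) that are active in clock state
`v`. -/
noncomputable def numAct (degs : List ℕ) {n : ℕ} (v : Fin D → Fin (2 * n + 2)) : ℕ :=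
  (degs.map fun j => if clkAct j v then 1 else 0).sum

lemma gates_comp (hφ : Comp φ) (degs : List ℕ) (rs : List (Fin M.k → ZMod 3))
    (Φ : Bool × M.Conf →₀ ℂ) :
    listOp (degs.flatMap (gatesG M D rs)) (Finsupp.mapDomain (emb x φ v 0 h w) Φ) =
      Finsupp.mapDomain (emb x φ v 0 h w) ((G M rs ^ numAct degs v) Φ) := by
  induction degs generalizing Φ with
  | nil => rfl
  | cons j degs ih =>
    rw [List.flatMap_cons, listOp_append, LinearMap.comp_apply, numAct, List.map_cons,
      List.sum_cons, add_comm, pow_add, Module.End.mul_apply]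
    by_cases hv : clkAct j v
    · rw [gatesG_active hφ hv, ih, if_pos hv, pow_one]; rfl
    · rw [if_neg hv, pow_zero]
      have : listOp (gatesG M D rs j) (Finsupp.mapDomain (emb x φ v 0 h w) Φ) =
          Finsupp.mapDomain (emb x φ v 0 h w) (LinearMap.id (R := ℂ) Φ) :=
        map_mapDomain_of_single _ _ _ _ (fun y => by
          rw [gatesG_inactive _ _ _ fun h => hv ((emb_act j).1 h.2), LinearMap.id_apply,
            Finsupp.mapDomain_single]) _
      rw [this, ih]; rfl

lemma gates_not_comp (degs : List ℕ) (rs : List (Fin M.k → ZMod 3)) (c : PC (Al M D) (St M D))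
    (hc : ¬ Comp c.st.φ) :
    listOp (degs.flatMap (gatesG M D rs)) (Finsupp.single c 1) = Finsupp.single c 1 := by
  induction degs with
  | nil => rfl
  | cons j degs ih =>
    rw [List.flatMap_cons, listOp_append, LinearMap.comp_apply,
      gatesG_inactive _ _ _ fun h => hc h.1, ih]

/-- The number of simulated steps in one cycle of the clock. -/
lemma sum_numAct (degs : List ℕ) (hD : ∀ j ∈ degs, j ≤ D) (n : ℕ) :
    ∑ v : Fin D → Fin (2 * n + 2), numAct degs v = (degs.map fun j => n ^ j).sum := by
  induction degs with
  | nil => simp [numAct]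
  | cons j degs ih =>
    simp only [numAct, List.map_cons, List.sum_cons, Finset.sum_add_distrib] at *
    rw [card_clkAct n (hD j (by simp)), ih fun j hj => hD j (by simp [hj])]

end simulation

end SquaredFunction

/-! ### Runs of the squaring program -/

namespace SquaredFunction

open ComplexConjugate

section runs
variable {X : Type*} (L : (X →₀ ℂ) →ₗ[ℂ] (X →₀ ℂ)) (F : Set X)

/-- `m` applications of `L` turn `Φ` into `Ψ`, and before that no element of `F` occurs. -/
def Runs (Φ : X →₀ ℂ) (m : ℕ) (Ψ : X →₀ ℂ) : Prop :=
  (L ^ m) Φ = Ψ ∧ ∀ t < m, ∀ c, (L ^ t) Φ c ≠ 0 → c ∉ F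

variable {L F} {Φ Ψ Ξ : X →₀ ℂ} {m m' : ℕ}

lemma Runs.trans (h : Runs L F Φ m Ψ) (h' : Runs L F Ψ m' Ξ) : Runs L F Φ (m + m') Ξ := by
  obtain ⟨rfl, h1⟩ := h
  obtain ⟨rfl, h2⟩ := h'
  refine ⟨by rw [add_comm, pow_add, Module.End.mul_apply], fun t ht c hc => ?_⟩
  by_cases htm : t < m
  · exact h1 t htm c hc
  · obtain ⟨s, rfl⟩ := Nat.exists_eq_add_of_le (not_lt.1 htm)
    rw [add_comm, pow_add, Module.End.mul_apply] at hc
    exact h2 s (by omega) c hc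

lemma Runs.one (h : L Φ = Ψ) (hF : ∀ c, Φ c ≠ 0 → c ∉ F) : Runs L F Φ 1 Ψ := by
  refine ⟨by rw [pow_one, h], fun t ht c hc => hF c ?_⟩
  obtain rfl : t = 0 := by omega
  exact hc

lemma Runs.of_steps (Ψ : ℕ → X →₀ ℂ) (m : ℕ) (h : ∀ s < m, L (Ψ s) = Ψ (s + 1))
    (hF : ∀ s < m, ∀ c, Ψ s c ≠ 0 → c ∉ F) : Runs L F (Ψ 0) m (Ψ m) := by
  induction m with
  | zero => exact ⟨rfl, fun t ht => absurd ht (Nat.not_lt_zero t)⟩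
  | succ m ih =>
    exact (ih (fun s hs => h s (by omega)) fun s hs => hF s (by omega)).trans
      (Runs.one (h m (by omega)) (hF m (by omega)))

end runs

section steps
variable {M : QTM} {D : ℕ} {x : List Bool} {φ φ' : Fin 18} {v : Fin D → Fin (2 * x.length + 2)}
  {o h : ℤ} {w : ℤ → Sym M} {y : Bool × M.Conf}

open Classical in
/-- A tick advances the odometer, and possibly the phase, and moves the simulated heads. -/
lemma gTick_emb (hp : (if v = 0 then φ + 1 else φ) = φ') (h5 : 5 ≤ φ') :
    (gTick : Gate (Al M D) (St M D)).op (Finsupp.single (emb x φ v o h w y) 1) =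
      Finsupp.single (emb x φ' (if Adv φ' then odo v else v) (o + (sweep φ').toInt) h w y) 1 := by
  have hp' : tickPhase (emb x φ v o h w y).st (emb x φ v o h w y).scan = φ' := by
    rw [← hp]
    refine if_congr ((forall_congr' fun i => emb_atStart i).trans ?_) rfl rfl
    exact ⟨fun h => funext h, fun h i => congrFun h i⟩
  have hin : mvIn φ' = sweep φ' := by
    rw [mvIn, if_neg, if_neg]
    · rintro (rfl | rfl) <;> exact absurd h5 (by decide)
    · rintro (rfl | rfl) <;> exact absurd h5 (by decide)
  have hclk : mvClk φ' = .N := by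
    rw [mvClk, if_neg, if_neg]
    · rintro rfl; exact absurd h5 (by decide)
    · rintro (rfl | rfl) <;> exact absurd h5 (by decide)
  have hW : ∀ i, (∀ j < i, AtStart (emb x φ v o h w y).st (emb x φ v o h w y).scan j) ↔
      ∀ j < i, v j = 0 := fun i => forall₂_congr fun j _ => emb_atStart j
  have hdirs : ∀ i, tickDirs (emb x φ v o h w y).st (emb x φ v o h w y).scan i =
      ringDir _ ((if Adv φ' then odo v else v) i) := fun i => by
    rw [tickDirs, hp']
    by_cases hA : Adv φ'
    · rw [if_pos hA, odo]
      by_cases hi : ∀ j < i, v j = 0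
      · rw [if_pos ⟨hA, (hW i).2 hi⟩, if_pos hi, ringDir_succ]
        exact congrArg (xor _) (decide_eq_decide.2 (emb_scan_clk_eq_blk i))
      · rw [if_neg fun h => hi ((hW i).1 h.2), if_neg hi]; rfl
    · rw [if_neg hA, if_neg fun h => hA h.1]; rfl
  rw [gTick, Gate.classical_op]
  congr 1
  refine PC.ext (St.ext hp' (funext hdirs) rfl rfl rfl) (funext fun i => ?_) ?_
  · have hmv : ∀ i : Fin M.k, (if i = M.inputTape then
        mvIn (tickPhase (emb x φ v o h w y).st (emb x φ v o h w y).scan) else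
        sweep (tickPhase (emb x φ v o h w y).st (emb x φ v o h w y).scan)) = sweep φ' := fun i => by
      rw [hp', hin, ite_self]
    cases i with
    | m i =>
      refine (congrArg (fun d : HeadMove => y.2.head i + o + d.toInt) (hmv i)).trans ?_
      exact add_assoc _ _ _
    | mark i =>
      refine (congrArg (fun φ => y.2.head i + o + (sweep φ).toInt) hp').trans ?_
      exact add_assoc _ _ _
    | inp => exact congrArg (fun d : HeadMove => o + d.toInt) ((congrArg mvIn hp').trans hin)
    | out => exact add_zero _
    | clk i =>
      show ringPos _ (v i) + (tickClk _ _ i).toInt =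
        ringPos _ ((if Adv φ' then odo v else v) i)
      rw [tickClk, hp', hdirs]
      by_cases hA : Adv φ'
      · rw [if_pos hA, if_pos hA, odo]
        by_cases hi : ∀ j < i, v j = 0
        · rw [if_pos ((hW i).2 hi), if_pos hi, ringPos_succ]
        · rw [if_neg fun h => hi ((hW i).1 h), if_neg hi]; exact add_zero _
      · rw [if_neg hA, if_neg hA, hclk]; exact add_zero _
  · exact PC.next_scan_tp _ _ _

open Classical in
/-- The sign given to `y` by the gate `gOp`. -/
noncomputable def sgn (φ : Fin 18) (o : ℤ) (y : Bool × M.Conf) : ℂ :=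
  if (φ = 7 ∨ φ = 8) ∧ y.2.head M.outputTape + o = 0 ∧
    (y.2.tape M.outputTape 0 : M.Symb) ≠ M.bit true then -1 else 1

lemma opSign_emb : opSign (emb x φ v o h w y).st (emb x φ v o h w y).scan = sgn φ o y := by
  classical
  refine if_congr (and_congr_right' ?_) rfl rfl
  refine (and_congr_left' (markTp_eq_one (M := M))).trans (and_congr_right fun h0 => ?_)
  refine not_congr (Eq.congr_left ?_)
  exact congrArg (fun z => (y.2.tape M.outputTape z : M.Symb)) h0

lemma opWrite_of_ne {s : St M D} (h0 : s.φ ≠ 0) (h2 : s.φ ≠ 2) (h16 : s.φ ≠ 16) (σ : Sg M D) :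
    opWrite s σ = σ := by
  rw [opWrite, if_neg h0, if_neg h2, if_neg h16]

lemma gOp_emb (h0 : φ ≠ 0) (h2 : φ ≠ 2) (h10 : φ ≠ 10) (h16 : φ ≠ 16) :
    (gOp : Gate (Al M D) (St M D)).op (Finsupp.single (emb x φ v o h w y) 1) =
      Finsupp.single (emb x φ v o h w y) (sgn φ o y) := by
  rw [gOp, Gate.classical_op, opSign_emb]
  congr 1
  set c := emb x φ v o h w y
  have hw : opWrite c.st c.scan = c.scan := opWrite_of_ne h0 h2 h16 _
  have hs : opState c.st = c.st := if_neg h10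
  show c.next (opState c.st) (opWrite c.st c.scan) (fun _ => .N) = c
  rw [hs, hw, PC.next_self]

lemma gOp_emb_copy : (gOp : Gate (Al M D) (St M D)).op (Finsupp.single (emb x 10 v o h w y) 1) =
      Finsupp.single (emb x 10 v o h w (!y.1, y.2)) 1 := by
  rw [gOp, Gate.classical_op, opSign_emb, sgn, if_neg fun h => by simp at h]
  congr 1
  set c := emb x 10 v o h w y
  have hw : opWrite c.st c.scan = c.scan :=
    opWrite_of_ne (by simp [c, emb]) (by simp [c, emb]) (by simp [c, emb]) _
  show c.next (opState c.st) (opWrite c.st c.scan) (fun _ => .N) = _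
  rw [hw]
  exact PC.ext rfl (funext fun i => add_zero _) (PC.next_scan_tp _ _ _)

lemma gOp_emb_write : (gOp : Gate (Al M D) (St M D)).op (Finsupp.single (emb x 16 v o h w y) 1) =
      Finsupp.single (emb x 16 v o h (Function.update w h (sw (blk M) (one M) (w h))) y) 1 := by
  rw [gOp, Gate.classical_op, opSign_emb, sgn, if_neg fun h => by simp at h]
  congr 1
  set c := emb x 16 v o h w y
  show c.next (opState c.st) (opWrite c.st c.scan) (fun _ => .N) = _
  refine PC.ext rfl (funext fun i => add_zero _) (funext fun i => ?_)
  cases i with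
  | out => rfl
  | _ => exact Function.update_eq_self _ _

open Classical in
/-- The increment of the counter for `y` by the gate `gCheck`. -/
noncomputable def dev (x : List Bool) (φ : Fin 18) (o : ℤ) (y : Bool × M.Conf) : ℕ :=
  if (φ = 12 ∧ (y.1 = false ∨ y.2.state ≠ M.q₀ ∨ ∃ i, y.2.head i + o ≠ 0)) ∨
    ((φ = 13 ∨ φ = 14 ∨ φ = 15) ∧ ∃ i, (y.2.tape i (y.2.head i + o) : M.Symb) ≠
      if i = M.inputTape then M.stringCell x o else M.blank) then 1 else 0

lemma gCheck_emb :
    (gCheck : Gate (Al M D) (St M D)).op (Finsupp.single (emb x φ v o h w y) 1) =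
      Finsupp.single (emb x φ v o (h + dev x φ o y) w y) 1 := by
  classical
  rw [gCheck, Gate.classical_op]
  congr 1
  have hF : Fail (emb x φ v o h w y).st (emb x φ v o h w y).scan ↔
    (φ = 12 ∧ (y.1 = false ∨ y.2.state ≠ M.q₀ ∨ ∃ i, y.2.head i + o ≠ 0)) ∨
    ((φ = 13 ∨ φ = 14 ∨ φ = 15) ∧ ∃ i, (y.2.tape i (y.2.head i + o) : M.Symb) ≠
      if i = M.inputTape then M.stringCell x o else M.blank) := by
    refine or_congr (and_congr_right' (or_congr Iff.rfl (or_congr Iff.rfl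
      (exists_congr fun i => not_congr ?_)))) Iff.rfl
    exact markTp_eq_one
  refine PC.ext rfl (funext fun i => ?_) (PC.next_scan_tp _ _ _)
  cases i with
  | out =>
    show h + (if Tp.out = Tp.out ∧ _ then HeadMove.R else .N).toInt = h + _
    rw [dev, if_congr (and_iff_right rfl) rfl rfl, if_congr hF rfl rfl]
    split_ifs <;> rfl
  | _ => exact add_zero _

end steps

section loops
variable {M : QTM} {D : ℕ} (degs : List ℕ) (rs : List (Fin M.k → ZMod 3)) {x : List Bool}
  {φ φ' : Fin 18} {v : Fin D → Fin (2 * x.length + 2)} {o : ℤ} {h : Bool × M.Conf → ℤ}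
  {w : ℤ → Sym M}

/-- A superposition of data, encoded in configurations of the squaring program; the position of the
output head may depend on the data. -/
noncomputable def enc (x : List Bool) (φ : Fin 18) (v : Fin D → Fin (2 * x.length + 2)) (o : ℤ)
    (h : Bool × M.Conf → ℤ) (w : ℤ → Sym M) (Φ : Bool × M.Conf →₀ ℂ) :
    PC (Al M D) (St M D) →₀ ℂ := Finsupp.mapDomain (fun y => emb x φ v o (h y) w y) Φ

lemma enc_phase {Φ : Bool × M.Conf →₀ ℂ} {c : PC (Al M D) (St M D)}
    (hc : enc x φ v o h w Φ c ≠ 0) : c.st.φ = φ := by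
  classical
  obtain ⟨y, -, rfl⟩ := Finset.mem_image.1
    (Finsupp.mapDomain_support (Finsupp.mem_support_iff.2 hc))
  rfl

/-- The operator that multiplies the amplitude of `y` by `s y`. -/
noncomputable def diag {X : Type*} (s : X → ℂ) : (X →₀ ℂ) →ₗ[ℂ] (X →₀ ℂ) :=
  Finsupp.linearCombination ℂ fun y => Finsupp.single y (s y)

lemma diag_single {X : Type*} (s : X → ℂ) (y : X) :
    diag s (Finsupp.single y 1) = Finsupp.single y (s y) := by simp [diag]

lemma diag_apply {X : Type*} (s : X → ℂ) (Φ : X →₀ ℂ) (y : X) : diag s Φ y = s y * Φ y := by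
  classical
  induction Φ using Finsupp.induction_linear with
  | zero => simp
  | add a b ha hb => simp only [map_add, Finsupp.add_apply, ha, hb, mul_add]
  | single c a =>
    rw [diag, Finsupp.linearCombination_single, Finsupp.smul_single, Finsupp.single_apply,
      Finsupp.single_apply]
    split_ifs with hcy
    · rw [hcy, smul_eq_mul, mul_comm]
    · rw [mul_zero]

lemma diag_one {X : Type*} (Φ : X →₀ ℂ) : diag (fun _ => 1) Φ = Φ := by
  ext y; rw [diag_apply, one_mul]

lemma diag_diag {X : Type*} (s s' : X → ℂ) (Φ : X →₀ ℂ) :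
    diag s (diag s' Φ) = diag (fun y => s y * s' y) Φ := by
  ext y; rw [diag_apply, diag_apply, diag_apply, mul_assoc]

variable (M D) in
/-- The operator of one pass through the squaring program. -/
noncomputable def pass : (PC (Al M D) (St M D) →₀ ℂ) →ₗ[ℂ] (PC (Al M D) (St M D) →₀ ℂ) :=
  listOp (gOp :: gatesTail M D degs rs)

lemma pass_apply (Φ : PC (Al M D) (St M D) →₀ ℂ) : pass M D degs rs Φ =
    gTick.op (listOp (degs.flatMap (gatesG M D rs)) (gCheck.op (gOp.op Φ))) := by
  rw [pass, gatesTail, listOp, listOp, listOp_append]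
  rfl

variable (M D) in
/-- The configurations in the final phase. -/
def finals : Set (PC (Al M D) (St M D)) := {c | c.st.φ = 17}

open Classical in
/-- One pass in a phase without simulation. -/
lemma loop_enc (hφ : ¬ Comp φ) (h0 : φ ≠ 0) (h2 : φ ≠ 2) (h10 : φ ≠ 10) (h16 : φ ≠ 16)
    (hp : (if v = 0 then φ + 1 else φ) = φ') (h5 : 5 ≤ φ') (Φ : Bool × M.Conf →₀ ℂ) :
    pass M D degs rs (enc x φ v o h w Φ) =
      enc x φ' (if Adv φ' then odo v else v) (o + (sweep φ').toInt)
        (fun y => h y + dev x φ o y) w (diag (sgn φ o) Φ) := by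
  refine map_mapDomain_of_single _ _ _ _ (fun y => ?_) Φ
  rw [pass_apply, gOp_emb h0 h2 h10 h16, ← Finsupp.smul_single_one, map_smul, gCheck_emb,
    map_smul, gates_not_comp _ _ _ hφ, map_smul, gTick_emb hp h5, diag_single,
    Finsupp.mapDomain_single, Finsupp.smul_single_one]

lemma gCheck_emb_of {k : ℤ} {y : Bool × M.Conf} (h1 : φ ≠ 12) (h2 : φ ≠ 13) (h3 : φ ≠ 14)
    (h4 : φ ≠ 15) : (gCheck : Gate (Al M D) (St M D)).op (Finsupp.single (emb x φ v o k w y) 1) =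
      Finsupp.single (emb x φ v o k w y) 1 := by
  rw [gCheck_emb, dev, if_neg (by simp [h1, h2, h3, h4]), Nat.cast_zero, add_zero]

open Classical in
/-- One pass in a simulation phase. -/
lemma loop_enc_comp (hφ : Comp φ) {k : ℤ} (hp : (if v = 0 then φ + 1 else φ) = φ')
    (h5 : 5 ≤ φ') (Φ : Bool × M.Conf →₀ ℂ) :
    pass M D degs rs (enc x φ v 0 (fun _ => k) w Φ) =
      enc x φ' (if Adv φ' then odo v else v) (0 + (sweep φ').toInt) (fun _ => k) w
        ((G M rs ^ numAct degs v) Φ) := by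
  have e1 : (gOp : Gate (Al M D) (St M D)).op (enc x φ v 0 (fun _ => k) w Φ) =
      enc x φ v 0 (fun _ => k) w (LinearMap.id (R := ℂ) Φ) := by
    refine map_mapDomain_of_single _ _ _ _ (fun y => ?_) Φ
    rw [LinearMap.id_apply, Finsupp.mapDomain_single]
    have hs : sgn φ 0 y = 1 := if_neg fun h => by
      rcases hφ with rfl | rfl <;> simp at h
    rcases hφ with rfl | rfl <;> rw [gOp_emb, hs] <;> decide
  have e2 : (gCheck : Gate (Al M D) (St M D)).op (enc x φ v 0 (fun _ => k) w Φ) =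
      enc x φ v 0 (fun _ => k) w (LinearMap.id (R := ℂ) Φ) := by
    refine map_mapDomain_of_single _ _ _ _ (fun y => ?_) Φ
    rw [LinearMap.id_apply, Finsupp.mapDomain_single]
    rcases hφ with rfl | rfl <;> rw [gCheck_emb_of] <;> decide
  rw [pass_apply, e1, LinearMap.id_apply, e2, LinearMap.id_apply, enc, gates_comp hφ]
  generalize (G M rs ^ numAct degs v) Φ = Φ'
  refine map_mapDomain_of_single _ _ _ LinearMap.id (fun y => ?_) Φ'
  rw [gTick_emb hp h5, LinearMap.id_apply, Finsupp.mapDomain_single]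

/-- The pass that exchanges the copies. -/
lemma loop_enc_copy {k : ℤ} (Φ : Bool × M.Conf →₀ ℂ) :
    pass M D degs rs (enc x 10 0 0 (fun _ => k) w Φ) =
      enc x 11 (odo 0) 0 (fun _ => k) w (flip M Φ) := by
  classical
  refine map_mapDomain_of_single _ _ _ _ (fun y => ?_) Φ
  rw [pass_apply, gOp_emb_copy, gCheck_emb_of (by decide) (by decide) (by decide) (by decide),
    gates_not_comp _ _ _ (by simp [emb, Comp]), gTick_emb (φ' := 11) (if_pos rfl) (by decide),
    if_pos (by simp [Adv]), flip, Finsupp.lmapDomain_apply, Finsupp.mapDomain_single,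
    Finsupp.mapDomain_single]
  rfl

/-- The pass that writes the result. -/
lemma loop_enc_write (Φ : Bool × M.Conf →₀ ℂ) :
    pass M D degs rs (enc x 16 0 o h w Φ) =
      Finsupp.mapDomain (fun y => emb x 17 0 o (h y)
        (Function.update w (h y) (sw (blk M) (one M) (w (h y)))) y) Φ := by
  classical
  refine map_mapDomain_of_single _ _ _ LinearMap.id (fun y => ?_) Φ
  rw [pass_apply, gOp_emb_write, gCheck_emb_of (by decide) (by decide) (by decide) (by decide),
    gates_not_comp _ _ _ (by simp [emb, Comp]), gTick_emb (φ' := 17) (if_pos rfl) (by decide),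
    if_neg (by simp [Adv]), LinearMap.id_apply, Finsupp.mapDomain_single,
    show (sweep 17).toInt = 0 from rfl, add_zero]

open Classical in
/-- A superposition at the beginning of phase `φ`. The tick that enters the phase has already
advanced the clock and moved the heads for the first time; `o` is the displacement before this
move. -/
noncomputable def entry (x : List Bool) (φ : Fin 18) (o : ℤ) (h : Bool × M.Conf → ℤ)
    (w : ℤ → Sym M) (Φ : Bool × M.Conf →₀ ℂ) : PC (Al M D) (St M D) →₀ ℂ :=
  enc x φ (if Adv φ then odo 0 else 0) (o + (sweep φ).toInt) h w Φ

/-- The result of a phase in which the simulated heads sweep over the tapes, in one cycle of the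
clock: signs are multiplied and deviations are counted in all cells visited. -/
lemma runs_sweep (hA : Adv φ) (hφ : ¬ Comp φ) (Φ : Bool × M.Conf →₀ ℂ) :
    Runs (pass M D degs rs) (finals M D) (entry x φ o h w Φ) ((2 * x.length + 2) ^ D)
      (entry x (φ + 1) (o + (2 * x.length + 2 : ℕ) ^ D * (sweep φ).toInt)
        (fun y => h y + ∑ s ∈ Finset.range ((2 * x.length + 2) ^ D),
          (dev x φ (o + (s + 1) * (sweep φ).toInt) y : ℤ)) w
        (diag (fun y => ∏ s ∈ Finset.range ((2 * x.length + 2) ^ D),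
          sgn φ (o + (s + 1) * (sweep φ).toInt) y) Φ)) := by
  have hn : φ ≠ 0 ∧ φ ≠ 2 ∧ φ ≠ 10 ∧ φ ≠ 16 ∧ φ ≠ 17 ∧ 5 ≤ φ ∧ 5 ≤ φ + 1 := by
    unfold Adv at hA; unfold Comp at hφ; revert φ; decide
  obtain ⟨h0, h2, h10, h16, h17, h5, h5'⟩ := hn
  obtain ⟨T, hT⟩ : ∃ T, (2 * x.length + 2) ^ D = T + 1 :=
    ⟨_, (Nat.succ_pred (pow_pos (by omega) D).ne').symm⟩
  let Ψ : ℕ → (PC (Al M D) (St M D) →₀ ℂ) := fun t =>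
    enc x φ (odo^[t + 1] 0) (o + (t + 1) * (sweep φ).toInt)
      (fun y => h y + ∑ s ∈ Finset.range t, (dev x φ (o + (s + 1) * (sweep φ).toInt) y : ℤ)) w
      (diag (fun y => ∏ s ∈ Finset.range t, sgn φ (o + (s + 1) * (sweep φ).toInt) y) Φ)
  have hF : ∀ t c, Ψ t c ≠ 0 → c ∉ finals M D := fun t c hc hcF =>
    h17 ((enc_phase hc).symm.trans hcF)
  have e0 : entry x φ o h w Φ = Ψ 0 := by
    simp only [Ψ, entry, if_pos hA, Finset.range_zero, Finset.sum_empty, Finset.prod_empty,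
      diag_one, Nat.cast_zero, zero_add, one_mul, add_zero, Function.iterate_one]
  rw [e0, hT]
  refine (Runs.of_steps Ψ T (fun s hs => ?_) fun s _ => hF s).trans
    (Runs.one ?_ (hF T))
  · have hne : odo^[s + 1] (0 : Fin D → Fin (2 * x.length + 2)) ≠ 0 :=
      odo_ne_zero (Nat.succ_pos s) (by omega)
    refine (loop_enc degs rs hφ h0 h2 h10 h16 (if_neg hne) h5 _).trans ?_
    simp only [Ψ, if_pos hA, diag_diag, Finset.sum_range_succ, Finset.prod_range_succ,
      Function.iterate_succ_apply', add_assoc, Nat.cast_add, Nat.cast_one]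
    congr 1
    · ring
    · exact congrArg (fun s => diag s Φ) (funext fun y => mul_comm _ _)
  · have hz : odo^[T + 1] (0 : Fin D → Fin (2 * x.length + 2)) = 0 := by
      rw [← hT]; exact (odo_cycle _ D).1
    refine (loop_enc degs rs hφ h0 h2 h10 h16 (if_pos hz) h5' _).trans ?_
    simp only [entry, hz, diag_diag, Finset.sum_range_succ, Finset.prod_range_succ, add_assoc]
    congr 1
    · have : (((2 * x.length + 2 : ℕ) : ℤ)) ^ D = T + 1 := by exact_mod_cast hT
      rw [this]
    · exact congrArg (fun s => diag s Φ) (funext fun y => mul_comm _ _)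

/-- The result of a phase in which the machine is simulated, in one cycle of the clock: the numbers
of steps in the states of the clock add up to the sum of powers. -/
lemma runs_comp (hφ : Comp φ) (hD : ∀ j ∈ degs, j ≤ D) {k : ℤ} (Φ : Bool × M.Conf →₀ ℂ) :
    Runs (pass M D degs rs) (finals M D) (entry x φ 0 (fun _ => k) w Φ) ((2 * x.length + 2) ^ D)
      (entry x (φ + 1) 0 (fun _ => k) w
        ((G M rs ^ (degs.map fun j => x.length ^ j).sum) Φ)) := by
  have hn : φ ≠ 17 ∧ 5 ≤ φ ∧ 5 ≤ φ + 1 ∧ Adv φ ∧ sweep φ = .N := by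
    rcases hφ with rfl | rfl <;> simp [Adv, sweep]
  obtain ⟨h17, h5, h5', hA, hs⟩ := hn
  obtain ⟨T, hT⟩ : ∃ T, (2 * x.length + 2) ^ D = T + 1 :=
    ⟨_, (Nat.succ_pred (pow_pos (by omega) D).ne').symm⟩
  let Ψ : ℕ → (PC (Al M D) (St M D) →₀ ℂ) := fun t =>
    enc x φ (odo^[t + 1] 0) 0 (fun _ => k) w
      ((G M rs ^ ∑ s ∈ Finset.range t,
        numAct degs (odo^[s + 1] (0 : Fin D → Fin (2 * x.length + 2)))) Φ)
  have hF : ∀ t c, Ψ t c ≠ 0 → c ∉ finals M D := fun t c hc hcF =>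
    h17 ((enc_phase hc).symm.trans hcF)
  have e0 : entry x φ 0 (fun _ => k) w Φ = Ψ 0 := by
    simp only [Ψ, entry, if_pos hA, hs, Finset.range_zero, Finset.sum_empty]
    rfl
  rw [e0, hT, ← sum_numAct degs hD, ← sum_odo_succ]
  refine (Runs.of_steps Ψ T (fun s hs' => ?_) fun s _ => hF s).trans
    (Runs.one ?_ (hF T))
  · have hne : odo^[s + 1] (0 : Fin D → Fin (2 * x.length + 2)) ≠ 0 :=
      odo_ne_zero (Nat.succ_pos s) (by omega)
    refine (loop_enc_comp degs rs hφ (if_neg hne) h5 _).trans ?_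
    simp only [Ψ, if_pos hA, hs, Finset.sum_range_succ, Function.iterate_succ_apply']
    rw [add_comm (∑ s ∈ Finset.range s, _), pow_add, Module.End.mul_apply]
    rfl
  · have hz : odo^[T + 1] (0 : Fin D → Fin (2 * x.length + 2)) = 0 := by
      rw [← hT]; exact (odo_cycle _ D).1
    refine (loop_enc_comp degs rs hφ (if_pos hz) h5' _).trans ?_
    rw [hT, Finset.sum_range_succ, add_comm (∑ s ∈ Finset.range T, _), pow_add,
      Module.End.mul_apply]
    simp only [entry, hz]

end loops

end SquaredFunction

/-! ### The initial phases -/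

namespace SquaredFunction

section initial
variable {M : QTM} {D : ℕ} {x : List Bool} {z K : ℤ} {φ φ' : Fin 18} {m : ℤ → Sym M}

open Classical in
variable (M) in
/-- The tape that holds the part of the input `x` to the left of cell `K`. -/
noncomputable def preTp (x : List Bool) (K z : ℤ) : Sym M := if z < K then strTp M x z else blk M

lemma preTp_zero : preTp M x 0 = fun _ => blk M := by
  funext z
  unfold preTp
  split_ifs with h
  · exact strTp_eq_blk.2 (Or.inl h)
  · rfl

lemma preTp_of_le (h : x.length ≤ K) : preTp M x K = strTp M x := by
  funext z
  unfold preTp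
  split_ifs with hz
  · rfl
  · exact (strTp_eq_blk.2 (Or.inr (by omega))).symm

lemma preTp_self : preTp M x z z = blk M := if_neg (lt_irrefl z)

lemma preTp_succ : Function.update (preTp M x z) z (strTp M x z) = preTp M x (z + 1) := by
  funext t
  by_cases ht : t = z
  · subst ht
    rw [Function.update_self, preTp, if_pos (by omega)]
  · rw [Function.update_of_ne ht, preTp, preTp]
    exact if_congr (by omega) rfl rfl

/-- The configurations in the initial phases: the heads on the clock tapes, the input tape and the
input tape of `M` scan cell `z`, and the input has been copied up to cell `K`. -/
noncomputable def ini (x : List Bool) (m : ℤ → Sym M) (φ : Fin 18) (z K : ℤ) :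
    PC (Al M D) (St M D) where
  st := { initSt M D with φ := φ }
  hd := mk (fun i => if i = M.inputTape then z else 0) (fun _ => 0) (fun _ => z) z 0
  tp := mk (Function.update (fun i _ => M.blankAt i) M.inputTape (preTp M x K)) (fun _ => m)
    (fun _ => preTp M x K) (strTp M x) (fun _ => blk M)

lemma ini_tp_inputTape :
    (ini (D := D) x m φ z K).tp (.m M.inputTape) = preTp M x K := by
  show Function.update (fun i _ => M.blankAt i) M.inputTape (preTp M x K) M.inputTape = _
  exact Function.update_self _ _ _

lemma ini_tp_of_ne {i : Fin M.k} (h : i ≠ M.inputTape) :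
    (ini (D := D) x m φ z K).tp (.m i) = fun _ => M.blankAt i := by
  show Function.update (fun i _ => M.blankAt i) M.inputTape (preTp M x K) i = _
  exact Function.update_of_ne h _ _

lemma start_eq (degs : List ℕ) (rs : List (Fin M.k → ZMod 3)) :
    (prog M D degs rs).start x = ini x (fun _ => blk M) 0 0 0 := by
  have key : ∀ (i : Tp M.k D) (t : ℤ), (((prog M D degs rs).start x).tp i t : M.Symb) =
      if i = .inp then M.stringCell x t else M.blank := fun _ _ => rfl
  refine PC.ext rfl (funext fun i => ?_) (funext fun i => funext fun t =>
    Subtype.ext ((key i t).trans ?_))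
  · cases i with
    | m i =>
      show (0 : ℤ) = if i = M.inputTape then 0 else 0
      rw [ite_self]
    | _ => rfl
  · cases i with
    | m i =>
      refine (if_neg (by simp)).trans ?_
      by_cases hi : i = M.inputTape
      · subst hi
        rw [ini_tp_inputTape, preTp_zero]; rfl
      · rw [ini_tp_of_ne hi]; rfl
    | mark i => exact if_neg (by simp)
    | clk i =>
      refine (if_neg (by simp)).trans ?_
      show _ = (preTp M x 0 t : M.Symb)
      rw [preTp_zero]; rfl
    | inp => exact if_pos rfl
    | out => exact if_neg (by simp)

lemma ini_atStart (i : Fin D) :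
    AtStart (ini (D := D) x m φ z K).st (ini (D := D) x m φ z K).scan i ↔ preTp M x K z = blk M :=
  and_iff_right rfl

open Classical in
lemma ini_tickPhase (hD : 0 < D) :
    tickPhase (ini (D := D) x m φ z K).st (ini (D := D) x m φ z K).scan =
      if preTp M x K z = blk M then φ + 1 else φ :=
  if_congr ⟨fun h => (ini_atStart _).1 (h ⟨0, hD⟩), fun h i => (ini_atStart i).2 h⟩ rfl rfl

lemma not_adv_of_lt (h : φ < 5) : ¬ Adv φ := by
  unfold Adv; revert φ; decide

lemma gOp_ini (h0 : φ ≠ 0) (h2 : φ ≠ 2) (h5 : φ < 5) :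
    (gOp : Gate (Al M D) (St M D)).op (Finsupp.single (ini x m φ z K) 1) =
      Finsupp.single (ini x m φ z K) 1 := by
  have hn : φ ≠ 7 ∧ φ ≠ 8 ∧ φ ≠ 10 ∧ φ ≠ 16 := by
    clear h0 h2; revert φ; decide
  rw [gOp, Gate.classical_op]
  set c : PC (Al M D) (St M D) := ini x m φ z K
  have hw : opWrite c.st c.scan = c.scan := opWrite_of_ne h0 h2 hn.2.2.2 _
  have hs : opState c.st = c.st := if_neg hn.2.2.1
  have hsg : opSign c.st c.scan = 1 := if_neg fun h => h.1.elim hn.1 hn.2.1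
  rw [hsg]
  show Finsupp.single (c.next (opState c.st) (opWrite c.st c.scan) (fun _ => .N)) (1 : ℂ) = _
  rw [hs, hw, PC.next_self]

lemma gOp_ini_mark : (gOp : Gate (Al M D) (St M D)).op
    (Finsupp.single (ini x (fun _ => blk M) 0 z K) 1) =
      Finsupp.single (ini x (markTp M) 0 z K) 1 := by
  rw [gOp, Gate.classical_op]
  set c : PC (Al M D) (St M D) := ini x (fun _ => blk M) 0 z K
  have hsg : opSign c.st c.scan = 1 := if_neg fun h => by
    have := h.1; simp [c, ini] at this
  rw [hsg]
  congr 1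
  refine PC.ext rfl (funext fun i => add_zero _) (funext fun i => ?_)
  cases i with
  | mark i =>
    show Function.update (fun _ => blk M) 0 (sw (blk M) (one M) (blk M)) = markTp M
    rw [sw_left]
    funext t
    rw [Function.update_apply]; rfl
  | _ => exact Function.update_eq_self _ _

lemma opWrite_two {s : St M D} (h : s.φ = 2) (σ : Sg M D) : opWrite s σ = mk
    (updIn (fun i => σ (.m i)) (sw (blk M) (σ .inp) (σ (.m M.inputTape))))
    (fun i => σ (.mark i)) (fun i => sw (blk M) (σ .inp) (σ (.clk i))) (σ .inp) (σ .out) := by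
  rw [opWrite, if_neg (by rw [h]; decide), if_pos h]

lemma gOp_ini_copy : (gOp : Gate (Al M D) (St M D)).op (Finsupp.single (ini x m 2 z z) 1) =
      Finsupp.single (ini x m 2 z (z + 1)) 1 := by
  rw [gOp, Gate.classical_op]
  set c : PC (Al M D) (St M D) := ini x m 2 z z with hc
  have hsg : opSign c.st c.scan = 1 := if_neg fun h => by
    have := h.1; simp [c, ini] at this
  rw [hsg]
  congr 1
  have hblk : sw (blk M) (strTp M x z) (preTp M x z z) = strTp M x z := by
    rw [preTp_self, sw_left]
  have hw : opWrite c.st c.scan = mk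
      (updIn (fun i => c.scan (.m i)) (sw (blk M) (c.scan .inp) (c.scan (.m M.inputTape))))
      (fun i => c.scan (.mark i)) (fun i => sw (blk M) (c.scan .inp) (c.scan (.clk i)))
      (c.scan .inp) (c.scan .out) := by
    exact opWrite_two rfl _
  refine PC.ext rfl (funext fun i => add_zero _) (funext fun i => ?_)
  cases i with
  | m i =>
    by_cases hi : i = M.inputTape
    · subst hi
      have e1 : c.hd (.m M.inputTape) = z := if_pos rfl
      have e2 : c.tp (.m M.inputTape) = preTp M x z := ini_tp_inputTape
      have e3 : (ini (D := D) x m 2 z (z + 1)).tp (.m M.inputTape) = preTp M x (z + 1) :=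
        ini_tp_inputTape
      have e4 : opWrite c.st c.scan (.m M.inputTape) = strTp M x z := by
        rw [hw]
        refine (updIn_self _ _).trans (Eq.trans ?_ hblk)
        refine congrArg (sw (blk M) (strTp M x z)) ?_
        show c.tp (.m M.inputTape) (c.hd (.m M.inputTape)) = _
        rw [e1, e2]
      show Function.update (c.tp (.m M.inputTape)) (c.hd (.m M.inputTape))
        (opWrite c.st c.scan (.m M.inputTape)) = _
      rw [e1, e2, e3, e4]
      exact preTp_succ
    · have e4 : opWrite c.st c.scan (.m i) = c.scan (.m i) := by
        rw [hw]; exact updIn_of_ne _ _ hi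
      show Function.update (c.tp (.m i)) (c.hd (.m i)) (opWrite c.st c.scan (.m i)) = _
      rw [e4]
      exact (Function.update_eq_self _ _).trans ((ini_tp_of_ne hi).trans (ini_tp_of_ne hi).symm)
  | clk i =>
    show Function.update (preTp M x z) z (sw (blk M) (strTp M x z) (preTp M x z z)) =
      preTp M x (z + 1)
    rw [hblk, preTp_succ]
  | _ => exact Function.update_eq_self _ _

open Classical in
lemma gTick_ini (hD : 0 < D) (hp : (if preTp M x K z = blk M then φ + 1 else φ) = φ')
    (hφ' : φ' = 1 ∨ φ' = 2 ∨ φ' = 3) :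
    (gTick : Gate (Al M D) (St M D)).op (Finsupp.single (ini x m φ z K) 1) =
      Finsupp.single (ini x m φ' (z + (mvIn φ').toInt) K) 1 := by
  rw [gTick, Gate.classical_op]
  set c : PC (Al M D) (St M D) := ini x m φ z K
  have hp' : tickPhase c.st c.scan = φ' := (ini_tickPhase hD).trans hp
  have hA : ¬ Adv φ' := not_adv_of_lt (by rcases hφ' with rfl | rfl | rfl <;> decide)
  have hclk : mvClk φ' = mvIn φ' := by
    rcases hφ' with rfl | rfl | rfl <;> simp [mvClk, mvIn]
  have hsw : sweep φ' = .N := by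
    rcases hφ' with rfl | rfl | rfl <;> simp [sweep]
  congr 1
  refine PC.ext (St.ext hp' (funext fun i => ?_) rfl rfl rfl) (funext fun i => ?_)
    (PC.next_scan_tp _ _ _)
  · show tickDirs c.st c.scan i = false
    rw [tickDirs, hp', if_neg fun h => hA h.1]; rfl
  · cases i with
    | m i =>
      show (if i = M.inputTape then z else 0) + (if i = M.inputTape then
        mvIn (tickPhase c.st c.scan) else sweep (tickPhase c.st c.scan)).toInt =
        if i = M.inputTape then z + (mvIn φ').toInt else 0
      rw [hp']
      by_cases hi : i = M.inputTape
      · simp only [if_pos hi]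
      · simp only [if_neg hi, hsw]; rfl
    | mark i =>
      show 0 + (sweep (tickPhase c.st c.scan)).toInt = 0
      rw [hp', hsw]; rfl
    | clk i =>
      show z + (tickClk c.st c.scan i).toInt = z + (mvIn φ').toInt
      rw [tickClk, hp', if_neg hA, hclk]
    | inp =>
      show z + (mvIn (tickPhase c.st c.scan)).toInt = z + (mvIn φ').toInt
      rw [hp']
    | out => rfl

/-- When all heads have returned, the simulation can start. -/
lemma gTick_ini_last (hD : 0 < D) (hK : x.length ≤ K) :
    (gTick : Gate (Al M D) (St M D)).op (Finsupp.single (ini x (markTp M) 3 (-1) K) 1) =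
      Finsupp.single (emb x 4 0 0 0 (fun _ => blk M) (false, M.init x)) 1 := by
  classical
  rw [gTick, Gate.classical_op]
  set c : PC (Al M D) (St M D) := ini x (markTp M) 3 (-1) K with hc
  have hb : preTp M x K (-1) = blk M := by
    rw [preTp_of_le hK]; exact strTp_eq_blk.2 (Or.inl (by norm_num))
  have hp' : tickPhase c.st c.scan = 4 := (ini_tickPhase hD).trans (if_pos hb)
  have hA : ¬ Adv 4 := not_adv_of_lt (by decide)
  congr 1
  refine PC.ext (St.ext hp' (funext fun i => ?_) rfl rfl (funext fun i => ?_)) (funext fun i => ?_)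
    ?_
  · show tickDirs c.st c.scan i = _
    rw [tickDirs, hp', if_neg fun h => hA h.1]; rfl
  · exact Int.cast_zero.symm
  · cases i with
    | m i =>
      show (if i = M.inputTape then -1 else 0) + (if i = M.inputTape then
        mvIn (tickPhase c.st c.scan) else sweep (tickPhase c.st c.scan)).toInt = 0 + 0
      rw [hp']
      by_cases hi : i = M.inputTape
      · simp only [if_pos hi]; rfl
      · simp only [if_neg hi]; rfl
    | mark i =>
      show 0 + (sweep (tickPhase c.st c.scan)).toInt = 0 + 0
      rw [hp']; rfl
    | clk i =>
      show -1 + (tickClk c.st c.scan i).toInt = _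
      rw [tickClk, hp', if_neg hA]; rfl
    | inp =>
      show -1 + (mvIn (tickPhase c.st c.scan)).toInt = 0
      rw [hp']; rfl
    | out => rfl
  · refine (PC.next_scan_tp _ _ _).trans (funext fun i => ?_)
    cases i with
    | m i =>
      show Function.update (fun i _ => M.blankAt i) M.inputTape (preTp M x K) i = (M.init x).tape i
      rw [preTp_of_le hK]
      funext t
      refine Subtype.ext ?_
      show _ = if i = M.inputTape then M.stringCell x t else M.blank
      by_cases hi : i = M.inputTape
      · subst hi
        rw [if_pos rfl, Function.update_self]; rfl
      · rw [if_neg hi, Function.update_of_ne hi]; rfl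
    | clk i => exact preTp_of_le hK
    | _ => rfl

variable (degs : List ℕ) (rs : List (Fin M.k → ZMod 3))

lemma pass_single (c c' : PC (Al M D) (St M D)) (h : gOp.op (Finsupp.single c 1) =
      Finsupp.single c' 1) (h5 : c'.st.φ < 5) :
    pass M D degs rs (Finsupp.single c 1) = gTick.op (Finsupp.single c' 1) := by
  classical
  have hn : c'.st.φ ≠ 12 ∧ c'.st.φ ≠ 13 ∧ c'.st.φ ≠ 14 ∧ c'.st.φ ≠ 15 ∧ ¬ Comp c'.st.φ := by
    unfold Comp; generalize c'.st.φ = φ at *; clear h; revert φ; decide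
  obtain ⟨h1, h2, h3, h4, h6⟩ := hn
  have hF : ¬ Fail c'.st c'.scan := by
    rintro (h | h)
    · exact h1 h.1
    · exact h.1.elim h2 fun h => h.elim h3 h4
  have hc : (gCheck : Gate (Al M D) (St M D)).op (Finsupp.single c' 1) = Finsupp.single c' 1 :=
    classical_op_self _ _ (by
      simp only [hF, and_false, if_false])
  rw [pass_apply, h, hc, gates_not_comp _ _ _ h6]

lemma runs_single {c c' : PC (Al M D) (St M D)} {Ψ : PC (Al M D) (St M D) →₀ ℂ}
    (h : gOp.op (Finsupp.single c 1) = Finsupp.single c' 1) (h5 : c'.st.φ < 5)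
    (h5' : c.st.φ < 5) (hT : gTick.op (Finsupp.single c' 1) = Ψ) :
    Runs (pass M D degs rs) (finals M D) (Finsupp.single c 1) 1 Ψ := by
  refine Runs.one ((pass_single degs rs c c' h h5).trans hT) fun d hd hF => ?_
  have hdc : d = c := by
    by_contra hne
    exact hd (Finsupp.single_eq_of_ne hne)
  subst hdc
  rw [show d.st.φ = 17 from hF] at h5'
  exact absurd h5' (by decide)

/-- The phases from 0 to 4 copy the input and set up the simulation. -/
lemma runs_initial (hD : 0 < D) (x : List Bool) :
    Runs (pass M D degs rs) (finals M D) (Finsupp.single ((prog M D degs rs).start x) 1)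
      (2 * x.length + 5)
      (entry x 5 0 (fun _ => 0) (fun _ => blk M) (Finsupp.single (false, M.init x) 1)) := by
  classical
  have l0 : (0 : Fin 18) < 5 := by decide
  have l1 : (1 : Fin 18) < 5 := by decide
  have l2 : (2 : Fin 18) < 5 := by decide
  have l3 : (3 : Fin 18) < 5 := by decide
  have r0 : Runs (pass M D degs rs) (finals M D)
      (Finsupp.single (ini x (fun _ => blk M) 0 0 0) 1) 1
      (Finsupp.single (ini x (markTp M) 1 (-1) 0) 1) :=
    runs_single degs rs gOp_ini_mark l0 l0
      (gTick_ini hD (if_pos preTp_self) (by decide))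
  have r1 : Runs (pass M D degs rs) (finals M D)
      (Finsupp.single (ini x (markTp M) 1 (-1) 0) 1) 1
      (Finsupp.single (ini x (markTp M) 2 0 0) 1) :=
    runs_single degs rs (gOp_ini (by decide) (by decide) (by decide)) l1 l1
      (gTick_ini hD (if_pos (by rw [preTp_zero])) (by decide))
  have r2 : ∀ t ≤ x.length, Runs (pass M D degs rs) (finals M D)
      (Finsupp.single (ini x (markTp M) 2 0 0) 1) t
      (Finsupp.single (ini x (markTp M) 2 t t) 1) := by
    intro t ht
    induction t with
    | zero => exact ⟨rfl, fun s hs => absurd hs (Nat.not_lt_zero s)⟩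
    | succ t ih =>
      refine (ih (by omega)).trans (runs_single degs rs gOp_ini_copy l2 l2 ?_)
      rw [gTick_ini hD (φ' := 2) (if_neg ?_) (by decide)]
      · rfl
      · rw [preTp, if_pos (by omega), strTp_eq_blk]; omega
  have r3 : Runs (pass M D degs rs) (finals M D)
      (Finsupp.single (ini x (markTp M) 2 x.length x.length) 1) 1
      (Finsupp.single (ini x (markTp M) 3 (x.length - 1) (x.length + 1)) 1) :=
    runs_single degs rs gOp_ini_copy l2 l2
      (gTick_ini hD (if_pos (by rw [preTp, if_pos (by omega), strTp_eq_blk]; omega)) (by decide))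
  have r4 : ∀ t ≤ x.length, Runs (pass M D degs rs) (finals M D)
      (Finsupp.single (ini x (markTp M) 3 (x.length - 1) (x.length + 1)) 1) t
      (Finsupp.single (ini x (markTp M) 3 (x.length - 1 - t) (x.length + 1)) 1) := by
    intro t ht
    induction t with
    | zero =>
      rw [Nat.cast_zero, sub_zero]
      exact ⟨rfl, fun s hs => absurd hs (Nat.not_lt_zero s)⟩
    | succ t ih =>
      refine (ih (by omega)).trans (runs_single degs rs
        (gOp_ini (by decide) (by decide) (by decide)) l3 l3 ?_)
      rw [gTick_ini hD (φ' := 3) (if_neg ?_) (by decide)]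
      · congr 2
        show (x.length - 1 - t : ℤ) + -1 = _
        push_cast; ring
      · rw [preTp, if_pos (by omega), strTp_eq_blk]; omega
  have r5 : Runs (pass M D degs rs) (finals M D)
      (Finsupp.single (ini x (markTp M) 3 (-1) (x.length + 1)) 1) 1
      (Finsupp.single (emb x 4 0 0 0 (fun _ => blk M) (false, M.init x)) 1) :=
    runs_single degs rs (gOp_ini (by decide) (by decide) (by decide)) l3 l3
      (gTick_ini_last hD (by omega))
  have r6 : Runs (pass M D degs rs) (finals M D)
      (Finsupp.single (emb x 4 0 0 0 (fun _ => blk M) (false, M.init x)) 1) 1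
      (entry x 5 0 (fun _ => 0) (fun _ => blk M) (Finsupp.single (false, M.init x) 1)) := by
    have e : Finsupp.single (emb (D := D) x 4 0 0 0 (fun _ => blk M) (false, M.init x)) (1 : ℂ) =
        enc x 4 0 0 (fun _ => 0) (fun _ => blk M) (Finsupp.single (false, M.init x) 1) := by
      rw [enc, Finsupp.mapDomain_single]
    rw [e]
    refine Runs.one ?_ fun c hc hF => ?_
    · rw [loop_enc degs rs (by simp [Comp]) (by decide) (by decide) (by decide) (by decide)
        (φ' := 5) (if_pos rfl) (by decide), entry]
      have h1 : sgn (M := M) 4 0 = fun _ => 1 := funext fun y => if_neg fun h => by simp at h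
      have h2 : ∀ y : Bool × M.Conf, dev x 4 0 y = 0 := fun y => if_neg fun h => by simp at h
      simp only [h1, h2, diag_one, Nat.cast_zero, add_zero]
    · have := (enc_phase hc).symm.trans hF
      exact absurd this (by decide)
  have r4' := r4 x.length le_rfl
  rw [show (x.length - 1 - x.length : ℤ) = -1 by ring] at r4'
  have := (((((r0.trans r1).trans (r2 _ le_rfl)).trans r3).trans r4').trans r5).trans r6
  rw [start_eq]
  convert this using 1
  ring

end initial

end SquaredFunction

/-! ### The result of the squaring program -/

namespace SquaredFunction

open ComplexConjugate

section result
variable {M : QTM} {D : ℕ} {x : List Bool}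

/-- The number of deviations of `y` from the initial configuration in copy `1` that are counted in
the phases from 12 to 15. -/
noncomputable def cnt (x : List Bool) (T : ℕ) (y : Bool × M.Conf) : ℕ :=
  dev x 12 0 y + ∑ s ∈ Finset.range T, dev x 13 (s + 1) y +
    ∑ s ∈ Finset.range T, dev x 14 (T - (s + 1)) y + ∑ s ∈ Finset.range T, dev x 15 (-(s + 1)) y

/-- The sign that `y` receives in the phases 7 and 8. -/
noncomputable def sweepSign (T : ℕ) (y : Bool × M.Conf) : ℂ :=
  (∏ s ∈ Finset.range T, sgn 8 (-(s + 1)) y) * ∏ s ∈ Finset.range T, sgn 7 (T - (s + 1)) y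

lemma sgn_of_ne {φ : Fin 18} (h7 : φ ≠ 7) (h8 : φ ≠ 8) (o : ℤ) (y : Bool × M.Conf) :
    sgn φ o y = 1 := if_neg fun h => h.1.elim h7 h8

lemma dev_of_ne {φ : Fin 18} (h1 : φ ≠ 12) (h2 : φ ≠ 13) (h3 : φ ≠ 14) (h4 : φ ≠ 15) (o : ℤ)
    (y : Bool × M.Conf) : dev x φ o y = 0 :=
  if_neg fun h => h.elim (fun h => h1 h.1) fun h => h.1.elim h2 fun h => h.elim h3 h4

variable (degs : List ℕ) (rs : List (Fin M.k → ZMod 3))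

variable (D x) in
/-- The data after the second simulation: `p(n)` steps of `G`, the signs of the output, the
exchange of the copies, and `p(n)` steps of `G`, where `p(n)` is the sum of the powers `n ^ j` for
`j` in `degs`. -/
noncomputable def finalData : Bool × M.Conf →₀ ℂ :=
  (G M rs ^ (degs.map fun j => x.length ^ j).sum)
    (flip M (diag (sweepSign ((2 * x.length + 2) ^ D))
      ((G M rs ^ (degs.map fun j => x.length ^ j).sum) (Finsupp.single (false, M.init x) 1))))

variable (D x) in
/-- The final configuration of the squaring program that holds the data `y`: the symbol `1` is in
the cell of the output tape whose number is that of the deviations. -/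
noncomputable def finalCfg (y : Bool × M.Conf) : PC (Al M D) (St M D) :=
  emb x 17 0 (-((2 * x.length + 2) ^ D : ℕ)) (cnt x ((2 * x.length + 2) ^ D) y)
    (Function.update (fun _ => blk M) (cnt x ((2 * x.length + 2) ^ D) y : ℤ) (one M)) y

/-- The whole run of the squaring program: one cycle of the clock for each of the nine phases 5 to
9, 11 and 13 to 15, one pass for each of the phases 4, 10, 12 and 16, and the copying of the input.
-/
lemma runs_prog (hD : 0 < D) (hdegs : ∀ j ∈ degs, j ≤ D) (x : List Bool) :
    Runs (pass M D degs rs) (finals M D) (Finsupp.single ((prog M D degs rs).start x) 1)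
      (2 * x.length + 8 + 9 * (2 * x.length + 2) ^ D)
      (Finsupp.mapDomain (finalCfg D x) (finalData D x degs rs)) := by
  classical
  set T : ℕ := (2 * x.length + 2) ^ D with hT
  have hTz : ((2 * x.length + 2 : ℕ) : ℤ) ^ D = T := by rw [hT]; push_cast; rfl
  set p := (degs.map fun j => x.length ^ j).sum with hp
  have hR : (sweep 6).toInt = 1 ∧ (sweep 9).toInt = 1 ∧ (sweep 13).toInt = 1 := ⟨rfl, rfl, rfl⟩
  have hL : (sweep 7).toInt = -1 ∧ (sweep 8).toInt = -1 ∧ (sweep 14).toInt = -1 ∧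
    (sweep 15).toInt = -1 := ⟨rfl, rfl, rfl, rfl⟩
  set Φ₁ := (G M rs ^ p) (Finsupp.single (false, M.init x) 1) with hΦ₁
  have r0 := runs_initial degs rs hD x
  have r5 := runs_comp (x := x) (φ := 5) degs rs (Or.inl rfl) hdegs (k := 0) (w := fun _ => blk M)
    (Finsupp.single (false, M.init x) 1)
  rw [← hp, ← hΦ₁] at r5
  have r6 := runs_sweep (D := D) (x := x) (φ := 6) degs rs (by simp [Adv]) (by simp [Comp])
    (o := 0) (h := fun _ => 0) (w := fun _ => blk M) Φ₁
  have r7 := runs_sweep (D := D) (x := x) (φ := 7) degs rs (by simp [Adv]) (by simp [Comp])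
    (o := T) (h := fun _ => 0) (w := fun _ => blk M) Φ₁
  have r8 := runs_sweep (D := D) (x := x) (φ := 8) degs rs (by simp [Adv]) (by simp [Comp])
    (o := 0) (h := fun _ => 0) (w := fun _ => blk M)
    (diag (fun y => ∏ s ∈ Finset.range T, sgn 7 (T - (s + 1)) y) Φ₁)
  have r9 := runs_sweep (D := D) (x := x) (φ := 9) degs rs (by simp [Adv]) (by simp [Comp])
    (o := -T) (h := fun _ => 0) (w := fun _ => blk M) (diag (sweepSign T) Φ₁)
  have d : ∀ (y : Bool × M.Conf) (o : ℤ), dev x 6 o y = 0 ∧ dev x 7 o y = 0 ∧ dev x 8 o y = 0 ∧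
      dev x 9 o y = 0 := fun y o => by
    refine ⟨?_, ?_, ?_, ?_⟩ <;> refine dev_of_ne ?_ ?_ ?_ ?_ _ _ <;> decide
  have g : ∀ (y : Bool × M.Conf) (o : ℤ), sgn 6 o y = 1 ∧ sgn 9 o y = 1 ∧ sgn 12 o y = 1 ∧
      sgn 13 o y = 1 ∧ sgn 14 o y = 1 ∧ sgn 15 o y = 1 := fun y o => by
    refine ⟨?_, ?_, ?_, ?_, ?_, ?_⟩ <;> refine sgn_of_ne ?_ ?_ _ _ <;> decide
  have hz : ∀ (A : Bool × M.Conf →₀ ℂ), enc (D := D) x 10 0 0 (fun _ => 0) (fun _ => blk M) A =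
      entry x 10 0 (fun _ => 0) (fun _ => blk M) A := fun A => by
    rw [entry, if_neg (by simp [Adv])]; rfl
  set Φ₂ := flip M (diag (sweepSign T) Φ₁) with hΦ₂
  have r10 : Runs (pass M D degs rs) (finals M D)
      (entry x 10 0 (fun _ => 0) (fun _ => blk M) (diag (sweepSign T) Φ₁)) 1
      (entry x 11 0 (fun _ => 0) (fun _ => blk M) Φ₂) := by
    refine Runs.one ?_ fun c hc hF => ?_
    · rw [← hz, loop_enc_copy, entry, if_pos (by simp [Adv])]; rfl
    · exact absurd ((enc_phase hc).symm.trans hF) (by decide)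
  have r11 := runs_comp (x := x) (φ := 11) degs rs (Or.inr rfl) hdegs (k := 0) (w := fun _ => blk M)
    Φ₂
  set Ψ := (G M rs ^ p) Φ₂ with hΨ
  have r12 : Runs (pass M D degs rs) (finals M D)
      (entry x 12 0 (fun _ => 0) (fun _ => blk M) Ψ) 1
      (entry x 13 0 (fun y => (dev x 12 0 y : ℤ)) (fun _ => blk M) Ψ) := by
    refine Runs.one ?_ fun c hc hF => ?_
    · rw [entry, if_neg (by simp [Adv])]
      refine (loop_enc degs rs (by simp [Comp]) (by decide) (by decide) (by decide) (by decide)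
        (φ' := 13) (if_pos rfl) (by decide) _).trans ?_
      have h12 : (sweep 12).toInt = 0 := rfl
      have hs : sgn (M := M) 12 0 = fun _ => 1 := funext fun y => (g y 0).2.2.1
      simp only [entry, h12, add_zero, hs, diag_one, zero_add]
    · exact absurd ((enc_phase hc).symm.trans hF) (by decide)
  have r13 := runs_sweep (D := D) (x := x) (φ := 13) degs rs (by simp [Adv]) (by simp [Comp])
    (o := 0) (h := fun y => (dev x 12 0 y : ℤ)) (w := fun _ => blk M) Ψ
  have r14 := runs_sweep (D := D) (x := x) (φ := 14) degs rs (by simp [Adv]) (by simp [Comp])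
    (o := T) (h := fun y => dev x 12 0 y + ∑ s ∈ Finset.range T, (dev x 13 (s + 1) y : ℤ))
    (w := fun _ => blk M) Ψ
  have r15 := runs_sweep (D := D) (x := x) (φ := 15) degs rs (by simp [Adv]) (by simp [Comp])
    (o := 0) (h := fun y => dev x 12 0 y + ∑ s ∈ Finset.range T, (dev x 13 (s + 1) y : ℤ) +
      ∑ s ∈ Finset.range T, (dev x 14 (T - (s + 1)) y : ℤ)) (w := fun _ => blk M) Ψ
  -- Only the phases 7 and 8 contribute signs, and only those from 12 to 15 count deviations.
  simp only [d, g, hR, hL, hTz, ← hT, Nat.cast_zero, Finset.sum_const_zero, Finset.prod_const_one,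
    diag_one, add_zero, zero_add, mul_one, mul_neg_one, add_neg_cancel, neg_add_cancel, diag_diag,
    ← sub_eq_add_neg, zero_sub, one_mul] at r6 r7 r8 r9 r13 r14 r15
  have r16 : Runs (pass M D degs rs) (finals M D)
      (entry x 16 (-T) (fun y => (cnt x T y : ℤ)) (fun _ => blk M) Ψ) 1
      (Finsupp.mapDomain (finalCfg D x) (finalData D x degs rs)) := by
    refine Runs.one ?_ fun c hc hF => ?_
    · rw [entry, if_neg (by simp [Adv])]
      have h16 : (sweep 16).toInt = 0 := rfl
      rw [h16, add_zero, loop_enc_write]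
      simp only [sw_left]
      rfl
    · exact absurd ((enc_phase hc).symm.trans hF) (by decide)
  have e15 : (fun y : Bool × M.Conf => (cnt x T y : ℤ)) = fun y => dev x 12 0 y +
      ∑ s ∈ Finset.range T, (dev x 13 (s + 1) y : ℤ) +
      ∑ s ∈ Finset.range T, (dev x 14 (T - (s + 1)) y : ℤ) +
      ∑ s ∈ Finset.range T, (dev x 15 (-(s + 1)) y : ℤ) := by
    funext y; simp only [cnt]; push_cast; rfl
  rw [e15] at r16
  have seg1 := ((r0.trans r5).trans (r6.trans r7)).trans (r8.trans r9)
  have seg2 := (r10.trans r11).trans (r12.trans r13)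
  have seg3 := (r14.trans r15).trans r16
  have := (seg1.trans seg2).trans seg3
  convert this using 1
  ring

end result

end SquaredFunction

/-! ### Acceptance probability of the squaring program -/

namespace SquaredFunction

open ComplexConjugate

section output
variable {M : QTM} {x : List Bool} {T R : ℕ} {y : Bool × M.Conf}

open Classical in
/-- The sign `-1` for the configurations that do not hold the symbol `1` in the start cell of the
output tape. -/
noncomputable def outSign (c : M.Conf) : ℂ :=
  if (c.tape M.outputTape 0 : M.Symb) = M.bit true then 1 else -1

/-- A factor `-1` occurs once, or not at all. -/
lemma prod_sign (T : ℕ) (a : ℤ) :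
    ∏ s ∈ Finset.range T, (if a = s then (-1 : ℂ) else 1) = if 0 ≤ a ∧ a < T then -1 else 1 := by
  by_cases h : 0 ≤ a ∧ a < T
  · rw [if_pos h, Finset.prod_eq_single a.toNat]
    · rw [if_pos (by omega)]
    · intro s _ hs
      rw [if_neg (by omega)]
    · intro hs
      rw [Finset.mem_range] at hs
      omega
  · rw [if_neg h]
    refine Finset.prod_eq_one fun s hs => if_neg ?_
    rw [Finset.mem_range] at hs
    omega

/-- During the sweep through the phases 7 and 8, the mark is seen exactly once. -/
lemma sweepSign_eq (hy : y ∈ Near M (M.init x) R) (hR : R < T) :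
    sweepSign T y = outSign y.2 := by
  classical
  have h1 := hy.1 M.outputTape
  rw [abs_le] at h1
  unfold sweepSign outSign
  by_cases hb : (y.2.tape M.outputTape 0 : M.Symb) = M.bit true
  · rw [if_pos hb]
    have : ∀ φ o, sgn φ o y = 1 := fun φ o => if_neg fun h => h.2.2 hb
    simp [this]
  · rw [if_neg hb]
    have e8 : ∀ s : ℕ, sgn 8 (-(s + 1)) y = if y.2.head M.outputTape - 1 = s then -1 else 1 :=
      fun s => if_congr ⟨fun h => by have := h.2.1; omega,
        fun h => ⟨Or.inr rfl, by omega, hb⟩⟩ rfl rfl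
    have e7 : ∀ s : ℕ, sgn 7 (T - (s + 1)) y =
        if y.2.head M.outputTape + T - 1 = s then -1 else 1 :=
      fun s => if_congr ⟨fun h => by have := h.2.1; omega,
        fun h => ⟨Or.inl rfl, by omega, hb⟩⟩ rfl rfl
    simp only [e7, e8, prod_sign]
    by_cases h0 : 1 ≤ y.2.head M.outputTape
    · rw [if_pos (by omega), if_neg (by omega), mul_one]
    · rw [if_neg (by omega), if_pos (by omega), one_mul]

lemma dev_init (φ : Fin 18) (o : ℤ) (h : φ = 12 → o = 0) : dev x φ o (true, M.init x) = 0 := by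
  refine if_neg ?_
  rintro (⟨h12, h' | h' | ⟨i, hi⟩⟩ | ⟨-, i, hi⟩)
  · simp at h'
  · exact h' rfl
  · rw [h h12] at hi
    exact hi rfl
  · refine hi ?_
    show (if i = M.inputTape then M.stringCell x (0 + o) else M.blank) = _
    rw [zero_add]

/-- No deviation is counted exactly for the initial configuration in copy `1`: the sweeps in the
phases 13, 14 and 15 see the cells to the right of the start, the start cell, and the cells to its
left, and the cells beyond their range are unchanged. -/
lemma cnt_eq_zero_iff (hy : y ∈ Near M (M.init x) R) (hR : R < T) :
    cnt x T y = 0 ↔ y = (true, M.init x) := by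
  constructor
  · intro h
    simp only [cnt, Nat.add_eq_zero_iff, Finset.sum_eq_zero_iff, Finset.mem_range] at h
    obtain ⟨⟨⟨h12, h13⟩, h14⟩, h15⟩ := h
    have k12 : ¬ (y.1 = false ∨ y.2.state ≠ M.q₀ ∨ ∃ i, y.2.head i + 0 ≠ 0) := fun h' => by
      rw [dev, if_pos (Or.inl ⟨rfl, h'⟩)] at h12
      exact one_ne_zero h12
    simp only [not_or, not_exists, not_not, add_zero, Bool.not_eq_false] at k12
    obtain ⟨hb, hq, hh⟩ := k12
    have key : ∀ (φ : Fin 18) (o : ℤ), (φ = 13 ∨ φ = 14 ∨ φ = 15) → dev x φ o y = 0 →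
        ∀ i, (y.2.tape i o : M.Symb) = (M.init x).tape i o := fun φ o hφ h i => by
      by_contra hne
      rw [dev, if_pos (Or.inr ⟨hφ, i, by rw [hh, zero_add]; exact hne⟩)] at h
      exact one_ne_zero h
    refine Prod.ext hb (QTM.Conf.ext hq (funext fun i => hh i) (funext fun i => funext fun z => ?_))
    by_cases hz : |z| ≤ R
    · rw [abs_le] at hz
      refine Subtype.ext ?_
      rcases lt_trichotomy z 0 with h0 | rfl | h0
      · have := h15 (-z - 1).toNat (by omega)
        rw [show (-(((-z - 1).toNat : ℕ) + 1) : ℤ) = z by omega] at this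
        exact key 15 z (by simp) this i
      · have := h14 (T - 1) (by omega)
        rw [show ((T : ℤ) - ((T - 1 : ℕ) + 1)) = 0 by omega] at this
        exact key 14 0 (by simp) this i
      · have := h13 (z - 1).toNat (by omega)
        rw [show (((z - 1).toNat : ℕ) + 1 : ℤ) = z by omega] at this
        exact key 13 z (by simp) this i
    · exact hy.2 i z (not_le.1 hz)
  · rintro rfl
    have h : ∀ φ : Fin 18, φ ≠ 12 → ∀ o, dev x φ o (true, M.init x) = 0 :=
      fun φ hφ o => dev_init φ o fun h => absurd h hφ
    rw [cnt, dev_init 12 0 fun _ => rfl]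
    simp only [h 13 (by decide), h 14 (by decide), h 15 (by decide), Finset.sum_const_zero,
      add_zero]

lemma init_near : (false, M.init x) ∈ Near M (M.init x) 0 :=
  ⟨fun _ => by simp [QTM.init], fun _ _ _ => rfl⟩

variable {D : ℕ} (degs : List ℕ) (rs : List (Fin M.k → ZMod 3))

lemma diag_near {c₀ : M.Conf} {s : Bool × M.Conf → ℂ} {Φ : Bool × M.Conf →₀ ℂ}
    (h : ∀ y, Φ y ≠ 0 → y ∈ Near M c₀ R) (y : Bool × M.Conf) (hy : diag s Φ y ≠ 0) :
    y ∈ Near M c₀ R := h y fun h0 => hy (by rw [diag_apply, h0, mul_zero])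

lemma diag_congr {X : Type*} {s s' : X → ℂ} {Φ : X →₀ ℂ} (h : ∀ y, Φ y ≠ 0 → s y = s' y) :
    diag s Φ = diag s' Φ := by
  ext y
  rw [diag_apply, diag_apply]
  by_cases hy : Φ y = 0
  · rw [hy, mul_zero, mul_zero]
  · rw [h y hy]

lemma single_init_near (y : Bool × M.Conf)
    (hy : Finsupp.single (false, M.init x) (1 : ℂ) y ≠ 0) : y ∈ Near M (M.init x) 0 := by
  have : y = (false, M.init x) := by
    by_contra hne
    exact hy (Finsupp.single_eq_of_ne hne)
  rw [this]; exact init_near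

lemma finalData_near (y : Bool × M.Conf) (hy : finalData D x degs rs y ≠ 0) :
    y ∈ Near M (M.init x) (4 * rs.length * (degs.map fun j => x.length ^ j).sum) := by
  have := G_pow_near rs _ (flip_near (diag_near (G_pow_near rs _ single_init_near))) y hy
  convert this using 1
  ring_nf

lemma diag_copy (s : M.Conf → ℂ) (b : Bool) (Φ : M.Conf →₀ ℂ) :
    diag (fun y : Bool × M.Conf => s y.2) (copy M b Φ) = copy M b (diag s Φ) := by
  refine map_mapDomain_of_single _ (Prod.mk b) (Prod.mk b) (diag s) (fun c => ?_) Φ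
  rw [diag_single, diag_single, Finsupp.mapDomain_single]

/-- The amplitude of the accepting configuration. The second power of `G` is moved to the left side
of the inner product, where it turns into a power of `U` on copy `1`. -/
lemma finalData_apply (hM : M.WellFormed) (hrs : rs.Nodup) (hrs' : ∀ r, r ∈ rs)
    (hT : 4 * rs.length * (degs.map fun j => x.length ^ j).sum < (2 * x.length + 2) ^ D) :
    finalData D x degs rs (true, M.init x) =
      ip ((M.U ^ (degs.map fun j => x.length ^ j).sum) (Finsupp.single (M.init x) 1))
        (diag outSign
          ((M.U ^ (degs.map fun j => x.length ^ j).sum) (Finsupp.single (M.init x) 1))) := by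
  set p := (degs.map fun j => x.length ^ j).sum with hp
  have h1 : finalData D x degs rs (true, M.init x) =
      ip (copy M true (Finsupp.single (M.init x) 1)) (finalData D x degs rs) := by
    rw [copy_single, ip_single_left, map_one, one_mul]
  have h2 : diag (sweepSign ((2 * x.length + 2) ^ D))
      ((G M rs ^ p) (Finsupp.single (false, M.init x) 1)) =
      diag (fun y => outSign y.2) ((G M rs ^ p) (Finsupp.single (false, M.init x) 1)) := by
    refine diag_congr fun y hy => sweepSign_eq (G_pow_near rs _ single_init_near y hy) ?_
    refine lt_of_le_of_lt ?_ hT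
    have : 2 * rs.length * p ≤ 4 * rs.length * p := by gcongr; norm_num
    omega
  rw [h1, finalData, ← hp, ip_copy_true_G_pow hM hrs hrs', h2, ← copy_single,
    G_pow_copy_false hM hrs hrs', diag_copy, flip_copy, Bool.not_false, ip_copy]

open Classical in
/-- Among the final configurations only that of `(true, M.init x)` is accepting. -/
lemma sum_mapDomain_finalCfg
    (hT : 4 * rs.length * (degs.map fun j => x.length ^ j).sum < (2 * x.length + 2) ^ D) :
    (Finsupp.mapDomain (finalCfg D x) (finalData D x degs rs)).sum (fun c a =>
      if c.st.φ = 17 ∧ (c.tp .out 0 : M.Symb) = M.bit true then ‖a‖ ^ 2 else 0) =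
      ‖finalData D x degs rs (true, M.init x)‖ ^ 2 := by
  have hacc : ∀ y, finalData D x degs rs y ≠ 0 →
      (((finalCfg D x y).st.φ = 17 ∧ ((finalCfg D x y).tp .out 0 : M.Symb) = M.bit true) ↔
        y = (true, M.init x)) := fun y hy => by
    rw [← cnt_eq_zero_iff (finalData_near degs rs y hy) hT]
    refine (and_iff_right rfl).trans ?_
    show ((Function.update (fun _ => blk M) (cnt x ((2 * x.length + 2) ^ D) y : ℤ) (one M) 0 :
      Sym M) : M.Symb) = M.bit true ↔ _
    rw [Function.update_apply]
    by_cases h0 : cnt x ((2 * x.length + 2) ^ D) y = 0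
    · rw [h0, if_pos Nat.cast_zero.symm]; exact iff_of_true rfl rfl
    · rw [if_neg fun h => h0 (by exact_mod_cast h.symm)]
      exact iff_of_false (fun h => M.bit_ne_blank true h.symm) h0
  have hinj : Function.Injective (finalCfg (M := M) D x) := fun y y' h => eq_of_emb_eq h
  rw [Finsupp.sum_mapDomain_index_inj hinj, Finsupp.sum,
    Finset.sum_congr rfl fun y hy => if_congr (hacc y (Finsupp.mem_support_iff.1 hy)) rfl rfl,
    Finset.sum_ite_eq']
  split_ifs with h
  · rfl
  · rw [Finsupp.notMem_support_iff.1 h, norm_zero, zero_pow two_ne_zero]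

end output

section final
variable {M : QTM}

/-- Configurations of nonzero amplitude are reached by computation paths. -/
lemma exists_isPath (c₀ : M.Conf) (t : ℕ) (c : M.Conf)
    (h : (M.U ^ t) (Finsupp.single c₀ 1) c ≠ 0) :
    ∃ γ, M.IsPath (Finsupp.single c₀ 1) t γ ∧ γ t = c := by
  induction t generalizing c with
  | zero =>
    exact ⟨fun _ => c, ⟨Finsupp.mem_support_iff.2 h, fun s hs => absurd hs (Nat.not_lt_zero s)⟩,
      rfl⟩
  | succ t ih =>
    rw [pow_succ', Module.End.mul_apply] at h
    obtain ⟨d, hd, hdc⟩ := exists_of_apply_ne_zero _ _ _ h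
    obtain ⟨γ, ⟨hγ0, hγ⟩, hγt⟩ := ih d hd
    refine ⟨fun s => if s ≤ t then γ s else c, ⟨by simpa using hγ0, fun s hs => ?_⟩, by simp⟩
    by_cases hst : s < t
    · simp only [if_pos hst.le, if_pos (Nat.succ_le_of_lt hst)]
      exact hγ s hst
    · obtain rfl : s = t := by omega
      simp only [le_refl, if_true, if_neg (Nat.not_succ_le_self s)]
      rw [hγt]
      exact hdc

/-- The probability gap as an expectation value. -/
lemma ip_outSign {x : List Bool} {t : ℕ}
    (h : M.HaltsAt (Finsupp.single (M.init x) 1) t) :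
    ip ((M.U ^ t) (Finsupp.single (M.init x) 1))
      (diag outSign ((M.U ^ t) (Finsupp.single (M.init x) 1))) =
      ((M.acceptProb x - M.rejectProb x : ℝ) : ℂ) := by
  classical
  rw [QTM.acceptProb, QTM.rejectProb, QTM.finalSuperposition, runningTime_eq h]
  set Ξ := (M.U ^ t) (Finsupp.single (M.init x) 1) with hΞ
  rw [Finsupp.sum, Finsupp.sum, ← Finset.sum_sub_distrib, Complex.ofReal_sum, ip_def,
    Finsupp.sum_of_support_subset (s := Ξ.support) _ (fun c hc => ?_) _ (by simp)]
  · refine Finset.sum_congr rfl fun c hc => ?_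
    obtain ⟨γ, hγ, hγt⟩ := exists_isPath _ t c (Finsupp.mem_support_iff.1 hc)
    have hfin : M.Final c := hγt ▸ h.1 γ hγ
    have hsq : Ξ c * conj (Ξ c) = ((‖Ξ c‖ ^ 2 : ℝ) : ℂ) := by
      rw [Complex.mul_conj, Complex.normSq_eq_norm_sq]
    rw [diag_apply, mul_assoc, hsq, outSign]
    by_cases hb : (c.tape M.outputTape 0 : M.Symb) = M.bit true
    · have ha : M.Accepting c := ⟨hfin, hb⟩
      rw [if_pos hb, if_pos ha, if_neg fun hr => hr.2 ha, sub_zero, one_mul]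
    · have ha : ¬ M.Accepting c := fun h => hb h.2
      rw [if_neg hb, if_neg ha, if_pos ⟨hfin, ha⟩, zero_sub, Complex.ofReal_neg, neg_one_mul]
  · rw [Finsupp.mem_support_iff, diag_apply] at hc
    exact Finsupp.mem_support_iff.2 (right_ne_zero_of_mul hc)

lemma Program.run_isom (P : Program M) (hg : ∀ i, Isom (P.g i).op) (m : ℕ) : Isom (P.run m) := by
  induction m with
  | zero => exact fun _ _ => rfl
  | succ m ih => exact (hg _).comp ih

/-- The period of a clock with sufficiently many heads exceeds a given polynomial. -/
lemma exists_period_gt (p : Polynomial ℕ) :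
    ∃ d, ∀ D ≥ d, ∀ n, p.eval n < (2 * n + 2) ^ D := by
  suffices h : ∃ d, ∀ n, p.eval n < (2 * n + 2) ^ d by
    obtain ⟨d, hd⟩ := h
    exact ⟨d, fun D hD n => (hd n).trans_le (Nat.pow_le_pow_right (by omega) hD)⟩
  induction p using Polynomial.induction_on' with
  | add p q hp hq =>
    obtain ⟨a, ha⟩ := hp
    obtain ⟨b, hb⟩ := hq
    refine ⟨max a b + 1, fun n => ?_⟩
    have h1 := (ha n).trans_le (Nat.pow_le_pow_right (by omega : 0 < 2 * n + 2) (le_max_left a b))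
    have h2 := (hb n).trans_le (Nat.pow_le_pow_right (by omega : 0 < 2 * n + 2) (le_max_right a b))
    rw [Polynomial.eval_add, pow_succ]
    nlinarith
  | monomial d a =>
    refine ⟨a + d, fun n => ?_⟩
    rw [Polynomial.eval_monomial, pow_add]
    refine Nat.mul_lt_mul_of_lt_of_le ?_ (Nat.pow_le_pow_left (by omega) d) (by positivity)
    exact (Nat.lt_two_pow_self).trans_le (Nat.pow_le_pow_left (by omega) a)

end final

end SquaredFunction

/-! ### The squared function theorem -/

namespace SquaredFunction

/-- The squaring program for a machine with gap `f` has acceptance probability `f ^ 2`. -/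
lemma sq_mem_sharpQP {K : Set ℂ} (hK : {0, 1, -1} ⊆ K) (hadm : Admissible K)
    {f : List Bool → ℝ} (hf : f ∈ GapQP K) : (fun x => f x ^ 2) ∈ SharpQP K := by
  classical
  obtain ⟨M, hM, ⟨p, hp⟩, hMK, hfM⟩ := hf
  obtain ⟨degs, hdegs⟩ := exists_degs p
  let rs : List (Fin M.k → ZMod 3) := Finset.univ.toList
  have hrs : rs.Nodup := Finset.nodup_toList _
  have hrs' : ∀ r, r ∈ rs := fun r => Finset.mem_toList.2 (Finset.mem_univ r)
  obtain ⟨d, hd⟩ := exists_period_gt (Polynomial.C (4 * rs.length) * p)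
  -- The period of the clock has to exceed the distance over which the two simulations spread, and
  -- there has to be a wheel for each degree, and at least one.
  let D := d + degs.sum + 1
  have hD : ∀ j ∈ degs, j ≤ D := fun j hj => by
    have := List.le_sum_of_mem hj
    omega
  have hT : ∀ n, 4 * rs.length * (degs.map fun j => n ^ j).sum < (2 * n + 2) ^ D := fun n => by
    have := hd D (by omega) n
    rwa [Polynomial.eval_mul, Polynomial.eval_C, ← hdegs] at this
  let P := prog M D degs rs
  have hg : ∀ i, Isom (P.g i).op := prog_isom D degs rs hM
  -- The number of passes through the program.
  let τ : ℕ → ℕ := fun n => 2 * n + 8 + 9 * (2 * n + 2) ^ D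
  have hrun : ∀ x : List Bool, Runs P.loop (finals M D) (Finsupp.single (P.start x) 1)
      (τ x.length) (Finsupp.mapDomain (finalCfg D x) (finalData D x degs rs)) := fun x => by
    have e : P.loop = pass M D degs rs := prog_loop M D degs rs
    rw [e]
    exact runs_prog degs rs (by omega : 0 < D) hD x
  have hloop : ∀ x t, ∃ c, (P.loop ^ t) (Finsupp.single (P.start x) 1) c ≠ 0 := fun x t => by
    have hne : (P.loop ^ t) (Finsupp.single (P.start x) 1) ≠ 0 := by
      rw [← P.run_mul]
      exact (P.run_isom hg _).ne_zero (by simp)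
    by_contra! hcon
    exact hne (Finsupp.ext hcon)
  have hhalt : ∀ n (φ : Qustring n), P.toQTM.HaltsAt (P.toQTM.initQ φ) ((P.n + 1) * τ n) := by
    intro n φ
    refine P.haltsAt hg ctl (prog_ctl D degs rs) (fun c d hcd => ?_) n (τ n) (fun x hx t ht => ?_)
      (fun x hx => ?_) φ
    · have h1 : c.st.φ = d.st.φ := congrArg Ctl.φ hcd
      show c.st.φ = 17 ↔ d.st.φ = 17
      rw [h1]
    · obtain ⟨c, hc⟩ := hloop x t
      exact ⟨c, hc, (hrun x).2 t (hx ▸ ht) c hc⟩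
    · obtain ⟨c, hc⟩ := hloop x (τ n)
      refine ⟨c, hc, ?_⟩
      rw [← hx, (hrun x).1] at hc
      obtain ⟨y, -, rfl⟩ := Finset.mem_image.1
        (Finsupp.mapDomain_support (Finsupp.mem_support_iff.2 hc))
      rfl
  refine ⟨P.toQTM, P.toQTM_wellFormed hg, ⟨Polynomial.C (P.n + 1) * (2 * Polynomial.X + 8 +
    9 * (2 * Polynomial.X + 2) ^ D), fun n φ => ?_⟩,
    P.toQTM_hasAmplitudes (hK (by simp)) (prog_amp_mem D degs rs hK hadm hMK), fun x => ?_⟩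
  · have := hhalt n φ
    simpa [τ] using this
  · have hMx : M.HaltsAt (Finsupp.single (M.init x) 1) (degs.map fun j => x.length ^ j).sum := by
      obtain ⟨φ, hφ⟩ := exists_qustring M x
      rw [← hφ, hdegs]
      exact hp _ φ
    have hrt : P.toQTM.runningTime (Finsupp.single (P.toQTM.init x) 1) =
        (P.n + 1) * τ x.length := by
      obtain ⟨φ, hφ⟩ := exists_qustring P.toQTM x
      rw [← hφ]
      exact runningTime_eq (hhalt _ φ)
    have hacc := P.acceptProb_eq x (τ x.length) hrt
    rw [(hrun x).1] at hacc
    have hsum := sum_mapDomain_finalCfg (x := x) degs rs (hT _)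
    refine Eq.symm (hacc.trans ((Eq.trans ?_ hsum).trans ?_))
    · exact Finset.sum_congr rfl fun c _ => if_congr Iff.rfl rfl rfl
    rw [finalData_apply degs rs hM hrs hrs' (hT _), ip_outSign hMx, Complex.norm_real,
      Real.norm_eq_abs, sq_abs]
    exact congrArg (· ^ 2) (hfM x).symm

end SquaredFunction

theorem mainTheorem1 (K : Set ℂ) (hK : {0, 1, -1} ⊆ K) (hadm : Admissible K)
    (f : List Bool → ℝ) (hf : f ∈ GapQP K) : (fun x => f x ^ 2) ∈ SharpQP K :=
  SquaredFunction.sq_mem_sharpQP hK hadm hf
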